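/- **Bloch theorem (no current in the absence of an external field).** Let $d\in\{1,2,3\}$, let $\mathcal R\subset\mathbb R^d$ be a lattice with a bounded unit cell $\Omega$, let $(e_\alpha)_{1\le\alpha\le d}$ be a (not necessarily orthonormal) basis of $\mathbb R^d$, and let $\mathcal A\in L^4_{\rm loc}(\mathbb R^d;\mathbb R^d)$ and $V\in L^2_{\rm loc}(\mathbb R^d;\mathbb R)$ be $\mathcal R$-periodic, with $\nabla\cdot\mathcal A=0$ in the sense of distributions. Let $\mu_{\rm F}\in\mathbb R$, and on $L^2(\mathbb R^d;\mathbb C)$ let $$H=\tfrac12(-i\nabla+\mathcal A)^2+V,\qquad H^\varepsilon_\beta=H+\varepsilon\,x\cdot e_\beta,\qquad J_\alpha=-(-i\nabla+\mathcal A)\cdot e_\alpha$$ (closures of the operators defined on $C^\infty_{\rm c}(\mathbb R^d;\mathbb C)$), and let $$\gamma(0)=\mathbb 1(H\le\mu_{\rm F}),\qquad \gamma^\varepsilon_\beta(t)=e^{-itH^\varepsilon_\beta}\,\gamma(0)\,e^{itH^\varepsilon_\beta}.$$ A bounded operator $B$ on $L^2(\mathbb R^d;\mathbb C)$ belongs to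 $\mathfrak S_{1,\rm per}$ if it commutes with the translations by vectors of $\mathcal R$ and $\chi|B|\chi$ is trace class for every compactly supported $\chi\in L^\infty(\mathbb R^d;\mathbb C)$; its trace per unit volume is $\underline{\rm Tr}(B)=|\Omega|^{-1}\,{\rm Tr}(\mathbb 1_\Omega B\mathbb 1_\Omega)$. The current is $j^\varepsilon_{\alpha,\beta}(t)=\underline{\rm Tr}\big(J_\alpha\gamma^\varepsilon_\beta(t)\big)$. Then $H$ is self-adjoint, and for all $\alpha,\beta\in\{1,\dots,d\}$: 1. for all $t\ge0$, $J_\alpha\gamma^0_\beta(t)$ is a bounded operator in $\mathfrak S_{1,\rm per}$ and $j^0_{\alpha,\beta}(t)=0$; 2. for all $\varepsilon\ge0$, $J_\alpha\gamma^\varepsilon_\beta(0)$ is a bounded operator in $\mathfrak S_{1,\rm per}$ and $j^\varepsilon_{\alpha,\beta}(0)=0$. -/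

import Mathlib

open MeasureTheory Set
open scoped ContDiff InnerProductSpace

noncomputable section

namespace BlochCurrent

/-! ### Bounded operators: trace class and trace -/

section HilbertSpace

variable {𝓗 : Type*} [NormedAddCommGroup 𝓗] [InnerProductSpace ℂ 𝓗] [CompleteSpace 𝓗]

/-- The absolute value `|T| = (T* T)^{1/2}` of a bounded operator. -/
def absOp (T : 𝓗 →L[ℂ] 𝓗) : 𝓗 →L[ℂ] 𝓗 := CFC.abs T

/-- A bounded operator `T` is trace class if `Tr |T| < ∞`, where `|T| = (T* T)^{1/2}` and the
trace of the nonnegative operator `|T|` is computed in an orthonormal basis (its value does not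
depend on the basis). -/
def IsTraceClass (T : 𝓗 →L[ℂ] 𝓗) : Prop :=
  ∃ (w : Set 𝓗) (b : HilbertBasis w ℂ 𝓗), Summable fun i => (⟪b i, absOp T (b i)⟫_ℂ).re

variable (𝓗) in
/-- The index set of an orthonormal basis of `𝓗`. -/
def onbIndex : Set 𝓗 := (exists_hilbertBasis ℂ 𝓗).choose

variable (𝓗) in
/-- An orthonormal basis of `𝓗`. -/
def onb : HilbertBasis (onbIndex 𝓗) ℂ 𝓗 := (exists_hilbertBasis ℂ 𝓗).choose_spec.choose

/-- The trace `Tr T = ∑ᵢ ⟨bᵢ, T bᵢ⟩` of a trace class operator. -/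
def trace (T : 𝓗 →L[ℂ] 𝓗) : ℂ := ∑' i, ⟪onb 𝓗 i, T (onb 𝓗 i)⟫_ℂ

/-! ### Spectral measures and functional calculus of self-adjoint operators -/

variable (𝓗) in
/-- A projection-valued measure on the Borel sets of `ℝ`. -/
structure ProjectionValuedMeasure where
  /-- the projection attached to a set -/
  proj : Set ℝ → 𝓗 →L[ℂ] 𝓗
  isStarProjection : ∀ B, MeasurableSet B → IsStarProjection (proj B)
  proj_univ : proj univ = 1
  proj_inter : ∀ B C, MeasurableSet B → MeasurableSet C → proj (B ∩ C) = proj B * proj C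
  hasSum : ∀ B : ℕ → Set ℝ, (∀ n, MeasurableSet (B n)) → Pairwise (Function.onFun Disjoint B) →
    ∀ ψ : 𝓗, HasSum (fun n => proj (B n) ψ) (proj (⋃ n, B n) ψ)

namespace ProjectionValuedMeasure

variable (E : ProjectionValuedMeasure 𝓗)

theorem proj_empty (ψ : 𝓗) : E.proj ∅ ψ = 0 := by
  have h := (E.hasSum (fun _ => ∅) (fun _ => MeasurableSet.empty)
    (fun i j _ => by simp [Function.onFun]) ψ).summable
  exact (summable_const_iff (E.proj ∅ ψ)).1 h

theorem inner_nonneg {B : Set ℝ} (hB : MeasurableSet B) (ψ : 𝓗) :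
    0 ≤ (⟪ψ, E.proj B ψ⟫_ℂ).re :=
  ((ContinuousLinearMap.nonneg_iff_isPositive _).1
    (E.isStarProjection B hB).nonneg).re_inner_nonneg_right ψ

/-- The scalar spectral measure `B ↦ ⟨ψ, E(B) ψ⟩`. -/
def scalarMeasure (ψ : 𝓗) : Measure ℝ :=
  Measure.ofMeasurable (fun B _ => ENNReal.ofReal (⟪ψ, E.proj B ψ⟫_ℂ).re)
    (by simp [E.proj_empty])
    (by
      intro B hB hd
      have h := (Complex.hasSum_re (((E.hasSum B hB hd ψ).mapL (innerSL ℂ ψ))))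
      have h' : HasSum (fun n => (⟪ψ, E.proj (B n) ψ⟫_ℂ).re)
        (⟪ψ, E.proj (⋃ n, B n) ψ⟫_ℂ).re := by simpa using h
      rw [← h'.tsum_eq]
      exact ENNReal.ofReal_tsum_of_nonneg (fun n => E.inner_nonneg (hB n) ψ) h'.summable)

/-- `E` is the spectral measure of the operator `T`, i.e. `T = ∫ s dE(s)`:
`D(T) = {ψ | ∫ s² d⟨ψ, E(s) ψ⟩ < ∞}` and `⟨ψ, T ψ⟩ = ∫ s d⟨ψ, E(s) ψ⟩` for `ψ ∈ D(T)`. -/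
def IsSpectralMeasureOf (T : 𝓗 →ₗ.[ℂ] 𝓗) : Prop :=
  (∀ ψ : 𝓗, ψ ∈ T.domain ↔ ∫⁻ s, ENNReal.ofReal (s ^ 2) ∂(E.scalarMeasure ψ) < ⊤) ∧
  ∀ ψ : T.domain, ⟪(ψ : 𝓗), T ψ⟫_ℂ = ((∫ s, s ∂(E.scalarMeasure (ψ : 𝓗)) : ℝ) : ℂ)

end ProjectionValuedMeasure

/-- By the spectral theorem, this holds for every self-adjoint operator `T`. -/
def HasSpectralMeasure (T : 𝓗 →ₗ.[ℂ] 𝓗) : Prop :=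
  ∃ E : ProjectionValuedMeasure 𝓗, E.IsSpectralMeasureOf T

open Classical in
/-- The spectral projection `𝟙(T ≤ μ)` of a self-adjoint operator `T`. -/
def spectralProjectionLE (T : 𝓗 →ₗ.[ℂ] 𝓗) (μ : ℝ) : 𝓗 →L[ℂ] 𝓗 :=
  if h : HasSpectralMeasure T then h.choose.proj (Iic μ) else 0

open Classical in
/-- The unitary operator `e^{i t T} = ∫ e^{i t s} dE(s)` of a self-adjoint operator `T` with
spectral measure `E`: the bounded operator `U` such that `⟨ψ, U ψ⟩ = ∫ e^{i t s} d⟨ψ, E(s) ψ⟩`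
for every `ψ`. -/
def expI (T : 𝓗 →ₗ.[ℂ] 𝓗) (t : ℝ) : 𝓗 →L[ℂ] 𝓗 :=
  if h : ∃ hT : HasSpectralMeasure T, ∃ U : 𝓗 →L[ℂ] 𝓗, ∀ ψ : 𝓗,
      ⟪ψ, U ψ⟫_ℂ = ∫ s : ℝ, Complex.exp (Complex.I * t * s) ∂(hT.choose.scalarMeasure ψ)
  then h.choose_spec.choose else 1

end HilbertSpace

/-! ### The physical space, periodic functions, test functions -/

/-- The physical space `ℝ^d`. -/
abbrev Space (d : ℕ) : Type := EuclideanSpace ℝ (Fin d)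

/-- The Hilbert space `L²(ℝ^d; ℂ)`. -/
abbrev L2 (d : ℕ) : Type := Lp ℂ 2 (volume : Measure (Space d))

/-- `f ∈ L^p_per`: `f` is periodic with respect to the lattice `R` and locally in `L^p`. -/
def IsPeriodicLp {d : ℕ} {F : Type*} [NormedAddCommGroup F] (R : Submodule ℤ (Space d))
    (p : ENNReal) (f : Space d → F) : Prop :=
  (∀ r ∈ R, ∀ᵐ x : Space d, f (x + r) = f x) ∧
  ∀ K : Set (Space d), IsCompact K → MemLp f p (volume.restrict K)

/-- `φ ∈ C_c^∞(ℝ^d; F)`. -/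
def IsTest {d : ℕ} {F : Type*} [NormedAddCommGroup F] [NormedSpace ℝ F]
    (φ : Space d → F) : Prop :=
  ContDiff ℝ ∞ φ ∧ HasCompactSupport φ

/-- The Coulomb gauge condition `∇ · A = 0` in the sense of distributions
(`fderiv ℝ φ x (A x)` is `A(x) · ∇φ(x)`). -/
def IsDivFree {d : ℕ} (A : Space d → Space d) : Prop :=
  ∀ φ : Space d → ℝ, IsTest φ → ∫ x, fderiv ℝ φ x (A x) = 0

theorem IsTest.laplacian_sum {d : ℕ} {φ χ : Space d → ℂ} (hφ : IsTest φ) (hχ : IsTest χ)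
    (x : Space d) : Laplacian.laplacian (φ + χ) x =
      Laplacian.laplacian φ x + Laplacian.laplacian χ x :=
  ((hφ.1.of_le (WithTop.coe_le_coe.2 le_top)).contDiffAt).laplacian_add
    ((hχ.1.of_le (WithTop.coe_le_coe.2 le_top)).contDiffAt)

theorem IsTest.fderiv_sum {d : ℕ} {φ χ : Space d → ℂ} (hφ : IsTest φ) (hχ : IsTest χ)
    (x v : Space d) : fderiv ℝ (φ + χ) x v = fderiv ℝ φ x v + fderiv ℝ χ x v := by
  rw [fderiv_add (hφ.1.differentiable (by simp) x) (hχ.1.differentiable (by simp) x)]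
  rfl

theorem IsTest.laplacian_scale {d : ℕ} {φ : Space d → ℂ} (hφ : IsTest φ) (c : ℂ)
    (x : Space d) : Laplacian.laplacian (c • φ) x =
      c * Laplacian.laplacian φ x :=
  InnerProductSpace.laplacian_smul c ((hφ.1.of_le (WithTop.coe_le_coe.2 le_top)).contDiffAt)

theorem IsTest.fderiv_scale {d : ℕ} {φ : Space d → ℂ} (hφ : IsTest φ) (c : ℂ)
    (x v : Space d) : fderiv ℝ (c • φ) x v = c * fderiv ℝ φ x v := by
  rw [fderiv_const_smul (hφ.1.differentiable (by simp) x)]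
  rfl

theorem IsTest.sum {d : ℕ} {φ χ : Space d → ℂ} (hφ : IsTest φ) (hχ : IsTest χ) :
    IsTest (φ + χ) := ⟨hφ.1.add hχ.1, hφ.2.add hχ.2⟩

theorem IsTest.scale {d : ℕ} {φ : Space d → ℂ} (hφ : IsTest φ) (c : ℂ) :
    IsTest (c • φ) := ⟨contDiff_const.smul hφ.1, hφ.2.smul_left (f := fun _ => c)⟩

theorem IsTest.zero {d : ℕ} : IsTest (0 : Space d → ℂ) :=
  ⟨contDiff_const, HasCompactSupport.zero⟩

/-! ### The Hamiltonian and the current operator on `C_c^∞` -/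

/-- `(½ (-i∇ + A)² + W) φ` for `φ ∈ C_c^∞`, expanded using `∇ · A = 0`:
`-½ Δφ - i A · ∇φ + (½ |A|² + W) φ`. -/
def hamiltonianFun {d : ℕ} (A : Space d → Space d) (W : Space d → ℝ) (φ : Space d → ℂ)
    (x : Space d) : ℂ :=
  -(1 / 2) * Laplacian.laplacian φ x - Complex.I * fderiv ℝ φ x (A x) +
    ((1 / 2 * ‖A x‖ ^ 2 + W x : ℝ) : ℂ) * φ x

/-- `-((-i∇ + A) · v) φ` for `φ ∈ C_c^∞`. -/
def currentFun {d : ℕ} (A : Space d → Space d) (v : Space d) (φ : Space d → ℂ)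
    (x : Space d) : ℂ :=
  -(-Complex.I * fderiv ℝ φ x v + ((⟪A x, v⟫_ℝ : ℝ) : ℂ) * φ x)

/-- The graph in `L² × L²` of a differential expression `D` that is linear on `C_c^∞`. -/
def testGraph {d : ℕ} (D : (Space d → ℂ) → Space d → ℂ)
    (hadd : ∀ φ χ, IsTest φ → IsTest χ → ∀ x, D (φ + χ) x = D φ x + D χ x)
    (hsmul : ∀ (c : ℂ) φ, IsTest φ → ∀ x, D (c • φ) x = c * D φ x) :
    Submodule ℂ (L2 d × L2 d) where
  carrier := {p | ∃ φ : Space d → ℂ, IsTest φ ∧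
    ⇑p.1 =ᵐ[(volume : Measure (Space d))] φ ∧ ⇑p.2 =ᵐ[(volume : Measure (Space d))] D φ}
  zero_mem' := by
    refine ⟨0, IsTest.zero, Lp.coeFn_zero _ _ _, ?_⟩
    have h : D 0 = 0 := by
      funext x
      have := hsmul 0 0 IsTest.zero x
      simpa using this
    rw [h]
    exact Lp.coeFn_zero _ _ _
  add_mem' := by
    rintro p q ⟨φ, hφ, h1, h2⟩ ⟨χ, hχ, h3, h4⟩
    refine ⟨φ + χ, hφ.sum hχ, (Lp.coeFn_add _ _).trans (h1.add h3), ?_⟩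
    refine (Lp.coeFn_add _ _).trans ((h2.add h4).trans (.of_forall fun x => ?_))
    exact (hadd φ χ hφ hχ x).symm
  smul_mem' := by
    rintro c p ⟨φ, hφ, h1, h2⟩
    refine ⟨c • φ, hφ.scale c, (Lp.coeFn_smul _ _).trans (h1.const_smul c), ?_⟩
    refine (Lp.coeFn_smul _ _).trans ((h2.const_smul c).trans (.of_forall fun x => ?_))
    exact (hsmul c φ hφ x).symm

/-- The operator `½ (-i∇ + A)² + W` on `L²(ℝ^d; ℂ)`: closure of its restriction to `C_c^∞`. -/
def hamiltonian {d : ℕ} (A : Space d → Space d) (W : Space d → ℝ) : L2 d →ₗ.[ℂ] L2 d :=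
  (testGraph (hamiltonianFun A W)
    (fun φ χ hφ hχ x => by
      simp only [hamiltonianFun, hφ.laplacian_sum hχ, hφ.fderiv_sum hχ, Pi.add_apply]; ring)
    (fun c φ hφ x => by
      simp only [hamiltonianFun, hφ.laplacian_scale, hφ.fderiv_scale, Pi.smul_apply,
        smul_eq_mul]; ring)).toLinearPMap.closure

/-- The current operator `J = -(-i∇ + A) · v` on `L²(ℝ^d; ℂ)` along the vector `v`: closure of its
restriction to `C_c^∞`. -/
def currentOperator {d : ℕ} (A : Space d → Space d) (v : Space d) : L2 d →ₗ.[ℂ] L2 d :=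
  (testGraph (currentFun A v)
    (fun φ χ hφ hχ x => by
      simp only [currentFun, hφ.fderiv_sum hχ, Pi.add_apply]; ring)
    (fun c φ hφ x => by
      simp only [currentFun, hφ.fderiv_scale, Pi.smul_apply, smul_eq_mul]; ring)).toLinearPMap.closure

/-! ### The state of the electrons -/

/-- The Hamiltonian `H^ε_β = H + ε x · v` with electric field of strength `ε` along `v = e_β`. -/
def fieldHamiltonian {d : ℕ} (A : Space d → Space d) (V : Space d → ℝ) (v : Space d) (ε : ℝ) :
    L2 d →ₗ.[ℂ] L2 d :=
  hamiltonian A (fun x => V x + ε * ⟪x, v⟫_ℝ)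

/-- The ground-state density matrix `γ(0) = 𝟙(H ≤ μ_F)`. -/
def groundState {d : ℕ} (A : Space d → Space d) (V : Space d → ℝ) (μF : ℝ) : L2 d →L[ℂ] L2 d :=
  spectralProjectionLE (hamiltonian A V) μF

/-- The state `γ^ε_β(t) = e^{-i t H^ε_β} γ(0) e^{i t H^ε_β}`, where `v = e_β`. -/
def densityMatrix {d : ℕ} (A : Space d → Space d) (V : Space d → ℝ) (μF : ℝ) (v : Space d)
    (ε t : ℝ) : L2 d →L[ℂ] L2 d :=
  expI (fieldHamiltonian A V v ε) (-t) * groundState A V μF *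
    expI (fieldHamiltonian A V v ε) t

/-! ### Trace per unit volume -/

/-- The translation `(τ_r φ)(x) = φ(x - r)` on `L²`. -/
def translation {d : ℕ} (r : Space d) : L2 d →L[ℂ] L2 d :=
  (Lp.compMeasurePreservingₗᵢ ℂ (fun x : Space d => x - r)
    (measurePreserving_sub_right volume r)).toContinuousLinearMap

open Classical in
/-- The operator of multiplication by `χ ∈ L^∞` on `L²`. -/
def mulOp {d : ℕ} (χ : Space d → ℂ) : L2 d →L[ℂ] L2 d :=
  if h : MemLp χ ⊤ (volume : Measure (Space d)) then
    (ContinuousLinearMap.mul ℂ ℂ).holderL volume ⊤ 2 2 (h.toLp χ) else 0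

/-- A bounded operator is `R`-periodic if it commutes with all translations by vectors of `R`. -/
def IsPeriodicOp {d : ℕ} (R : Submodule ℤ (Space d)) (B : L2 d →L[ℂ] L2 d) : Prop :=
  ∀ r ∈ R, Commute B (translation r)

/-- `χ B χ` is trace class for all compactly supported `χ ∈ L^∞`. -/
def IsLocallyTraceClass {d : ℕ} (B : L2 d →L[ℂ] L2 d) : Prop :=
  ∀ χ : Space d → ℂ, MemLp χ ⊤ (volume : Measure (Space d)) → HasCompactSupport χ →
    IsTraceClass (mulOp χ * B * mulOp χ)

/-- The space `𝔖_{1,per}`: periodic bounded operators `B` such that `|B|` is locally trace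
class. -/
def MemSOnePer {d : ℕ} (R : Submodule ℤ (Space d)) (B : L2 d →L[ℂ] L2 d) : Prop :=
  IsPeriodicOp R B ∧ IsLocallyTraceClass (absOp B)

/-- The trace per unit volume `|Ω|⁻¹ Tr (𝟙_Ω B 𝟙_Ω)`, where `Ω` is a unit cell. -/
def tracePerVolume {d : ℕ} (Ω : Set (Space d)) (B : L2 d →L[ℂ] L2 d) : ℂ :=
  ((volume.real Ω : ℝ) : ℂ)⁻¹ *
    trace (mulOp (Ω.indicator fun _ => 1) * B * mulOp (Ω.indicator fun _ => 1))

/-- `Ω` is a (bounded) unit cell of the lattice `R`. -/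
def IsUnitCell {d : ℕ} (R : Submodule ℤ (Space d)) (Ω : Set (Space d)) : Prop :=
  Bornology.IsBounded Ω ∧ IsAddFundamentalDomain R Ω (volume : Measure (Space d))

/-- The current along `a` at time `t`, for the field strength `ε` along `b`, is well defined and
equal to `j`: the product `J_a γ^ε_b(t)` is an everywhere defined bounded operator `B`, it belongs
to `𝔖_{1,per}`, and its trace per unit volume is `j`. (`B` is determined by `a`, `b`, `ε`, `t`, so
that there is at most one such `j`.) -/
def HasCurrent {d : ℕ} (R : Submodule ℤ (Space d)) (Ω : Set (Space d)) (A : Space d → Space d)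
    (V : Space d → ℝ) (μF : ℝ) (a b : Space d) (ε t : ℝ) (j : ℂ) : Prop :=
  ∃ B : L2 d →L[ℂ] L2 d,
    (∀ ψ : L2 d, (densityMatrix A V μF b ε t ψ, B ψ) ∈ (currentOperator A a).graph) ∧
    MemSOnePer R B ∧ tracePerVolume Ω B = j

end BlochCurrent

end

/-! Both assertions concern one operator. At ε = 0 the evolution is generated by H, which commutes
with its own spectral projections, and at t = 0 there is no evolution, so in both cases the state is
γ = 𝟙(H ≤ μ) (`densityMatrix_zero_field`, `densityMatrix_zero_time`). It remains to see that Jγ is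
bounded, lies in 𝔖_{1,per} and has zero trace per unit volume (`exists_current_proj_Iic`).

The trace vanishes by a variational argument of Bohm type (`cellTrace_eq_zero`). Let U_s be
multiplication by e^{i s v·x}. Completing the square gives U_s* H U_s = H − sJ + s²|v|²/2
(`hamiltonianFun_gauge`). The plane wave is not periodic, but it commutes with translations up to a
phase, so γ_s = U_s γ U_s* is again a periodic projection. Put K = (H − μ)γ ≤ 0. The energy per unit
volume of γ_s is Tr K − s Tr(Jγ) + s²|v|²/2 · Tr γ; it is at least Tr(γ_s K γ_s), which is at least
Tr K because K ≤ 0 and γ_s is a projection. This holds for s of both signs, so the linear term is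
zero. The manipulations of traces rest on cyclicity of the trace per unit volume, which is polarised
from the fact that the Hilbert–Schmidt norm of a periodic operator over one cell does not change
under taking adjoints (`hsNormSq_adjoint_mul`).

The analytic input uses d ≤ 3. Fourier inversion bounds ‖φ‖_∞ by ‖(−½Δ + e)φ‖₂ with a constant
tending to 0 as e → ∞ (`enorm_sq_le_supConst`, `exists_supConst_le`), and a Gagliardo–Nirenberg
inequality then bounds ∇φ in L⁴. Localising to translates of the unit cell (`exists_localization`)
makes the terms containing A and V a small perturbation of −½Δ + e
(`exists_l2sq_fieldTerm_le_quarter`). This yields self-adjointness, a lower bound on H, relative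
boundedness of J, and a sup bound on the domain of H. By the last one γ maps L² into L^∞, hence is
locally Hilbert–Schmidt, and χ|Jγ|χ is a product of two Hilbert–Schmidt operators.

The spectral theorem is never invoked. A spectral measure enters only through quadratic forms, from
which operator statements are recovered by polarisation; if no spectral measure exists, γ is 0 by
definition and the claim is trivial. -/

noncomputable section

namespace BlochCurrent

/-! ### Spectral measures: from quadratic forms to operator statements. -/

section HilbertSpace

variable {𝓗 : Type*} [NormedAddCommGroup 𝓗] [InnerProductSpace ℂ 𝓗] [CompleteSpace 𝓗]

namespace ProjectionValuedMeasure

variable (E : ProjectionValuedMeasure 𝓗) {B C : Set ℝ}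

theorem inner_proj_left (hB : MeasurableSet B) (x y : 𝓗) :
    ⟪E.proj B x, y⟫_ℂ = ⟪x, E.proj B y⟫_ℂ :=
  (ContinuousLinearMap.isSelfAdjoint_iff_isSymmetric.1
    (E.isStarProjection B hB).isSelfAdjoint) x y

theorem proj_proj (hB : MeasurableSet B) (hC : MeasurableSet C) (x : 𝓗) :
    E.proj B (E.proj C x) = E.proj (B ∩ C) x := by
  rw [E.proj_inter B C hB hC]; rfl

theorem proj_proj_self (hB : MeasurableSet B) (x : 𝓗) :
    E.proj B (E.proj B x) = E.proj B x := by
  rw [E.proj_proj hB hB, inter_self]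

theorem proj_proj_of_disjoint (hB : MeasurableSet B) (hC : MeasurableSet C)
    (h : Disjoint B C) (x : 𝓗) : E.proj B (E.proj C x) = 0 := by
  rw [E.proj_proj hB hC, h.inter_eq, E.proj_empty]

theorem inner_proj_self (hB : MeasurableSet B) (x : 𝓗) :
    ⟪x, E.proj B x⟫_ℂ = ((‖E.proj B x‖ ^ 2 : ℝ) : ℂ) := by
  rw [← E.proj_proj_self hB, ← E.inner_proj_left hB, E.proj_proj_self hB,
    inner_self_eq_norm_sq_to_K]
  norm_cast

theorem scalarMeasure_apply (hB : MeasurableSet B) (ψ : 𝓗) :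
    E.scalarMeasure ψ B = ENNReal.ofReal (‖E.proj B ψ‖ ^ 2) := by
  rw [scalarMeasure, Measure.ofMeasurable_apply _ hB, E.inner_proj_self hB, Complex.ofReal_re]

theorem scalarMeasure_univ (ψ : 𝓗) :
    E.scalarMeasure ψ univ = ENNReal.ofReal (‖ψ‖ ^ 2) := by
  rw [E.scalarMeasure_apply MeasurableSet.univ, E.proj_univ]; rfl

instance (ψ : 𝓗) : IsFiniteMeasure (E.scalarMeasure ψ) :=
  ⟨by rw [E.scalarMeasure_univ]; exact ENNReal.ofReal_lt_top⟩

theorem scalarMeasure_real_univ (ψ : 𝓗) : (E.scalarMeasure ψ).real univ = ‖ψ‖ ^ 2 := by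
  rw [Measure.real, E.scalarMeasure_univ, ENNReal.toReal_ofReal (by positivity)]

theorem proj_eq_zero_iff (hB : MeasurableSet B) (ψ : 𝓗) :
    E.proj B ψ = 0 ↔ E.scalarMeasure ψ B = 0 := by
  rw [E.scalarMeasure_apply hB, ENNReal.ofReal_eq_zero]
  constructor
  · intro h; simp [h]
  · intro h
    have : ‖E.proj B ψ‖ ^ 2 = 0 := le_antisymm h (by positivity)
    simpa using this

theorem scalarMeasure_proj (hC : MeasurableSet C) (ψ : 𝓗) :
    E.scalarMeasure (E.proj C ψ) = (E.scalarMeasure ψ).restrict C := by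
  ext S hS
  rw [E.scalarMeasure_apply hS, Measure.restrict_apply hS, E.scalarMeasure_apply (hS.inter hC),
    E.proj_proj hS hC]

theorem proj_add_proj_compl (hB : MeasurableSet B) (x : 𝓗) :
    E.proj B x + E.proj Bᶜ x = x := by
  -- Finite additivity is σ-additivity for the sequence B, Bᶜ, ∅, ∅, ….
  have h := E.hasSum (fun n => if n = 0 then B else if n = 1 then Bᶜ else ∅)
    (fun n => by
      split_ifs
      exacts [hB, hB.compl, MeasurableSet.empty])
    (fun i j hij => by
      simp only [Function.onFun]
      split_ifs <;> simp_all [disjoint_compl_right, disjoint_compl_left]) x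
  have h2 : (⋃ n : ℕ, if n = 0 then B else if n = 1 then Bᶜ else ∅) = univ := by
    ext s
    simp only [mem_iUnion, mem_univ, iff_true]
    by_cases hs : s ∈ B
    · exact ⟨0, by simpa using hs⟩
    · exact ⟨1, by simpa using hs⟩
  rw [h2, E.proj_univ] at h
  have h3 := hasSum_sum_of_ne_finset_zero (L := SummationFilter.unconditional ℕ) (s := Finset.range 2)
    (f := fun n : ℕ => E.proj (if n = 0 then B else if n = 1 then Bᶜ else ∅) x) (by
      intro n hn
      have h0 : n ≠ 0 := by rintro rfl; simp at hn
      have h1 : n ≠ 1 := by rintro rfl; simp at hn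
      simp [h0, h1, E.proj_empty])
  have := h3.unique h
  simpa [Finset.sum_range_succ] using this

theorem inner_proj_of_disjoint (hB : MeasurableSet B) (hC : MeasurableSet C)
    (h : Disjoint B C) (x y : 𝓗) : ⟪E.proj B x, E.proj C y⟫_ℂ = 0 := by
  rw [E.inner_proj_left hB, E.proj_proj_of_disjoint hB hC h, inner_zero_right]

/-- Pythagoras: ψ ↦ ⟨ψ, E(S)ψ⟩ is quadratic, but the cross terms vanish between spectral subspaces
of disjoint sets. This is the source of all the polarisation arguments below. -/
theorem scalarMeasure_add (hB : MeasurableSet B) (hC : MeasurableSet C)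
    (h : Disjoint B C) (x y : 𝓗) :
    E.scalarMeasure (E.proj B x + E.proj C y) =
      E.scalarMeasure (E.proj B x) + E.scalarMeasure (E.proj C y) := by
  ext S hS
  rw [Measure.add_apply, E.scalarMeasure_apply hS, E.scalarMeasure_apply hS,
    E.scalarMeasure_apply hS, ← ENNReal.ofReal_add (by positivity) (by positivity), map_add,
    E.proj_proj hS hB, E.proj_proj hS hC, sq, norm_add_sq_eq_norm_sq_add_norm_sq_of_inner_eq_zero
    (𝕜 := ℂ), sq, sq]
  exact E.inner_proj_of_disjoint (hS.inter hB) (hS.inter hC)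
    (h.mono inter_subset_right inter_subset_right) x y

theorem norm_sq_eq_add (hB : MeasurableSet B) (x : 𝓗) :
    ‖x‖ ^ 2 = ‖E.proj B x‖ ^ 2 + ‖E.proj Bᶜ x‖ ^ 2 := by
  conv_lhs => rw [← E.proj_add_proj_compl hB x]
  rw [sq, norm_add_sq_eq_norm_sq_add_norm_sq_of_inner_eq_zero (𝕜 := ℂ), sq, sq]
  exact E.inner_proj_of_disjoint hB hB.compl disjoint_compl_right x x

theorem norm_proj_le (hB : MeasurableSet B) (x : 𝓗) : ‖E.proj B x‖ ≤ ‖x‖ := by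
  have := E.norm_sq_eq_add hB x
  nlinarith [norm_nonneg x, norm_nonneg (E.proj B x), sq_nonneg ‖E.proj Bᶜ x‖]

/-- Vectors with bounded spectral support are dense. -/
theorem exists_proj_Icc_near (x : 𝓗) {ε : ℝ} (hε : 0 < ε) :
    ∃ n : ℕ, ‖x - E.proj (Icc (-n : ℝ) n) x‖ < ε := by
  have hanti : Antitone fun n : ℕ => (Icc (-n : ℝ) n)ᶜ := fun m n hmn =>
    compl_subset_compl.2 (Icc_subset_Icc (neg_le_neg (Nat.cast_le.2 hmn)) (Nat.cast_le.2 hmn))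
  have hlim := tendsto_measure_iInter_atTop (μ := E.scalarMeasure x)
    (s := fun n : ℕ => (Icc (-n : ℝ) n)ᶜ)
    (fun n => measurableSet_Icc.compl.nullMeasurableSet) hanti ⟨0, measure_ne_top _ _⟩
  have hI : (⋂ n : ℕ, (Icc (-n : ℝ) n)ᶜ) = ∅ := by
    ext s
    simp only [mem_iInter, mem_compl_iff, mem_Icc, not_and_or, mem_empty_iff_false, iff_false,
      not_forall, not_or, not_not]
    obtain ⟨n, hn⟩ := exists_nat_ge |s|
    exact ⟨n, by linarith [neg_abs_le s], (le_abs_self s).trans hn⟩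
  rw [hI, measure_empty] at hlim
  have h1 : (0 : ENNReal) < ENNReal.ofReal (ε ^ 2) := ENNReal.ofReal_pos.2 (by positivity)
  obtain ⟨n, hn⟩ := (hlim.eventually (gt_mem_nhds h1)).exists
  refine ⟨n, ?_⟩
  rw [Function.comp_apply, E.scalarMeasure_apply measurableSet_Icc.compl,
    ENNReal.ofReal_lt_ofReal_iff (by positivity)] at hn
  have h2 : x - E.proj (Icc (-n : ℝ) n) x = E.proj (Icc (-n : ℝ) n)ᶜ x := by
    rw [sub_eq_iff_eq_add']; exact (E.proj_add_proj_compl measurableSet_Icc x).symm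
  rw [h2]
  exact lt_of_pow_lt_pow_left₀ 2 hε.le hn

theorem ae_mem_of_proj_eq (hB : MeasurableSet B) {x : 𝓗} (hx : E.proj B x = x) :
    ∀ᵐ s ∂(E.scalarMeasure x), s ∈ B := by
  rw [← hx, E.scalarMeasure_proj hB]
  exact ae_restrict_mem hB

section Unbounded

variable {E} {T : 𝓗 →ₗ.[ℂ] 𝓗} (hT : E.IsSpectralMeasureOf T)
include hT

theorem IsSpectralMeasureOf.proj_mem (hB : MeasurableSet B) {x : 𝓗} (hx : x ∈ T.domain) :
    E.proj B x ∈ T.domain := by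
  rw [hT.1] at hx ⊢
  rw [E.scalarMeasure_proj hB]
  exact (lintegral_mono' Measure.restrict_le_self le_rfl).trans_lt hx

theorem IsSpectralMeasureOf.proj_mem_of_bounded (hB : MeasurableSet B) {M : ℝ}
    (hM : ∀ s ∈ B, |s| ≤ M) (x : 𝓗) : E.proj B x ∈ T.domain := by
  rw [hT.1, E.scalarMeasure_proj hB]
  have : ∫⁻ s in B, ENNReal.ofReal (s ^ 2) ∂(E.scalarMeasure x) ≤
      ∫⁻ s in B, ENNReal.ofReal (M ^ 2) ∂(E.scalarMeasure x) :=
    setLIntegral_mono measurable_const fun s hs =>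
      ENNReal.ofReal_le_ofReal (by rw [← sq_abs]; gcongr; exact hM s hs)
  refine this.trans_lt ?_
  rw [setLIntegral_const]
  exact ENNReal.mul_lt_top ENNReal.ofReal_lt_top (measure_lt_top _ _)

theorem IsSpectralMeasureOf.integrable {x : 𝓗} (hx : x ∈ T.domain) :
    Integrable (fun s : ℝ => s) (E.scalarMeasure x) := by
  have h2 : MemLp (fun s : ℝ => s) 2 (E.scalarMeasure x) := by
    refine (memLp_two_iff_integrable_sq measurable_id'.aestronglyMeasurable).2 ⟨(measurable_id.pow_const 2).aestronglyMeasurable, ?_⟩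
    rw [hasFiniteIntegral_iff_ofReal (.of_forall fun s => sq_nonneg s)]
    exact (hT.1 x).1 hx
  exact h2.integrable (by norm_num)

theorem IsSpectralMeasureOf.dense_domain : Dense (T.domain : Set 𝓗) := by
  intro x
  rw [Metric.mem_closure_iff]
  intro ε hε
  obtain ⟨n, hn⟩ := E.exists_proj_Icc_near x hε
  exact ⟨_, hT.proj_mem_of_bounded measurableSet_Icc (M := n) (fun s hs => abs_le.2 hs) x,
    by rwa [dist_eq_norm]⟩

/-- Only the diagonal values ⟨ψ, Tψ⟩ are prescribed. Since the scalar measures of x and y add, the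
form is additive on x + y and its cross terms cancel. -/
theorem IsSpectralMeasureOf.inner_add (hB : MeasurableSet B) (hC : MeasurableSet C)
    (h : Disjoint B C) {x y : T.domain} (hx : E.proj B x = x) (hy : E.proj C y = y) :
    ⟪(x : 𝓗), T y⟫_ℂ + ⟪(y : 𝓗), T x⟫_ℂ = 0 := by
  have h1 := hT.2 (x + y)
  have hi1 := hT.integrable x.2
  have hi2 := hT.integrable y.2
  rw [Submodule.coe_add] at h1
  rw [← hx] at hi1
  rw [← hy] at hi2
  have h2 : (E.scalarMeasure ((x : 𝓗) + y)) =
      E.scalarMeasure x + E.scalarMeasure y := by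
    have := E.scalarMeasure_add hB hC h x y
    rwa [hx, hy] at this
  rw [hx] at hi1
  rw [hy] at hi2
  rw [h2, integral_add_measure hi1 hi2, Complex.ofReal_add, ← hT.2, ← hT.2, T.map_add,
    inner_add_left, inner_add_right, inner_add_right] at h1
  linear_combination h1

theorem IsSpectralMeasureOf.inner_eq_zero (hB : MeasurableSet B) (hC : MeasurableSet C)
    (h : Disjoint B C) {x y : T.domain} (hx : E.proj B x = x) (hy : E.proj C y = y) :
    ⟪(x : 𝓗), T y⟫_ℂ = 0 := by
  have h1 := hT.inner_add hB hC h hx hy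
  -- Replacing y by iy flips the relative sign of the two cross terms, so each of them vanishes
  -- separately.
  have h2 := hT.inner_add hB hC h (y := Complex.I • y) hx (by simp [hy])
  rw [T.map_smul, Submodule.coe_smul, inner_smul_left, inner_smul_right, Complex.conj_I] at h2
  linear_combination (1 / 2 : ℂ) * h1 - Complex.I / 2 * h2 +
    (1 / 2 * (⟪(x : 𝓗), T y⟫_ℂ - ⟪(y : 𝓗), T x⟫_ℂ)) * Complex.I_sq

/-- For each S, the vector T E(S)x is orthogonal to E(Sᶜ)v for every v in the dense domain, so T
preserves the range of E(S). Using this for both C and Cᶜ gives the commutation. -/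
theorem IsSpectralMeasureOf.map_proj (hC : MeasurableSet C) (x : T.domain) :
    T ⟨E.proj C x, hT.proj_mem hC x.2⟩ = E.proj C (T x) := by
  have key : ∀ (S : Set ℝ) (hS : MeasurableSet S),
      E.proj Sᶜ (T ⟨E.proj S x, hT.proj_mem hS x.2⟩) = 0 := by
    intro S hS
    refine hT.dense_domain.eq_zero_of_inner_right ℂ fun v hv => ?_
    rw [← E.inner_proj_left hS.compl]
    exact hT.inner_eq_zero hS.compl hS disjoint_compl_left
      (x := ⟨E.proj Sᶜ v, hT.proj_mem hS.compl hv⟩) (E.proj_proj_self hS.compl _)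
      (E.proj_proj_self hS _)
  have h1 := key C hC
  have h2 := key Cᶜ hC.compl
  simp only [compl_compl] at h2
  have hx : x = ⟨E.proj C x, hT.proj_mem hC x.2⟩ + ⟨E.proj Cᶜ x, hT.proj_mem hC.compl x.2⟩ :=
    Subtype.ext (E.proj_add_proj_compl hC x).symm
  conv_rhs => rw [hx, T.map_add, map_add, h2, add_zero]
  conv_lhs => rw [← E.proj_add_proj_compl hC (T _), h1, add_zero]

/-- The quadratic form is an integral of a real function, hence real; polarisation over ℂ does the
rest. -/
theorem IsSpectralMeasureOf.isSymm (x y : T.domain) : ⟪T x, (y : 𝓗)⟫_ℂ = ⟪(x : 𝓗), T y⟫_ℂ := by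
  have hq : ∀ z : T.domain, ⟪T z, (z : 𝓗)⟫_ℂ = ⟪(z : 𝓗), T z⟫_ℂ := fun z => by
    rw [← inner_conj_symm, hT.2 z, Complex.conj_ofReal]
  have h1 := hq (x + y)
  have h2 := hq (x + Complex.I • y)
  simp only [T.map_add, T.map_smul, Submodule.coe_add, Submodule.coe_smul, inner_add_left,
    inner_add_right, inner_smul_left, inner_smul_right, Complex.conj_I, hq x, hq y] at h1 h2
  linear_combination (1 / 2 : ℂ) * h1 - Complex.I / 2 * h2 +
    (1 / 2 : ℂ) * (⟪T x, (y : 𝓗)⟫_ℂ - ⟪T y, (x : 𝓗)⟫_ℂ - ⟪(x : 𝓗), T y⟫_ℂ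
      + ⟪(y : 𝓗), T x⟫_ℂ) * Complex.I_sq

theorem IsSpectralMeasureOf.re_inner_le (hB : MeasurableSet B) {b : ℝ} (hb : ∀ s ∈ B, s ≤ b)
    {x : T.domain} (hx : E.proj B x = x) : (⟪(x : 𝓗), T x⟫_ℂ).re ≤ b * ‖(x : 𝓗)‖ ^ 2 := by
  rw [hT.2, Complex.ofReal_re, ← E.scalarMeasure_real_univ, mul_comm, ← smul_eq_mul,
    ← integral_const]
  exact integral_mono_ae (hT.integrable x.2) (integrable_const _)
    ((E.ae_mem_of_proj_eq hB hx).mono fun s hs => hb s hs)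

theorem IsSpectralMeasureOf.le_re_inner (hB : MeasurableSet B) {b : ℝ} (hb : ∀ s ∈ B, b ≤ s)
    {x : T.domain} (hx : E.proj B x = x) : b * ‖(x : 𝓗)‖ ^ 2 ≤ (⟪(x : 𝓗), T x⟫_ℂ).re := by
  rw [hT.2, Complex.ofReal_re, ← E.scalarMeasure_real_univ, mul_comm, ← smul_eq_mul,
    ← integral_const]
  exact integral_mono_ae (integrable_const _) (hT.integrable x.2)
    ((E.ae_mem_of_proj_eq hB hx).mono fun s hs => hb s hs)

/-- On the range of `E(B)` with `B ⊆ [c - δ, c + δ]`, the operator `T - c` is bounded by `δ`. -/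
theorem IsSpectralMeasureOf.norm_sub_le (hB : MeasurableSet B) {c δ : ℝ} (hδ : 0 ≤ δ)
    (hb : ∀ s ∈ B, |s - c| ≤ δ) {x : T.domain} (hx : E.proj B x = x) :
    ‖T x - (c : ℂ) • (x : 𝓗)‖ ≤ δ * ‖(x : 𝓗)‖ := by
  have hdom : ∀ y : 𝓗, E.proj B y ∈ T.domain :=
    hT.proj_mem_of_bounded hB (M := |c| + δ) fun s hs => by
      have h1 := hb s hs
      have h2 := abs_add_le (s - c) c
      rw [sub_add_cancel] at h2
      linarith
  set m : 𝓗 := T x - (c : ℂ) • (x : 𝓗) with hm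
  have hmB : E.proj B m = m := by
    have h1 := hT.map_proj hB x
    have h2 : (⟨E.proj B x, hT.proj_mem hB x.2⟩ : T.domain) = x := Subtype.ext hx
    rw [h2] at h1
    rw [hm, map_sub, map_smul, hx, ← h1]
  have hmD : m ∈ T.domain := hmB ▸ hdom m
  have hq : ∀ z : T.domain, E.proj B z = z →
      |(⟪(z : 𝓗), T z⟫_ℂ).re - c * ‖(z : 𝓗)‖ ^ 2| ≤ δ * ‖(z : 𝓗)‖ ^ 2 := by
    intro z hz
    have h1 := hT.re_inner_le hB (b := c + δ) (fun s hs => by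
      have := (abs_le.1 (hb s hs)).2; linarith) hz
    have h2 := hT.le_re_inner hB (b := c - δ) (fun s hs => by
      have := (abs_le.1 (hb s hs)).1; linarith) hz
    rw [abs_le]
    constructor <;> nlinarith
  -- The form of T − c is bounded by δ. Polarising it between x and y = t m, where m = (T − c)x is
  -- the residual itself, and using the parallelogram law turns the form bound into a norm bound.
  have hpol : ∀ t : ℝ, 4 * (t * ‖m‖ ^ 2) ≤ 2 * δ * (‖(x : 𝓗)‖ ^ 2 + t ^ 2 * ‖m‖ ^ 2) := by
    intro t
    set y : T.domain := (t : ℂ) • ⟨m, hmD⟩ with hy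
    have hyB : E.proj B y = y := by simp [hy, hmB]
    have h1 := (abs_le.1 (hq (x + y) (by simp [hx, hyB]))).2
    have h2 := (abs_le.1 (hq (x - y) (by simp [hx, hyB]))).1
    have hsum := parallelogram_law_with_norm ℂ (x : 𝓗) (y : 𝓗)
    have hyn : ‖(y : 𝓗)‖ ^ 2 = t ^ 2 * ‖m‖ ^ 2 := by
      simp [hy, norm_smul, mul_pow]
    have hp : ‖(x : 𝓗) + y‖ ^ 2 = ‖(x : 𝓗)‖ ^ 2 + 2 * (⟪(y : 𝓗), (x : 𝓗)⟫_ℂ).re + ‖(y : 𝓗)‖ ^ 2 := by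
      rw [norm_add_sq (𝕜 := ℂ), ← inner_re_symm]; rfl
    have hmi : ‖(x : 𝓗) - y‖ ^ 2 = ‖(x : 𝓗)‖ ^ 2 - 2 * (⟪(y : 𝓗), (x : 𝓗)⟫_ℂ).re + ‖(y : 𝓗)‖ ^ 2 := by
      rw [norm_sub_sq (𝕜 := ℂ), ← inner_re_symm]; rfl
    have hsy : (⟪(x : 𝓗), T y⟫_ℂ).re = (⟪(y : 𝓗), T x⟫_ℂ).re := by
      rw [← hT.isSymm x y]; exact inner_re_symm (𝕜 := ℂ) _ _
    have hval : (⟪(y : 𝓗), T x⟫_ℂ).re - c * (⟪(y : 𝓗), (x : 𝓗)⟫_ℂ).re = t * ‖m‖ ^ 2 := by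
      have h3 : ⟪(y : 𝓗), m⟫_ℂ = ((t * ‖m‖ ^ 2 : ℝ) : ℂ) := by
        simp only [hy, Submodule.coe_smul, inner_smul_left, Complex.conj_ofReal]
        rw [inner_self_eq_norm_sq_to_K]; push_cast; rfl
      have h4 : ⟪(y : 𝓗), m⟫_ℂ = ⟪(y : 𝓗), T x⟫_ℂ - (c : ℂ) * ⟪(y : 𝓗), (x : 𝓗)⟫_ℂ := by
        rw [hm, inner_sub_right, inner_smul_right]
      rw [h4] at h3
      have := congrArg Complex.re h3
      rwa [Complex.sub_re, Complex.re_ofReal_mul, Complex.ofReal_re] at this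
    simp only [T.map_add, T.map_sub, Submodule.coe_add, Submodule.coe_sub, inner_add_left,
      inner_add_right, inner_sub_left, inner_sub_right, Complex.add_re, Complex.sub_re] at h1 h2
    rw [hp, hsy] at h1
    rw [hmi, hsy] at h2
    rw [← hyn]
    nlinarith
  rcases eq_or_ne ‖m‖ 0 with h0 | h0
  · rw [h0]; positivity
  have hmpos : 0 < ‖m‖ := lt_of_le_of_ne (norm_nonneg _) (Ne.symm h0)
  -- This t makes ‖y‖ = ‖x‖, which optimises the inequality and gives the sharp constant δ.
  have h5 := hpol (‖(x : 𝓗)‖ / ‖m‖)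
  rcases eq_or_ne ‖(x : 𝓗)‖ 0 with hx0 | hx0
  · have hx0' : x = 0 := Subtype.ext (norm_eq_zero.1 hx0)
    rw [hm, hx0']; simp
  have hxpos : 0 < ‖(x : 𝓗)‖ := lt_of_le_of_ne (norm_nonneg _) (Ne.symm hx0)
  have h6 : ‖(x : 𝓗)‖ / ‖m‖ * ‖m‖ ^ 2 = ‖(x : 𝓗)‖ * ‖m‖ := by field_simp
  have h7 : (‖(x : 𝓗)‖ / ‖m‖) ^ 2 * ‖m‖ ^ 2 = ‖(x : 𝓗)‖ ^ 2 := by field_simp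
  rw [h6, h7] at h5
  have h8 : ‖(x : 𝓗)‖ * ‖m‖ ≤ ‖(x : 𝓗)‖ * (δ * ‖(x : 𝓗)‖) := by nlinarith
  exact le_of_mul_le_mul_left h8 hxpos

end Unbounded

end ProjectionValuedMeasure

end HilbertSpace

/-! ### Semibounded operators: truncations and commutation with spectral projections. -/

section HilbertSpace

variable {𝓗 : Type*} [NormedAddCommGroup 𝓗] [InnerProductSpace ℂ 𝓗] [CompleteSpace 𝓗]

omit [CompleteSpace 𝓗] in
/-- A densely defined operator composed with a bounded one is bounded if it is so pointwise. -/
theorem exists_clm_of_graph {T : 𝓗 →ₗ.[ℂ] 𝓗} (G : 𝓗 →L[ℂ] 𝓗) (C : ℝ)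
    (h : ∀ ψ, ∃ y, (G ψ, y) ∈ T.graph ∧ ‖y‖ ≤ C * ‖ψ‖) :
    ∃ K : 𝓗 →L[ℂ] 𝓗, ∀ ψ, (G ψ, K ψ) ∈ T.graph := by
  choose y hy hyC using h
  refine ⟨LinearMap.mkContinuous ⟨⟨y, fun a b => ?_⟩, fun c a => ?_⟩ C hyC, hy⟩
  · have h1 := T.graph.add_mem (hy a) (hy b)
    rw [Prod.mk_add_mk, ← map_add] at h1
    exact T.mem_graph_snd_inj (hy (a + b)) h1 rfl
  · have h1 := T.graph.smul_mem c (hy a)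
    rw [Prod.smul_mk, ← map_smul] at h1
    exact T.mem_graph_snd_inj (hy (c • a)) h1 rfl

namespace ProjectionValuedMeasure

variable {E : ProjectionValuedMeasure 𝓗} {T : 𝓗 →ₗ.[ℂ] 𝓗} (hT : E.IsSpectralMeasureOf T)

theorem proj_iUnion_eq_zero {ι : Type*} [Countable ι] {B : ι → Set ℝ}
    (hB : ∀ n, MeasurableSet (B n)) {x : 𝓗} (h : ∀ n, E.proj (B n) x = 0) :
    E.proj (⋃ n, B n) x = 0 := by
  rw [E.proj_eq_zero_iff (.iUnion hB), measure_iUnion_null_iff]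
  exact fun n => (E.proj_eq_zero_iff (hB n) x).1 (h n)

theorem proj_mono_eq_zero {B C : Set ℝ} (hB : MeasurableSet B) (hC : MeasurableSet C)
    (hBC : B ⊆ C) {x : 𝓗} (h : E.proj C x = 0) : E.proj B x = 0 := by
  rw [E.proj_eq_zero_iff hB]
  exact measure_mono_null hBC ((E.proj_eq_zero_iff hC x).1 h)

include hT

/-- The spectrum of `T` does not meet `(-∞, -E₀]` if `T + e` is bounded below for `e ≥ E₀`. -/
theorem IsSpectralMeasureOf.proj_Iio_eq_zero {E₀ κ : ℝ} (hκ : 0 < κ)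
    (h : ∀ e, E₀ ≤ e → ∀ x : T.domain, κ * ‖(x : 𝓗)‖ ≤ ‖T x + (e : ℂ) • (x : 𝓗)‖) (x : 𝓗) :
    E.proj (Iio (-E₀)) x = 0 := by
  -- Intervals of radius κ/2 with centres κ/2 apart cover (−∞, −E₀). On the spectral subspace of
  -- such an interval, T + e at the centre −e has norm at most κ/2, which contradicts the lower
  -- bound κ unless the subspace is trivial.
  set B : ℕ → Set ℝ := fun n => {s | |s - (-(E₀ + n * (κ / 2)))| ≤ κ / 2} with hBdef
  have hB : ∀ n, MeasurableSet (B n) := fun n =>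
    measurableSet_le (measurable_id.sub_const _).abs measurable_const
  have hz : ∀ n, E.proj (B n) x = 0 := by
    intro n
    have hD := hT.proj_mem_of_bounded (hB n) (M := |(-(E₀ + n * (κ / 2)))| + κ / 2)
      (fun s hs => by
        have h2 := abs_add_le (s - (-(E₀ + n * (κ / 2)))) (-(E₀ + n * (κ / 2)))
        rw [sub_add_cancel] at h2
        have h1 : |s - (-(E₀ + n * (κ / 2)))| ≤ κ / 2 := hs
        linarith) x
    have h1 := hT.norm_sub_le (hB n) (half_pos hκ).le (fun s hs => hs)
      (x := ⟨E.proj (B n) x, hD⟩) (E.proj_proj_self (hB n) x)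
    have h2 := h (E₀ + n * (κ / 2)) (le_add_of_nonneg_right (by positivity))
      ⟨E.proj (B n) x, hD⟩
    rw [Complex.ofReal_neg, neg_smul, sub_neg_eq_add] at h1
    have h3 := h2.trans h1
    simp only at h3
    have h4 : ‖E.proj (B n) x‖ ≤ 0 := by nlinarith [norm_nonneg (E.proj (B n) x)]
    exact norm_le_zero_iff.1 h4
  refine proj_mono_eq_zero measurableSet_Iio (.iUnion hB) (fun s hs => ?_)
    (proj_iUnion_eq_zero hB hz)
  rw [mem_iUnion]
  have hs' : s < -E₀ := hs
  have hpos : 0 ≤ (-E₀ - s) / (κ / 2) := div_nonneg (by linarith) (by positivity)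
  refine ⟨⌊(-E₀ - s) / (κ / 2)⌋₊, ?_⟩
  have h1 := Nat.floor_le hpos
  have h2 := (Nat.lt_floor_add_one ((-E₀ - s) / (κ / 2))).le
  rw [le_div_iff₀ (by positivity)] at h1
  rw [div_le_iff₀ (by positivity)] at h2
  show |s - _| ≤ _
  rw [abs_le]
  constructor <;> nlinarith

variable {M : ℝ} (hM : ∀ x, E.proj (Iio (-M)) x = 0)
include hM

omit hT in
theorem proj_Iic_eq_proj_Icc (μ : ℝ) (x : 𝓗) : E.proj (Iic μ) x = E.proj (Icc (-M) μ) x := by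
  have h1 := E.proj_add_proj_compl (B := Iio (-M)) measurableSet_Iio (E.proj (Iic μ) x)
  rw [hM, zero_add, E.proj_proj measurableSet_Iio.compl measurableSet_Iic] at h1
  rw [← h1]
  congr 2
  ext s
  simp

theorem IsSpectralMeasureOf.proj_Iic_mem (μ : ℝ) (x : 𝓗) : E.proj (Iic μ) x ∈ T.domain := by
  rw [proj_Iic_eq_proj_Icc hM]
  exact hT.proj_mem_of_bounded measurableSet_Icc (M := max |(-M)| |μ|)
    (fun s hs => abs_le_max_abs_abs hs.1 hs.2) x

theorem IsSpectralMeasureOf.norm_add_le_of_proj_Iic {μ : ℝ} (hμ : -M ≤ μ) {x : T.domain}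
    (hx : E.proj (Iic μ) x = x) : ‖T x + (M : ℂ) • (x : 𝓗)‖ ≤ (μ + M) * ‖(x : 𝓗)‖ := by
  -- Centred at −M rather than at the midpoint, so that T + M itself is bounded, with the rate μ + M
  -- that the iteration argument compares against.
  have h1 := hT.norm_sub_le (B := Icc (-M) μ) measurableSet_Icc (c := -M) (δ := μ + M)
    (by linarith) (fun s hs => abs_le.2 ⟨by linarith [hs.1], by linarith [hs.2]⟩) (x := x)
    (by rw [← proj_Iic_eq_proj_Icc hM]; exact hx)
  rwa [Complex.ofReal_neg, neg_smul, sub_neg_eq_add] at h1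

omit hT in
theorem proj_Iic_of_lt {μ : ℝ} (hμ : μ < -M) (x : 𝓗) : E.proj (Iic μ) x = 0 := by
  rw [proj_Iic_eq_proj_Icc hM, Icc_eq_empty (not_le.2 hμ), E.proj_empty]

theorem IsSpectralMeasureOf.exists_proj_Iic_clm (μ : ℝ) :
    ∃ K : 𝓗 →L[ℂ] 𝓗, ∀ x, (E.proj (Iic μ) x, K x) ∈ T.graph := by
  rcases lt_or_ge μ (-M) with hμ | hμ
  · exact ⟨0, fun x => by
      rw [proj_Iic_of_lt hM hμ]
      exact T.graph.zero_mem⟩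
  refine exists_clm_of_graph _ (μ + M + |M|) fun x => ?_
  set y : T.domain := ⟨_, hT.proj_Iic_mem hM μ x⟩
  refine ⟨T y, T.mem_graph y, ?_⟩
  have h1 := hT.norm_add_le_of_proj_Iic hM hμ (x := y) (E.proj_proj_self measurableSet_Iic _)
  have h2 : ‖(y : 𝓗)‖ ≤ ‖x‖ := E.norm_proj_le measurableSet_Iic x
  have h3 : ‖T y‖ ≤ ‖T y + (M : ℂ) • (y : 𝓗)‖ + ‖(M : ℂ) • (y : 𝓗)‖ := by
    have := _root_.norm_sub_le (T y + (M : ℂ) • (y : 𝓗)) ((M : ℂ) • (y : 𝓗))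
    rwa [add_sub_cancel_right] at this
  rw [norm_smul, Complex.norm_real, Real.norm_eq_abs] at h3
  have h4 : 0 ≤ μ + M := by linarith
  nlinarith [abs_nonneg M, norm_nonneg (y : 𝓗)]

omit hM in
/-- Iterates of `T + M` growing at most like `(μ + M)^n` characterise the range of `E(-∞, μ]`. -/
theorem IsSpectralMeasureOf.proj_Ioi_eq_zero {μ : ℝ} (hμ : -M ≤ μ) (x : ℕ → T.domain)
    (hx : ∀ n, (x (n + 1) : 𝓗) = T (x n) + (M : ℂ) • (x n : 𝓗)) (C : ℝ)
    (hC : ∀ n, ‖(x n : 𝓗)‖ ≤ C * (μ + M) ^ n) : E.proj (Ioi μ) (x 0) = 0 := by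
  have key : ∀ δ : ℝ, 0 < δ → E.proj (Ici (μ + δ)) (x 0) = 0 := by
    intro δ hδ
    set y : ℕ → T.domain := fun n => ⟨E.proj (Ici (μ + δ)) (x n),
      hT.proj_mem measurableSet_Ici (x n).2⟩ with hy
    -- The component above μ + δ grows at least by the factor μ + M + δ at each iteration, faster
    -- than the allowed (μ + M)^n, so it must be zero.
    have hstep : ∀ n, (μ + M + δ) * ‖(y n : 𝓗)‖ ≤ ‖(y (n + 1) : 𝓗)‖ := by
      intro n
      have h1 : (y (n + 1) : 𝓗) = T (y n) + (M : ℂ) • (y n : 𝓗) := by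
        simp only [hy]
        rw [hx, map_add, map_smul, hT.map_proj measurableSet_Ici]
      have h2 := hT.le_re_inner measurableSet_Ici (b := μ + δ) (fun s hs => hs) (x := y n)
        (E.proj_proj_self measurableSet_Ici _)
      have h3 : (⟪(y n : 𝓗), (y (n + 1) : 𝓗)⟫_ℂ).re =
          (⟪(y n : 𝓗), T (y n)⟫_ℂ).re + M * ‖(y n : 𝓗)‖ ^ 2 := by
        rw [h1, inner_add_right, inner_smul_right, inner_self_eq_norm_sq_to_K, Complex.add_re,
          Complex.re_ofReal_mul]
        norm_cast
      have h4 : (⟪(y n : 𝓗), (y (n + 1) : 𝓗)⟫_ℂ).re ≤ ‖(y n : 𝓗)‖ * ‖(y (n + 1) : 𝓗)‖ :=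
        re_inner_le_norm (𝕜 := ℂ) _ _
      rcases eq_or_ne ‖(y n : 𝓗)‖ 0 with h0 | h0
      · rw [h0, mul_zero]; exact norm_nonneg _
      have hpos : 0 < ‖(y n : 𝓗)‖ := lt_of_le_of_ne (norm_nonneg _) (Ne.symm h0)
      refine le_of_mul_le_mul_left ?_ hpos
      nlinarith
    have hind : ∀ n, (μ + M + δ) ^ n * ‖(y 0 : 𝓗)‖ ≤ ‖(y n : 𝓗)‖ := by
      intro n
      induction n with
      | zero => simp
      | succ n ih =>
        calc (μ + M + δ) ^ (n + 1) * ‖(y 0 : 𝓗)‖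
            = (μ + M + δ) * ((μ + M + δ) ^ n * ‖(y 0 : 𝓗)‖) := by ring
          _ ≤ (μ + M + δ) * ‖(y n : 𝓗)‖ := by
            apply mul_le_mul_of_nonneg_left ih; linarith
          _ ≤ _ := hstep n
    have hc : 0 < μ + M + δ := by linarith
    have hb : ∀ n, ‖(y 0 : 𝓗)‖ ≤ C * ((μ + M) / (μ + M + δ)) ^ n := by
      intro n
      have h1 := (hind n).trans ((E.norm_proj_le measurableSet_Ici (x n)).trans (hC n))
      rw [div_pow, ← mul_div_assoc, le_div_iff₀ (by positivity)]
      linarith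
    have hlim : Filter.Tendsto (fun n : ℕ => C * ((μ + M) / (μ + M + δ)) ^ n) Filter.atTop
        (nhds (C * 0)) :=
      (tendsto_pow_atTop_nhds_zero_of_lt_one (div_nonneg (by linarith) hc.le)
        ((div_lt_one hc).2 (by linarith))).const_mul C
    rw [mul_zero] at hlim
    exact norm_le_zero_iff.1 (ge_of_tendsto' hlim hb)
  have hU : Ioi μ = ⋃ n : ℕ, Ici (μ + 1 / ((n : ℝ) + 1)) := by
    ext s
    simp only [mem_Ioi, mem_iUnion, mem_Ici]
    constructor
    · intro h
      obtain ⟨n, hn⟩ := exists_nat_one_div_lt (sub_pos.2 h)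
      exact ⟨n, by linarith⟩
    · rintro ⟨n, hn⟩
      have : (0 : ℝ) < 1 / ((n : ℝ) + 1) := by positivity
      linarith
  rw [hU]
  exact proj_iUnion_eq_zero (fun n => measurableSet_Ici) fun n => key _ (by positivity)

/-- A bounded operator that intertwines `T` leaves the range of `E(-∞, μ]` invariant. -/
theorem IsSpectralMeasureOf.proj_Iic_intertwine (μ : ℝ) (W : 𝓗 →L[ℂ] 𝓗)
    (hW : ∀ x y, (x, y) ∈ T.graph → (W x, W y) ∈ T.graph) (x : 𝓗) :
    E.proj (Iic μ) (W (E.proj (Iic μ) x)) = W (E.proj (Iic μ) x) := by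
  rcases lt_or_ge μ (-M) with hμ | hμ
  · simp [proj_Iic_of_lt hM hμ]
  set f : 𝓗 → T.domain := fun z => ⟨_, hT.proj_Iic_mem hM μ z⟩ with hf
  -- Iterates of T + M started at E(−∞, μ]x. They grow at most like (μ + M)^n, and since W
  -- intertwines T, so do their images under W; the growth criterion then locates W E(−∞, μ]x.
  set u : ℕ → 𝓗 := fun n => Nat.rec x (fun _ z => T (f z) + (M : ℂ) • (f z : 𝓗)) n with hu
  have hus : ∀ n, u (n + 1) = T (f (u n)) + (M : ℂ) • (f (u n) : 𝓗) := fun n => rfl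
  have hfu : ∀ z, f (T (f z) + (M : ℂ) • (f z : 𝓗)) =
      T (f z) + (M : ℂ) • (f z : 𝓗) := by
    intro z
    have h1 := hT.map_proj measurableSet_Iic (C := Iic μ) (f z)
    have h2 : (⟨E.proj (Iic μ) (f z), hT.proj_mem measurableSet_Iic (f z).2⟩ : T.domain) = f z :=
      Subtype.ext (E.proj_proj_self measurableSet_Iic z)
    rw [h2] at h1
    simp only [hf]
    rw [map_add, map_smul, E.proj_proj_self measurableSet_Iic]
    exact congrArg (· + _) h1.symm
  have hbd : ∀ n, ‖(f (u n) : 𝓗)‖ ≤ ‖x‖ * (μ + M) ^ n := by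
    intro n
    induction n with
    | zero => rw [pow_zero, mul_one]; exact E.norm_proj_le measurableSet_Iic x
    | succ n ih =>
      rw [hus, hfu]
      refine (hT.norm_add_le_of_proj_Iic hM hμ (E.proj_proj_self measurableSet_Iic _)).trans ?_
      rw [pow_succ, mul_comm, ← mul_assoc]
      exact mul_le_mul_of_nonneg_right ih (by linarith)
  have hWmem : ∀ n, (W (f (u n)), W (T (f (u n)))) ∈ T.graph := fun n =>
    hW _ _ (T.mem_graph _)
  set w : ℕ → T.domain := fun n => ⟨W (f (u n)), LinearPMap.mem_domain_of_mem_graph (hWmem n)⟩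
    with hw
  have hTw : ∀ n, T (w n) = W (T (f (u n))) := fun n =>
    T.mem_graph_snd_inj (T.mem_graph (w n)) (hWmem n) rfl
  have h0 := hT.proj_Ioi_eq_zero hμ w (fun n => by
    rw [hTw]
    simp only [hw]
    rw [hus, hfu, map_add, map_smul]) (‖W‖ * ‖x‖) (fun n => by
      rw [mul_assoc]
      exact (W.le_opNorm _).trans (mul_le_mul_of_nonneg_left (hbd n) (norm_nonneg _)))
  have h1 := E.proj_add_proj_compl (B := Iic μ) measurableSet_Iic (W (f (u 0)))
  rw [compl_Iic, h0, add_zero] at h1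
  exact h1

/-- Write P for the projection. Invariance of its range under W and under W* means PWP = WP and PW*P
= W*P; the adjoint of the second is PWP = PW. The growth criterion behind the invariance replaces
uniqueness of the spectral measure. -/
theorem IsSpectralMeasureOf.proj_Iic_commute (μ : ℝ) (W : 𝓗 →L[ℂ] 𝓗)
    (hW : ∀ x y, (x, y) ∈ T.graph → (W x, W y) ∈ T.graph)
    (hW' : ∀ x y, (x, y) ∈ T.graph →
      (ContinuousLinearMap.adjoint W x, ContinuousLinearMap.adjoint W y) ∈ T.graph) :
    Commute (E.proj (Iic μ)) W := by
  refine ContinuousLinearMap.ext fun x => ?_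
  show E.proj (Iic μ) (W x) = W (E.proj (Iic μ) x)
  rw [← hT.proj_Iic_intertwine hM μ W hW x]
  refine ext_inner_left ℂ fun y => ?_
  rw [← E.inner_proj_left measurableSet_Iic, ← ContinuousLinearMap.adjoint_inner_left,
    ← hT.proj_Iic_intertwine hM μ _ hW' y, E.inner_proj_left measurableSet_Iic,
    ContinuousLinearMap.adjoint_inner_left, E.inner_proj_left measurableSet_Iic]

end ProjectionValuedMeasure

end HilbertSpace

/-! ### The unitary group, known only through its diagonal matrix elements. -/

section HilbertSpace

variable {𝓗 : Type*} [NormedAddCommGroup 𝓗] [InnerProductSpace ℂ 𝓗] [CompleteSpace 𝓗]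

namespace ProjectionValuedMeasure

variable {E : ProjectionValuedMeasure 𝓗} {U U' : 𝓗 →L[ℂ] 𝓗} {t : ℝ}

theorem norm_exp_I (t s : ℝ) : ‖Complex.exp (Complex.I * t * s)‖ = 1 := by
  have : Complex.I * t * s = ((t * s : ℝ) : ℂ) * Complex.I := by push_cast; ring
  rw [this, Complex.norm_exp_ofReal_mul_I]

theorem integrable_exp_I (μ : Measure ℝ) [IsFiniteMeasure μ] (t : ℝ) :
    Integrable (fun s : ℝ => Complex.exp (Complex.I * t * s)) μ := by
  refine Integrable.of_bound (C := 1) ?_ (.of_forall fun s => (norm_exp_I t s).le)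
  exact Continuous.aestronglyMeasurable (by fun_prop)

variable (hU : ∀ ψ : 𝓗,
  ⟪ψ, U ψ⟫_ℂ = ∫ s : ℝ, Complex.exp (Complex.I * t * s) ∂(E.scalarMeasure ψ))
include hU

/-- The polarisation argument of `IsSpectralMeasureOf.inner_eq_zero`, with s replaced by e^{its} in
the diagonal form. -/
theorem exp_inner_eq_zero {B C : Set ℝ} (hB : MeasurableSet B) (hC : MeasurableSet C)
    (h : Disjoint B C) {x y : 𝓗} (hx : E.proj B x = x) (hy : E.proj C y = y) :
    ⟪x, U y⟫_ℂ = 0 := by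
  have key : ∀ z : 𝓗, E.proj C z = z → ⟪x, U z⟫_ℂ + ⟪z, U x⟫_ℂ = 0 := by
    intro z hz
    have h1 := hU (x + z)
    have h2 : E.scalarMeasure (x + z) = E.scalarMeasure x + E.scalarMeasure z := by
      have := E.scalarMeasure_add hB hC h x z
      rwa [hx, hz] at this
    rw [h2, integral_add_measure (integrable_exp_I _ _) (integrable_exp_I _ _), ← hU, ← hU,
      map_add, inner_add_left, inner_add_right, inner_add_right] at h1
    linear_combination h1
  have h1 := key y hy
  have h2 := key (Complex.I • y) (by simp [hy])
  rw [map_smul, inner_smul_left, inner_smul_right, Complex.conj_I] at h2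
  linear_combination (1 / 2 : ℂ) * h1 - Complex.I / 2 * h2 +
    (1 / 2 * (⟪x, U y⟫_ℂ - ⟪y, U x⟫_ℂ)) * Complex.I_sq

theorem exp_map_proj {C : Set ℝ} (hC : MeasurableSet C) (x : 𝓗) :
    U (E.proj C x) = E.proj C (U x) := by
  have key : ∀ (S : Set ℝ), MeasurableSet S → E.proj Sᶜ (U (E.proj S x)) = 0 := by
    intro S hS
    refine ext_inner_left ℂ fun v => ?_
    rw [← E.inner_proj_left hS.compl, inner_zero_right]
    exact exp_inner_eq_zero hU hS.compl hS disjoint_compl_left (E.proj_proj_self hS.compl _)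
      (E.proj_proj_self hS _)
  have h1 := key C hC
  have h2 := key Cᶜ hC.compl
  simp only [compl_compl] at h2
  conv_rhs => rw [← E.proj_add_proj_compl hC x, map_add, map_add, h2, add_zero]
  conv_lhs => rw [← E.proj_add_proj_compl hC (U _), h1, add_zero]

/-- The form of U − c is bounded by δ on the range of E(B). As U − c is not self-adjoint, the
four-term complex polarisation is needed and costs a factor 2, harmless because δ is later sent to
0. -/
theorem exp_norm_sub_le {B : Set ℝ} (hB : MeasurableSet B) {c : ℂ} {δ : ℝ} (hδ : 0 ≤ δ)
    (hb : ∀ s ∈ B, ‖Complex.exp (Complex.I * t * s) - c‖ ≤ δ) {x : 𝓗}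
    (hx : E.proj B x = x) : ‖U x - c • x‖ ≤ 2 * δ * ‖x‖ := by
  set V : 𝓗 →ₗ[ℂ] 𝓗 := (U - c • ContinuousLinearMap.id ℂ 𝓗).toLinearMap with hV
  have hVa : ∀ z, V z = U z - c • z := fun z => rfl
  have hVB : ∀ z, E.proj B z = z → E.proj B (V z) = V z := fun z hz => by
    rw [hVa, map_sub, map_smul, hz, ← exp_map_proj hU hB, hz]
  have hq : ∀ z : 𝓗, E.proj B z = z → ‖⟪V z, z⟫_ℂ‖ ≤ δ * ‖z‖ ^ 2 := by
    intro z hz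
    have h1 : ⟪z, V z⟫_ℂ = ∫ s : ℝ, (Complex.exp (Complex.I * t * s) - c)
        ∂(E.scalarMeasure z) := by
      rw [integral_sub (integrable_exp_I _ _) (integrable_const _), ← hU, integral_const,
        E.scalarMeasure_real_univ, hVa, inner_sub_right, inner_smul_right,
        inner_self_eq_norm_sq_to_K, Complex.real_smul, mul_comm c]
      norm_cast
    rw [← inner_conj_symm, RCLike.norm_conj, h1, ← E.scalarMeasure_real_univ]
    exact norm_integral_le_of_norm_le_const
      ((E.ae_mem_of_proj_eq hB hz).mono fun s hs => hb s hs)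
  rcases eq_or_ne ‖V x‖ 0 with h0 | h0
  · rw [← hVa, h0]; positivity
  rcases eq_or_ne ‖x‖ 0 with hx0 | hx0
  · rw [← hVa, norm_eq_zero.1 hx0]; simp
  have hmpos : 0 < ‖V x‖ := lt_of_le_of_ne (norm_nonneg _) (Ne.symm h0)
  have hxpos : 0 < ‖x‖ := lt_of_le_of_ne (norm_nonneg _) (Ne.symm hx0)
  set y : 𝓗 := ((‖x‖ / ‖V x‖ : ℝ) : ℂ) • V x with hy
  have hyB : E.proj B y = y := by rw [hy, map_smul, hVB x hx]
  have hyn : ‖y‖ = ‖x‖ := by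
    rw [hy, norm_smul, Complex.norm_real, Real.norm_of_nonneg (by positivity)]
    field_simp
  have hval : ‖⟪V x, y⟫_ℂ‖ = ‖x‖ * ‖V x‖ := by
    rw [hy, inner_smul_right, norm_mul, Complex.norm_real, Real.norm_of_nonneg (by positivity),
      inner_self_eq_norm_sq_to_K, norm_pow, RCLike.norm_ofReal, abs_norm]
    field_simp
  have hpol := inner_map_polarization' V x y
  have hn1 := hq (x + y) (by rw [map_add, hx, hyB])
  have hn2 := hq (x - y) (by rw [map_sub, hx, hyB])
  have hn3 := hq (x + Complex.I • y) (by rw [map_add, map_smul, hx, hyB])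
  have hn4 := hq (x - Complex.I • y) (by rw [map_sub, map_smul, hx, hyB])
  have hp1 := parallelogram_law_with_norm ℂ x y
  have hp2 := parallelogram_law_with_norm ℂ x (Complex.I • y)
  rw [norm_smul, Complex.norm_I, one_mul, hyn] at hp2
  rw [hyn] at hp1
  have hfin : ‖⟪V x, y⟫_ℂ‖ ≤ (‖⟪V (x + y), x + y⟫_ℂ‖ + ‖⟪V (x - y), x - y⟫_ℂ‖ +
      ‖⟪V (x + Complex.I • y), x + Complex.I • y⟫_ℂ‖ +
      ‖⟪V (x - Complex.I • y), x - Complex.I • y⟫_ℂ‖) / 4 := by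
    rw [hpol, norm_div, show ‖(4 : ℂ)‖ = 4 by simp]
    refine div_le_div_of_nonneg_right ?_ (by norm_num)
    refine (norm_add_le _ _).trans (add_le_add ((norm_sub_le _ _).trans
      (add_le_add (norm_sub_le _ _) ?_)) ?_) <;>
      rw [norm_mul, Complex.norm_I, one_mul]
  rw [hval] at hfin
  rw [← hVa]
  refine le_of_mul_le_mul_left ?_ hxpos
  nlinarith

/-- Cut ℝ into countably many sets on which e^{its} varies by at most ε. On each spectral component
U is within 2ε of a phase, so component norms change by a factor between 1 − 2ε and 1 + 2ε. Sum the
squares and let ε → 0. -/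
theorem exp_norm_eq (x : 𝓗) : ‖U x‖ = ‖x‖ := by
  -- The bound ε ≤ 1/4 keeps 1 − 2ε nonnegative, so that the lower estimate can be squared.
  have key : ∀ ε : ℝ, 0 < ε → ε ≤ 1 / 4 →
      ‖U x‖ ^ 2 ≤ (1 + 2 * ε) ^ 2 * ‖x‖ ^ 2 ∧ (1 - 2 * ε) ^ 2 * ‖x‖ ^ 2 ≤ ‖U x‖ ^ 2 := by
    intro ε hε hε'
    set B : ℤ → Set ℝ := fun k => {s | ⌊t * s / ε⌋ = k} with hBdef
    have hB : ∀ k, MeasurableSet (B k) := fun k =>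
      measurableSet_eq_fun (by fun_prop) measurable_const
    have hd : Pairwise (Function.onFun Disjoint B) := fun i j hij =>
      Set.disjoint_left.2 fun s hi hj => hij ((show _ = i from hi).symm.trans hj)
    have hun : (⋃ k, B k) = univ := eq_univ_of_forall fun s => mem_iUnion.2 ⟨_, rfl⟩
    have hexp : ∀ k, ∀ s ∈ B k, ‖Complex.exp (Complex.I * t * s) -
        Complex.exp (((k * ε : ℝ) : ℂ) * Complex.I)‖ ≤ ε := by
      intro k s hs
      have h1 : Complex.exp (Complex.I * t * s) = Complex.exp (((k * ε : ℝ) : ℂ) * Complex.I) *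
          Complex.exp (Complex.I * ((t * s - k * ε : ℝ) : ℂ)) := by
        rw [← Complex.exp_add]; congr 1; push_cast; ring
      have h2 : Complex.exp (Complex.I * t * s) - Complex.exp (((k * ε : ℝ) : ℂ) * Complex.I) =
          Complex.exp (((k * ε : ℝ) : ℂ) * Complex.I) *
          (Complex.exp (Complex.I * ((t * s - k * ε : ℝ) : ℂ)) - 1) := by
        rw [h1]; ring
      rw [h2, norm_mul, Complex.norm_exp_ofReal_mul_I, one_mul]
      refine (Real.norm_exp_I_mul_ofReal_sub_one_le).trans ?_
      have h3 : (⌊t * s / ε⌋ : ℤ) = k := hs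
      have h4 := Int.floor_le (t * s / ε)
      have h5 := (Int.lt_floor_add_one (t * s / ε)).le
      rw [h3] at h4 h5
      rw [le_div_iff₀ hε] at h4
      rw [div_le_iff₀ hε] at h5
      rw [Real.norm_eq_abs, abs_le]
      constructor <;> nlinarith
    have hbd : ∀ k, |‖E.proj (B k) (U x)‖ - ‖E.proj (B k) x‖| ≤ 2 * ε * ‖E.proj (B k) x‖ := by
      intro k
      have h1 := exp_norm_sub_le hU (hB k) hε.le (hexp k) (E.proj_proj_self (hB k) x)
      rw [exp_map_proj hU (hB k)] at h1
      have h2 := abs_norm_sub_norm_le (E.proj (B k) (U x))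
        (Complex.exp (((k * ε : ℝ) : ℂ) * Complex.I) • E.proj (B k) x)
      rw [norm_smul, Complex.norm_exp_ofReal_mul_I, one_mul] at h2
      exact h2.trans h1
    have hsum : ∀ z : 𝓗, ENNReal.ofReal (‖z‖ ^ 2) =
        ∑' k, ENNReal.ofReal (‖E.proj (B k) z‖ ^ 2) := by
      intro z
      rw [← E.scalarMeasure_univ, ← hun, measure_iUnion hd hB]
      exact tsum_congr fun k => E.scalarMeasure_apply (hB k) z
    constructor
    · rw [← ENNReal.ofReal_le_ofReal_iff (by positivity), ENNReal.ofReal_mul (by positivity),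
        hsum, hsum, ← ENNReal.tsum_mul_left]
      refine ENNReal.tsum_le_tsum fun k => ?_
      rw [← ENNReal.ofReal_mul (by positivity), ← mul_pow]
      refine ENNReal.ofReal_le_ofReal (pow_le_pow_left₀ (norm_nonneg _) ?_ 2)
      linarith [(abs_le.1 (hbd k)).2]
    · rw [← ENNReal.ofReal_le_ofReal_iff (by positivity), ENNReal.ofReal_mul (by positivity),
        hsum, hsum, ← ENNReal.tsum_mul_left]
      refine ENNReal.tsum_le_tsum fun k => ?_
      rw [← ENNReal.ofReal_mul (by positivity), ← mul_pow]
      refine ENNReal.ofReal_le_ofReal (pow_le_pow_left₀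
        (mul_nonneg (by linarith) (norm_nonneg _)) ?_ 2)
      linarith [(abs_le.1 (hbd k)).1]
  have hsq : ‖U x‖ ^ 2 = ‖x‖ ^ 2 := by
    have hl1 : Filter.Tendsto (fun ε : ℝ => (1 + 2 * ε) ^ 2 * ‖x‖ ^ 2) (nhdsWithin 0 (Ioi 0))
        (nhds ((1 + 2 * 0) ^ 2 * ‖x‖ ^ 2)) :=
      ((by fun_prop : Continuous fun ε : ℝ => (1 + 2 * ε) ^ 2 * ‖x‖ ^ 2).tendsto 0).mono_left
        nhdsWithin_le_nhds
    have hl2 : Filter.Tendsto (fun ε : ℝ => (1 - 2 * ε) ^ 2 * ‖x‖ ^ 2) (nhdsWithin 0 (Ioi 0))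
        (nhds ((1 - 2 * 0) ^ 2 * ‖x‖ ^ 2)) :=
      ((by fun_prop : Continuous fun ε : ℝ => (1 - 2 * ε) ^ 2 * ‖x‖ ^ 2).tendsto 0).mono_left
        nhdsWithin_le_nhds
    have hev : ∀ᶠ ε : ℝ in nhdsWithin 0 (Ioi 0), 0 < ε ∧ ε ≤ 1 / 4 := by
      filter_upwards [self_mem_nhdsWithin,
        nhdsWithin_le_nhds (Iic_mem_nhds (by norm_num : (0 : ℝ) < 1 / 4))] with ε h1 h2
      exact ⟨h1, h2⟩
    apply le_antisymm
    · simpa using ge_of_tendsto hl1 (hev.mono fun ε h => (key ε h.1 h.2).1)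
    · simpa using le_of_tendsto hl2 (hev.mono fun ε h => (key ε h.1 h.2).2)
  exact (pow_left_inj₀ (norm_nonneg _) (norm_nonneg _) two_ne_zero).1 hsq

omit hU in
-- Conjugating the diagonal form identifies U' with the adjoint of U, and an isometry satisfies U*U
-- = 1.
theorem exp_mul_eq_one (hU : ∀ ψ : 𝓗,
      ⟪ψ, U ψ⟫_ℂ = ∫ s : ℝ, Complex.exp (Complex.I * t * s) ∂(E.scalarMeasure ψ))
    (hU' : ∀ ψ : 𝓗, ⟪ψ, U' ψ⟫_ℂ =
      ∫ s : ℝ, Complex.exp (Complex.I * ((-t : ℝ) : ℂ) * s) ∂(E.scalarMeasure ψ)) :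
    U' * U = 1 := by
  have h1 : U' = ContinuousLinearMap.adjoint U := by
    rw [← ContinuousLinearMap.coe_inj, ← ext_inner_map]
    intro x
    rw [ContinuousLinearMap.coe_coe, ContinuousLinearMap.coe_coe,
      ContinuousLinearMap.adjoint_inner_left, ← inner_conj_symm, hU', hU, ← integral_conj]
    congr 1
    funext s
    rw [← Complex.exp_conj]
    simp
  rw [h1]
  exact ContinuousLinearMap.norm_map_iff_adjoint_comp_self U |>.1 (exp_norm_eq hU)

end ProjectionValuedMeasure

/-- The operator `e^{itT}` exists as a bounded operator. -/
def HasExpI (T : 𝓗 →ₗ.[ℂ] 𝓗) (t : ℝ) : Prop :=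
  ∃ hT : HasSpectralMeasure T, ∃ U : 𝓗 →L[ℂ] 𝓗, ∀ ψ : 𝓗,
    ⟪ψ, U ψ⟫_ℂ = ∫ s : ℝ, Complex.exp (Complex.I * t * s) ∂(hT.choose.scalarMeasure ψ)

theorem inner_expI {T : 𝓗 →ₗ.[ℂ] 𝓗} {t : ℝ} (h : HasExpI T t) (hT : HasSpectralMeasure T)
    (ψ : 𝓗) : ⟪ψ, expI T t ψ⟫_ℂ =
      ∫ s : ℝ, Complex.exp (Complex.I * t * s) ∂(hT.choose.scalarMeasure ψ) := by
  have h1 : expI T t = h.choose_spec.choose := dif_pos h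
  rw [h1]
  exact h.choose_spec.choose_spec ψ

theorem expI_of_not {T : 𝓗 →ₗ.[ℂ] 𝓗} {t : ℝ} (h : ¬ HasExpI T t) : expI T t = 1 := dif_neg h

/-- The adjoint serves at −t. Hence the two factors of a conjugation by the group are either both
genuine or both the default value 1. -/
theorem HasExpI.neg {T : 𝓗 →ₗ.[ℂ] 𝓗} {t : ℝ} (h : HasExpI T t) : HasExpI T (-t) := by
  obtain ⟨h, U, hU⟩ := h
  refine ⟨h, ContinuousLinearMap.adjoint U, fun ψ => ?_⟩
  rw [ContinuousLinearMap.adjoint_inner_right, ← inner_conj_symm, hU, ← integral_conj]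
  congr 1
  funext s
  rw [← Complex.exp_conj]
  simp

open ProjectionValuedMeasure in
/-- The spectral projections are invariant under the unitary group of the operator. -/
theorem expI_mul_spectralProjectionLE_mul_expI (T : 𝓗 →ₗ.[ℂ] 𝓗) (μ t : ℝ) :
    expI T (-t) * spectralProjectionLE T μ * expI T t = spectralProjectionLE T μ := by
  by_cases hT : HasSpectralMeasure T
  swap
  -- Without a spectral measure the projection is 0 by definition, and both sides vanish.
  · simp [spectralProjectionLE, hT]
  by_cases h : HasExpI T t
  · have hS : spectralProjectionLE T μ = hT.choose.proj (Iic μ) := dif_pos hT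
    have hU := inner_expI h hT
    have hU' := inner_expI h.neg hT
    have hc : hT.choose.proj (Iic μ) * expI T t = expI T t * hT.choose.proj (Iic μ) :=
      ContinuousLinearMap.ext fun x => (exp_map_proj hU measurableSet_Iic x).symm
    rw [hS, mul_assoc, hc, ← mul_assoc, exp_mul_eq_one hU hU', one_mul]
  -- Here both exponentials take the default value 1.
  · have h' : ¬ HasExpI T (-t) := fun h' => h (by simpa using h'.neg)
    rw [expI_of_not h, expI_of_not h', one_mul, mul_one]

theorem expI_zero (T : 𝓗 →ₗ.[ℂ] 𝓗) : expI T 0 = 1 := by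
  by_cases h : HasExpI T 0
  · rw [← ContinuousLinearMap.coe_inj, ← ext_inner_map]
    intro x
    have h1 := inner_expI h h.1 x
    simp only [Complex.ofReal_zero, mul_zero, zero_mul, Complex.exp_zero, integral_const,
      ProjectionValuedMeasure.scalarMeasure_real_univ] at h1
    rw [ContinuousLinearMap.coe_coe, ContinuousLinearMap.coe_coe, ← inner_conj_symm, h1]
    show _ = ⟪x, x⟫_ℂ
    rw [inner_self_eq_norm_sq_to_K]
    simp
  · exact expI_of_not h

end HilbertSpace

/-! ### Symmetric relations, closures and self-adjointness. -/

section HilbertSpace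

variable {𝓗 : Type*} [NormedAddCommGroup 𝓗] [InnerProductSpace ℂ 𝓗] [CompleteSpace 𝓗]

/-- A linear relation on a Hilbert space is symmetric. -/
def IsSymmRel (G : Submodule ℂ (𝓗 × 𝓗)) : Prop :=
  ∀ p ∈ G, ∀ q ∈ G, ⟪p.2, q.1⟫_ℂ = ⟪p.1, q.2⟫_ℂ

omit [CompleteSpace 𝓗] in
theorem IsSymmRel.topologicalClosure {G : Submodule ℂ (𝓗 × 𝓗)} (hG : IsSymmRel G) :
    IsSymmRel G.topologicalClosure := by
  have h1 : ∀ p ∈ G, ∀ q ∈ G.topologicalClosure, ⟪p.2, q.1⟫_ℂ = ⟪p.1, q.2⟫_ℂ := by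
    intro p hp q hq
    refine closure_minimal (s := (G : Set (𝓗 × 𝓗))) (t := {q | ⟪p.2, q.1⟫_ℂ = ⟪p.1, q.2⟫_ℂ})
      (fun q hq => hG p hp q hq) ?_ hq
    exact isClosed_eq (by fun_prop) (by fun_prop)
  intro p hp q hq
  refine closure_minimal (s := (G : Set (𝓗 × 𝓗))) (t := {p | ⟪p.2, q.1⟫_ℂ = ⟪p.1, q.2⟫_ℂ})
    (fun p hp => h1 p hp q hq) ?_ hp
  exact isClosed_eq (by fun_prop) (by fun_prop)

omit [CompleteSpace 𝓗] in
-- By symmetry the multivalued part of G is orthogonal to the domain, which is dense; so G is the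
-- graph of an operator.
theorem IsSymmRel.eq_zero {G : Submodule ℂ (𝓗 × 𝓗)} (hG : IsSymmRel G)
    (hd : Dense {x | ∃ y, (x, y) ∈ G}) (p : 𝓗 × 𝓗) (hp : p ∈ G) (h0 : p.1 = 0) : p.2 = 0 := by
  refine hd.eq_zero_of_inner_left ℂ ?_
  rintro x ⟨y, hy⟩
  rw [hG p hp _ hy, h0, inner_zero_left]

omit [CompleteSpace 𝓗] in
theorem dense_domain_topologicalClosure {G : Submodule ℂ (𝓗 × 𝓗)}
    (hd : Dense {x | ∃ y, (x, y) ∈ G}) : Dense {x | ∃ y, (x, y) ∈ G.topologicalClosure} :=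
  by
  refine hd.mono ?_
  rintro x ⟨y, hy⟩
  exact ⟨y, G.le_topologicalClosure hy⟩

omit [CompleteSpace 𝓗] in
-- Symmetry and density survive closure, so the closed relation is again single-valued: this is
-- closability.
theorem IsSymmRel.graph_closure {G : Submodule ℂ (𝓗 × 𝓗)} (hG : IsSymmRel G)
    (hd : Dense {x | ∃ y, (x, y) ∈ G}) :
    G.toLinearPMap.closure.graph = G.topologicalClosure := by
  have h1 : G.toLinearPMap.graph = G := Submodule.toLinearPMap_graph_eq G (hG.eq_zero hd)
  have h2 : G.toLinearPMap.IsClosable := by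
    refine ⟨G.topologicalClosure.toLinearPMap, ?_⟩
    rw [h1]
    exact (Submodule.toLinearPMap_graph_eq _ (hG.topologicalClosure.eq_zero
      (dense_domain_topologicalClosure hd))).symm
  rw [← h2.graph_closure_eq_closure_graph, h1]

/-- For y in the domain of T*, surjectivity gives x in the domain of T with (T + e)x = (T* + e)y.
Then y − x is orthogonal to the range of T + e, hence zero, and y lies in the domain of T. -/
theorem isSelfAdjoint_of_surjective {T : 𝓗 →ₗ.[ℂ] 𝓗} (hd : Dense (T.domain : Set 𝓗))
    (hsym : ∀ x y : T.domain, ⟪T x, (y : 𝓗)⟫_ℂ = ⟪(x : 𝓗), T y⟫_ℂ) (e : ℝ)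
    (hsurj : ∀ f : 𝓗, ∃ x : T.domain, T x + (e : ℂ) • (x : 𝓗) = f) : IsSelfAdjoint T := by
  rw [LinearPMap.isSelfAdjoint_def]
  have hle : T ≤ T.adjoint := LinearPMap.IsFormalAdjoint.le_adjoint hd fun x y => hsym x y
  refine (LinearPMap.eq_of_le_of_domain_eq hle (le_antisymm hle.1 ?_)).symm
  intro y hy
  obtain ⟨x, hx⟩ := hsurj (T.adjoint ⟨y, hy⟩ + (e : ℂ) • y)
  have hxy : y - x = 0 := by
    obtain ⟨z, hz⟩ := hsurj (y - x)
    have h1 : ⟪T.adjoint ⟨y, hy⟩, (z : 𝓗)⟫_ℂ = ⟪y, T z⟫_ℂ :=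
      LinearPMap.adjoint_isFormalAdjoint hd ⟨y, hy⟩ z
    have h2 := hsym x z
    have h3 : ⟪T x + (e : ℂ) • (x : 𝓗), (z : 𝓗)⟫_ℂ =
      ⟪T.adjoint ⟨y, hy⟩ + (e : ℂ) • y, (z : 𝓗)⟫_ℂ := by rw [hx]
    have h4 : ⟪y - x, T z + (e : ℂ) • (z : 𝓗)⟫_ℂ = 0 := by
      simp only [inner_add_left, inner_smul_left, Complex.conj_ofReal] at h3
      rw [inner_add_right, inner_smul_right, inner_sub_left, inner_sub_left, ← h1, ← h2]
      linear_combination -h3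
    rwa [hz, inner_self_eq_zero] at h4
  rw [sub_eq_zero.1 hxy]
  exact x.2

/-- A criterion for essential self-adjointness of semibounded symmetric operators. -/
theorem IsSymmRel.isSelfAdjoint_closure {G : Submodule ℂ (𝓗 × 𝓗)} (hG : IsSymmRel G)
    (hd : Dense {x | ∃ y, (x, y) ∈ G}) (e : ℝ) {c : ℝ} (hc : 0 < c)
    (hbd : ∀ p ∈ G, c * ‖p.1‖ ≤ ‖p.2 + (e : ℂ) • p.1‖)
    (hran : Dense {f | ∃ p ∈ G, p.2 + (e : ℂ) • p.1 = f}) :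
    IsSelfAdjoint G.toLinearPMap.closure := by
  have hgr := hG.graph_closure hd
  set T := G.toLinearPMap.closure
  have hmem : ∀ x : T.domain, ((x : 𝓗), T x) ∈ G.topologicalClosure := fun x =>
    hgr ▸ T.mem_graph x
  refine isSelfAdjoint_of_surjective (e := e) ?_ (fun x y => hG.topologicalClosure _ (hmem x) _
    (hmem y)) fun f => ?_
  · refine (dense_domain_topologicalClosure hd).mono ?_
    rintro x ⟨y, hy⟩
    rw [← hgr] at hy
    exact LinearPMap.mem_domain_of_mem_graph hy
  · obtain ⟨u, hu, hlim⟩ := mem_closure_iff_seq_limit.1 (hran f)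
    choose p hp hpu using hu
    -- Density of the range gives approximate solutions; the lower bound on T + e makes them a
    -- Cauchy sequence, so the closed operator attains f.
    have hcau : CauchySeq fun n => (p n).1 := by
      rw [Metric.cauchySeq_iff']
      intro ε hε
      obtain ⟨N, hN⟩ := Metric.cauchySeq_iff'.1 hlim.cauchySeq (c * ε) (by positivity)
      refine ⟨N, fun n hn => ?_⟩
      have h1 := hbd _ (G.sub_mem (hp n) (hp N))
      have h2 := hN n hn
      rw [dist_eq_norm] at h2 ⊢
      rw [← hpu, ← hpu] at h2
      have h3 : (p n - p N).2 + (e : ℂ) • (p n - p N).1 =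
          (p n).2 + (e : ℂ) • (p n).1 - ((p N).2 + (e : ℂ) • (p N).1) := by
        simp only [Prod.fst_sub, Prod.snd_sub, smul_sub]; abel
      rw [h3] at h1
      exact lt_of_mul_lt_mul_left (h1.trans_lt h2) hc.le
    obtain ⟨x, hx⟩ := cauchySeq_tendsto_of_complete hcau
    have hlim2 : Filter.Tendsto (fun n => (p n).2) Filter.atTop (nhds (f - (e : ℂ) • x)) := by
      have := hlim.sub (hx.const_smul (e : ℂ))
      refine this.congr fun n => ?_
      rw [← hpu, add_sub_cancel_right]
    have hcl : (x, f - (e : ℂ) • x) ∈ T.graph := by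
      rw [hgr]
      exact mem_closure_of_tendsto (hx.prodMk_nhds hlim2) (.of_forall hp)
    refine ⟨⟨x, LinearPMap.mem_domain_of_mem_graph hcl⟩, ?_⟩
    have h1 : T ⟨x, LinearPMap.mem_domain_of_mem_graph hcl⟩ = f - (e : ℂ) • x :=
      T.mem_graph_snd_inj (T.mem_graph _) hcl rfl
    rw [h1]
    simp

omit [CompleteSpace 𝓗] in
theorem le_norm_of_mem_closure {G : Submodule ℂ (𝓗 × 𝓗)} {e c : ℝ}
    (hbd : ∀ p ∈ G, c * ‖p.1‖ ≤ ‖p.2 + (e : ℂ) • p.1‖) :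
    ∀ p ∈ G.topologicalClosure, c * ‖p.1‖ ≤ ‖p.2 + (e : ℂ) • p.1‖ := by
  intro p hp
  refine closure_minimal (s := (G : Set (𝓗 × 𝓗)))
    (t := {p | c * ‖p.1‖ ≤ ‖p.2 + (e : ℂ) • p.1‖}) (fun p hp => hbd p hp) ?_ hp
  exact isClosed_le (by fun_prop) (by fun_prop)

/-- Approximation in the graph norm of `G` is also approximation in the graph norm of a relation
that is bounded relatively to `G`. -/
theorem exists_seq_of_relatively_bounded {G J : Submodule ℂ (𝓗 × 𝓗)} {e C : ℝ}
    (hJ : ∀ p ∈ J, p.1 = 0 → p.2 = 0)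
    (h : ∀ p ∈ G, ∃ j, (p.1, j) ∈ J ∧ ‖j‖ ≤ C * ‖p.2 + (e : ℂ) • p.1‖)
    {p : 𝓗 × 𝓗} (hp : p ∈ G.topologicalClosure) :
    ∃ (u : ℕ → 𝓗 × 𝓗) (v : ℕ → 𝓗) (g : 𝓗), (∀ n, u n ∈ G) ∧ (∀ n, ((u n).1, v n) ∈ J) ∧
      Filter.Tendsto u Filter.atTop (nhds p) ∧ Filter.Tendsto v Filter.atTop (nhds g) ∧
      ‖g‖ ≤ C * ‖p.2 + (e : ℂ) • p.1‖ := by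
  obtain ⟨u, hu, hlim⟩ := mem_closure_iff_seq_limit.1 hp
  choose v hv hvb using fun n => h (u n) (hu n)
  have hsum : Filter.Tendsto (fun n => (u n).2 + (e : ℂ) • (u n).1) Filter.atTop
      (nhds (p.2 + (e : ℂ) • p.1)) :=
    ((by fun_prop : Continuous fun q : 𝓗 × 𝓗 => q.2 + (e : ℂ) • q.1).tendsto p).comp hlim
  have hdiff : ∀ n m, ‖v n - v m‖ ≤ |C| * ‖((u n).2 + (e : ℂ) • (u n).1) -
      ((u m).2 + (e : ℂ) • (u m).1)‖ := by
    intro n m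
    -- The bound comes with some image j of the difference; single-valuedness of J identifies j with
    -- v n − v m.
    obtain ⟨j, hj, hjb⟩ := h _ (G.sub_mem (hu n) (hu m))
    have h1 := J.sub_mem (J.sub_mem (hv n) (hv m)) hj
    have h2 : v n - v m = j := sub_eq_zero.1 (hJ _ h1 (by simp))
    have h3 : (u n - u m).2 + (e : ℂ) • (u n - u m).1 =
        (u n).2 + (e : ℂ) • (u n).1 - ((u m).2 + (e : ℂ) • (u m).1) := by
      simp only [Prod.fst_sub, Prod.snd_sub, smul_sub]; abel
    rw [h3, ← h2] at hjb
    exact hjb.trans (mul_le_mul_of_nonneg_right (le_abs_self C) (norm_nonneg _))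
  have hcau : CauchySeq v := by
    rw [Metric.cauchySeq_iff']
    intro ε hε
    obtain ⟨N, hN⟩ := Metric.cauchySeq_iff'.1 hsum.cauchySeq (ε / (|C| + 1)) (by positivity)
    refine ⟨N, fun n hn => ?_⟩
    have h1 := hN n hn
    rw [dist_eq_norm] at h1 ⊢
    rw [lt_div_iff₀ (by positivity)] at h1
    have := hdiff n N
    have h0 := norm_nonneg ((u n).2 + (e : ℂ) • (u n).1 - ((u N).2 + (e : ℂ) • (u N).1))
    nlinarith
  obtain ⟨g, hg⟩ := cauchySeq_tendsto_of_complete hcau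
  exact ⟨u, v, g, hu, hv, hlim, hg, le_of_tendsto_of_tendsto' hg.norm
    (hsum.norm.const_mul C) hvb⟩

end HilbertSpace

/-! ### Hilbert–Schmidt and trace class operators. -/

section HilbertSpace

variable {𝓗 : Type*} [NormedAddCommGroup 𝓗] [InnerProductSpace ℂ 𝓗] [CompleteSpace 𝓗]

/-- The square of the Hilbert–Schmidt norm. -/
def hsNormSq (T : 𝓗 →L[ℂ] 𝓗) : ENNReal := ∑' i, ‖T (onb 𝓗 i)‖ₑ ^ 2

theorem enorm_sq_eq_ofReal {F : Type*} [SeminormedAddCommGroup F] (x : F) :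
    ‖x‖ₑ ^ 2 = ENNReal.ofReal (‖x‖ ^ 2) := by
  rw [← ofReal_norm, ENNReal.ofReal_pow (norm_nonneg _)]

omit [CompleteSpace 𝓗] in
theorem enorm_sq_eq_tsum {ι : Type*} (b : HilbertBasis ι ℂ 𝓗) (x : 𝓗) :
    ‖x‖ₑ ^ 2 = ∑' i, ‖⟪b i, x⟫_ℂ‖ₑ ^ 2 := by
  have h := b.hasSum_inner_mul_inner x x
  have h2 : HasSum (fun i => ‖⟪b i, x⟫_ℂ‖ ^ 2) (‖x‖ ^ 2) := by
    have h3 := Complex.hasSum_re h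
    have h4 : (⟪x, x⟫_ℂ).re = ‖x‖ ^ 2 := by rw [inner_self_eq_norm_sq_to_K]; norm_cast
    rw [h4] at h3
    refine h3.congr_fun fun i => ?_
    rw [← inner_conj_symm x (b i), ← Complex.normSq_eq_conj_mul_self, Complex.ofReal_re,
      Complex.normSq_eq_norm_sq]
  rw [enorm_sq_eq_ofReal, ← h2.tsum_eq, ENNReal.ofReal_tsum_of_nonneg (fun _ => by positivity)
    h2.summable]
  exact tsum_congr fun i => (enorm_sq_eq_ofReal _).symm

/-- By Parseval both sides are the double sum of squared moduli of the matrix elements, and Tonelli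
in [0, ∞] exchanges the order. -/
theorem hsNormSq_adjoint (T : 𝓗 →L[ℂ] 𝓗) :
    hsNormSq (ContinuousLinearMap.adjoint T) = hsNormSq T := by
  rw [hsNormSq, hsNormSq]
  simp_rw [enorm_sq_eq_tsum (onb 𝓗) (T _),
    enorm_sq_eq_tsum (onb 𝓗) (ContinuousLinearMap.adjoint T _)]
  rw [ENNReal.tsum_comm]
  refine tsum_congr fun i => tsum_congr fun j => ?_
  rw [ContinuousLinearMap.adjoint_inner_right, ← inner_conj_symm, RCLike.enorm_conj]

theorem hsNormSq_mul_le (S T : 𝓗 →L[ℂ] 𝓗) : hsNormSq (S * T) ≤ ‖S‖ₑ ^ 2 * hsNormSq T := by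
  rw [hsNormSq, hsNormSq, ← ENNReal.tsum_mul_left]
  refine ENNReal.tsum_le_tsum fun i => ?_
  rw [← mul_pow]
  gcongr
  exact S.le_opENorm _

theorem hsNormSq_mul_le' (S T : 𝓗 →L[ℂ] 𝓗) : hsNormSq (S * T) ≤ hsNormSq S * ‖T‖ₑ ^ 2 := by
  rw [← hsNormSq_adjoint (S * T), ← hsNormSq_adjoint S, mul_comm]
  have h1 : ContinuousLinearMap.adjoint (S * T) =
      ContinuousLinearMap.adjoint T * ContinuousLinearMap.adjoint S :=
    ContinuousLinearMap.adjoint_comp S T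
  have h2 : ‖ContinuousLinearMap.adjoint T‖ₑ = ‖T‖ₑ := by
    rw [← ofReal_norm, ← ofReal_norm, LinearIsometryEquiv.norm_map]
  rw [h1, ← h2]
  exact hsNormSq_mul_le _ _

theorem hsNormSq_mul_lt_top (S : 𝓗 →L[ℂ] 𝓗) {T : 𝓗 →L[ℂ] 𝓗} (hT : hsNormSq T < ⊤) :
    hsNormSq (S * T) < ⊤ :=
  (hsNormSq_mul_le S T).trans_lt (ENNReal.mul_lt_top (by simp) hT)

theorem hsNormSq_mul_lt_top' {S : 𝓗 →L[ℂ] 𝓗} (hS : hsNormSq S < ⊤) (T : 𝓗 →L[ℂ] 𝓗) :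
    hsNormSq (S * T) < ⊤ :=
  (hsNormSq_mul_le' S T).trans_lt (ENNReal.mul_lt_top hS (by simp))

theorem summable_of_hsNormSq_lt_top {T : 𝓗 →L[ℂ] 𝓗} (hT : hsNormSq T < ⊤) :
    Summable fun i => ‖T (onb 𝓗 i)‖ ^ 2 := by
  simp only [hsNormSq, enorm_sq_eq_ofReal] at hT
  refine (ENNReal.summable_toReal hT.ne).congr fun i => ?_
  rw [ENNReal.toReal_ofReal (by positivity)]

theorem toReal_hsNormSq (T : 𝓗 →L[ℂ] 𝓗) :
    (hsNormSq T).toReal = ∑' i, ‖T (onb 𝓗 i)‖ ^ 2 := by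
  simp only [hsNormSq, enorm_sq_eq_ofReal]
  rw [ENNReal.tsum_toReal_eq fun _ => ENNReal.ofReal_ne_top]
  exact tsum_congr fun i => ENNReal.toReal_ofReal (by positivity)

theorem hsNormSq_lt_top_of_summable {T : 𝓗 →L[ℂ] 𝓗}
    (hT : Summable fun i => ‖T (onb 𝓗 i)‖ ^ 2) : hsNormSq T < ⊤ := by
  simp only [hsNormSq, enorm_sq_eq_ofReal]
  rw [← ENNReal.ofReal_tsum_of_nonneg (fun _ => by positivity) hT]
  exact ENNReal.ofReal_lt_top

theorem summable_inner_of_hsNormSq {X Y : 𝓗 →L[ℂ] 𝓗} (hX : hsNormSq X < ⊤)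
    (hY : hsNormSq Y < ⊤) : Summable fun i => ⟪X (onb 𝓗 i), Y (onb 𝓗 i)⟫_ℂ := by
  refine Summable.of_norm_bounded
    ((summable_of_hsNormSq_lt_top hX).add (summable_of_hsNormSq_lt_top hY)) fun i => ?_
  have h := norm_inner_le_norm (𝕜 := ℂ) (X (onb 𝓗 i)) (Y (onb 𝓗 i))
  nlinarith [sq_nonneg (‖X (onb 𝓗 i)‖ - ‖Y (onb 𝓗 i)‖), sq_nonneg ‖X (onb 𝓗 i)‖,
    sq_nonneg ‖Y (onb 𝓗 i)‖]

/-- Polarization of an identity between Hilbert–Schmidt norms. -/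
theorem tsum_inner_eq_of_hsNormSq_eq {X Y X' Y' : 𝓗 →L[ℂ] 𝓗} (hX : hsNormSq X < ⊤)
    (hY : hsNormSq Y < ⊤) (hX' : hsNormSq X' < ⊤) (hY' : hsNormSq Y' < ⊤)
    (h : ∀ z : ℂ, hsNormSq (X + z • Y) = hsNormSq (X' + (starRingEnd ℂ) z • Y')) :
    ∑' i, ⟪X (onb 𝓗 i), Y (onb 𝓗 i)⟫_ℂ = ∑' i, ⟪Y' (onb 𝓗 i), X' (onb 𝓗 i)⟫_ℂ := by
  have expand : ∀ (X Y : 𝓗 →L[ℂ] 𝓗), hsNormSq X < ⊤ → hsNormSq Y < ⊤ → ∀ z : ℂ,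
      (hsNormSq (X + z • Y)).toReal = (hsNormSq X).toReal + ‖z‖ ^ 2 * (hsNormSq Y).toReal +
        2 * (z * ∑' i, ⟪X (onb 𝓗 i), Y (onb 𝓗 i)⟫_ℂ).re := by
    intro X Y hX hY z
    have hs := ((summable_inner_of_hsNormSq hX hY).mul_left z).hasSum
    rw [tsum_mul_left] at hs
    have h1 := (((summable_of_hsNormSq_lt_top hX).hasSum.add
      ((summable_of_hsNormSq_lt_top hY).hasSum.mul_left (‖z‖ ^ 2))).add
      ((Complex.hasSum_re hs).mul_left 2))
    rw [toReal_hsNormSq, toReal_hsNormSq, toReal_hsNormSq, ← h1.tsum_eq]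
    refine tsum_congr fun i => ?_
    simp only [add_apply, smul_apply]
    rw [norm_add_sq (𝕜 := ℂ), norm_smul, inner_smul_right, mul_pow]
    simp only [RCLike.re_to_complex]
    ring
  set a := ∑' i, ⟪X (onb 𝓗 i), Y (onb 𝓗 i)⟫_ℂ with ha
  set c := ∑' i, ⟪X' (onb 𝓗 i), Y' (onb 𝓗 i)⟫_ℂ with hc
  have hconj : ∑' i, ⟪Y' (onb 𝓗 i), X' (onb 𝓗 i)⟫_ℂ = (starRingEnd ℂ) c := by
    rw [hc, Complex.conj_tsum]
    exact tsum_congr fun i => (inner_conj_symm _ _).symm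
  rw [hconj]
  have key : ∀ z : ℂ, (hsNormSq X).toReal + ‖z‖ ^ 2 * (hsNormSq Y).toReal + 2 * (z * a).re =
      (hsNormSq X').toReal + ‖z‖ ^ 2 * (hsNormSq Y').toReal +
        2 * ((starRingEnd ℂ) z * c).re := by
    intro z
    have h1 := congrArg ENNReal.toReal (h z)
    rw [expand X Y hX hY, expand X' Y' hX' hY'] at h1
    simpa using h1
  have k1 := key 1
  have k2 := key (-1)
  have k3 := key Complex.I
  have k4 := key (-Complex.I)
  simp at k1 k2 k3 k4
  apply Complex.ext
  · simp; linarith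
  · simp; linarith

/-- Polarisation of `hsNormSq_adjoint`; this is the cyclicity Tr(X*Y) = Tr(YX*). -/
theorem tsum_inner_adjoint {X Y : 𝓗 →L[ℂ] 𝓗} (hX : hsNormSq X < ⊤) (hY : hsNormSq Y < ⊤) :
    ∑' i, ⟪X (onb 𝓗 i), Y (onb 𝓗 i)⟫_ℂ = ∑' i, ⟪ContinuousLinearMap.adjoint Y (onb 𝓗 i),
      ContinuousLinearMap.adjoint X (onb 𝓗 i)⟫_ℂ := by
  refine tsum_inner_eq_of_hsNormSq_eq hX hY (by rwa [hsNormSq_adjoint])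
    (by rwa [hsNormSq_adjoint]) fun z => ?_
  rw [← hsNormSq_adjoint (X + z • Y), map_add, LinearIsometryEquiv.map_smulₛₗ]

/-- Invariance of the trace under unitary conjugation. -/
theorem tsum_inner_mul_isometry {X Y U : 𝓗 →L[ℂ] 𝓗} (hX : hsNormSq X < ⊤) (hY : hsNormSq Y < ⊤)
    (hU : U * ContinuousLinearMap.adjoint U = 1) :
    ∑' i, ⟪(X * U) (onb 𝓗 i), (Y * U) (onb 𝓗 i)⟫_ℂ =
      ∑' i, ⟪X (onb 𝓗 i), Y (onb 𝓗 i)⟫_ℂ := by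
  rw [tsum_inner_adjoint (hsNormSq_mul_lt_top' hX U) (hsNormSq_mul_lt_top' hY U),
    tsum_inner_adjoint hX hY]
  refine tsum_congr fun i => ?_
  have h1 : ∀ S : 𝓗 →L[ℂ] 𝓗, ContinuousLinearMap.adjoint (S * U) =
      ContinuousLinearMap.adjoint U * ContinuousLinearMap.adjoint S := fun S =>
    ContinuousLinearMap.adjoint_comp S U
  have h2 : ∀ x, U (ContinuousLinearMap.adjoint U x) = x := fun x =>
    congrArg (fun S : 𝓗 →L[ℂ] 𝓗 => S x) hU
  rw [h1, h1]
  show ⟪ContinuousLinearMap.adjoint U _, ContinuousLinearMap.adjoint U _⟫_ℂ = _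
  rw [ContinuousLinearMap.adjoint_inner_right, h2]
  rfl

theorem inner_absOp_self_nonneg (T : 𝓗 →L[ℂ] 𝓗) (x : 𝓗) : 0 ≤ (⟪x, absOp T x⟫_ℂ).re :=
  ((ContinuousLinearMap.nonneg_iff_isPositive _).1 (CFC.abs_nonneg T)).re_inner_nonneg_right x

theorem absOp_adjoint (T : 𝓗 →L[ℂ] 𝓗) : ContinuousLinearMap.adjoint (absOp T) = absOp T :=
  (CFC.abs_nonneg T).isSelfAdjoint

theorem absOp_mul_absOp (T : 𝓗 →L[ℂ] 𝓗) :
    absOp T * absOp T = ContinuousLinearMap.adjoint T * T :=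
  CFC.abs_mul_abs T

theorem absOp_absOp_apply (T : 𝓗 →L[ℂ] 𝓗) (x : 𝓗) :
    absOp T (absOp T x) = ContinuousLinearMap.adjoint T (T x) :=
  congrArg (fun S : 𝓗 →L[ℂ] 𝓗 => S x) (absOp_mul_absOp T)

theorem norm_absOp_apply (T : 𝓗 →L[ℂ] 𝓗) (x : 𝓗) : ‖absOp T x‖ = ‖T x‖ := by
  have h : ⟪absOp T x, absOp T x⟫_ℂ = ⟪T x, T x⟫_ℂ := by
    rw [← ContinuousLinearMap.adjoint_inner_right, absOp_adjoint,
      ← ContinuousLinearMap.adjoint_inner_right T, absOp_absOp_apply]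
  rw [inner_self_eq_norm_sq_to_K, inner_self_eq_norm_sq_to_K] at h
  have h2 : ‖absOp T x‖ ^ 2 = ‖T x‖ ^ 2 := by exact_mod_cast h
  exact (pow_left_inj₀ (norm_nonneg _) (norm_nonneg _) two_ne_zero).1 h2

theorem norm_absOp_le_norm_add (T : 𝓗 →L[ℂ] 𝓗) {ε : ℝ} (hε : 0 ≤ ε) (x : 𝓗) :
    ‖absOp T x‖ ≤ ‖absOp T x + (ε : ℂ) • x‖ := by
  refine le_of_sq_le_sq ?_ (norm_nonneg _)
  rw [norm_add_sq (𝕜 := ℂ), inner_smul_right]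
  have h1 := inner_absOp_self_nonneg T x
  have h2 : (RCLike.re ((ε : ℂ) * ⟪absOp T x, x⟫_ℂ) : ℝ) = ε * (⟪x, absOp T x⟫_ℂ).re := by
    rw [RCLike.re_to_complex, Complex.re_ofReal_mul]
    congr 1
    exact inner_re_symm (𝕜 := ℂ) _ _
  rw [h2]
  nlinarith [mul_nonneg hε h1, sq_nonneg ‖(ε : ℂ) • x‖]

/-- A product of two Hilbert–Schmidt operators is trace class. -/
theorem isTraceClass_mul {X Y : 𝓗 →L[ℂ] 𝓗} (hX : hsNormSq X < ⊤) (hY : hsNormSq Y < ⊤) :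
    IsTraceClass (X * Y) := by
  refine ⟨onbIndex 𝓗, onb 𝓗, ?_⟩
  set T := X * Y
  refine summable_of_sum_le (c := ∑' i, ‖Y (onb 𝓗 i)‖ ^ 2 + (hsNormSq X).toReal)
    (fun i => inner_absOp_self_nonneg T _) fun F => ?_
  refine le_of_forall_pos_le_add fun η hη => ?_
  -- The regularised inverse D = (|T| + ε)⁻¹ replaces the polar decomposition: T D is a contraction
  -- approximating the partial isometry. The size of ε makes the total error over F at most η.
  set ε : ℝ := η / (F.card + 1) with hεdef
  have hε : 0 < ε := by positivity
  have hunit : IsUnit (absOp T + (ε : ℂ) • 1) := by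
    have h1 : (-ε) ∉ spectrum ℝ (absOp T) := fun hmem => by
      have := spectrum_nonneg_of_nonneg (CFC.abs_nonneg T) hmem
      linarith
    rw [spectrum.notMem_iff] at h1
    have h2 : absOp T + (ε : ℂ) • 1 = -((algebraMap ℝ (𝓗 →L[ℂ] 𝓗)) (-ε) - absOp T) := by
      rw [Algebra.algebraMap_eq_smul_one, neg_smul, neg_sub, sub_neg_eq_add]
      rfl
    rw [h2]
    exact h1.neg
  obtain ⟨D, hD1, hD2⟩ := (isUnit_iff_exists).1 hunit
  have hcomm : D * absOp T = absOp T * D := by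
    have h1 : absOp T * (absOp T + (ε : ℂ) • 1) = (absOp T + (ε : ℂ) • 1) * absOp T := by
      simp [mul_add, add_mul]
    calc D * absOp T = D * (absOp T * (absOp T + (ε : ℂ) • 1)) * D := by
          rw [mul_assoc, mul_assoc, hD1, mul_one]
      _ = absOp T * D := by rw [h1, ← mul_assoc, hD2, one_mul]
  have hbound : ∀ x, ‖absOp T (D x)‖ ≤ ‖x‖ := by
    intro x
    have h1 := norm_absOp_le_norm_add T hε.le (D x)
    have h2 : absOp T (D x) + (ε : ℂ) • D x = x := by
      have := congrArg (fun S : 𝓗 →L[ℂ] 𝓗 => S x) hD1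
      simpa using this
    rwa [h2] at h1
  have hW : ‖T * D‖ ≤ 1 := ContinuousLinearMap.opNorm_le_bound _ zero_le_one fun x => by
    rw [one_mul]
    exact (norm_absOp_apply T (D x)).symm.le.trans (hbound x)
  have hDadj : ContinuousLinearMap.adjoint D = D := by
    have h1 : (ContinuousLinearMap.adjoint D) * (absOp T + (ε : ℂ) • 1) = 1 := by
      have h3 := congrArg ContinuousLinearMap.adjoint hD1
      have h4 : ContinuousLinearMap.adjoint ((absOp T + (ε : ℂ) • 1) * D) =
          ContinuousLinearMap.adjoint D * ContinuousLinearMap.adjoint (absOp T + (ε : ℂ) • 1) :=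
        ContinuousLinearMap.adjoint_comp _ _
      have h6 : ContinuousLinearMap.adjoint (1 : 𝓗 →L[ℂ] 𝓗) = 1 := star_one _
      have h5 : ContinuousLinearMap.adjoint (absOp T + (ε : ℂ) • (1 : 𝓗 →L[ℂ] 𝓗)) =
          absOp T + (ε : ℂ) • 1 := by
        rw [map_add, absOp_adjoint, LinearIsometryEquiv.map_smulₛₗ, Complex.conj_ofReal, h6]
      rwa [h4, h5, h6] at h3
    calc ContinuousLinearMap.adjoint D
        = ContinuousLinearMap.adjoint D * ((absOp T + (ε : ℂ) • 1) * D) := by rw [hD1, mul_one]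
      _ = D := by rw [← mul_assoc, h1, one_mul]
  -- From |T| = ε|T|D + D T*T and T = XY, the main term is a pairing of X*(TD) with Y, both
  -- Hilbert–Schmidt with norms bounded independently of ε.
  have hid : ∀ x, ⟪x, absOp T x⟫_ℂ = (ε : ℂ) * ⟪x, absOp T (D x)⟫_ℂ +
      ⟪(ContinuousLinearMap.adjoint X * (T * D)) x, Y x⟫_ℂ := by
    intro x
    have h1 : absOp T x = (ε : ℂ) • absOp T (D x) + D (absOp T (absOp T x)) := by
      have h2 : absOp T = (ε : ℂ) • (absOp T * D) + D * (absOp T * absOp T) := by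
        calc absOp T = (D * (absOp T + (ε : ℂ) • 1)) * absOp T := by rw [hD2, one_mul]
          _ = _ := by
            rw [← hcomm, mul_add, add_mul, mul_assoc, mul_assoc, add_comm]
            simp
      conv_lhs => rw [h2]
      rfl
    rw [h1, inner_add_right, inner_smul_right, absOp_absOp_apply]
    congr 1
    rw [← ContinuousLinearMap.adjoint_inner_left, hDadj, ContinuousLinearMap.adjoint_inner_right]
    show _ = ⟪ContinuousLinearMap.adjoint X (T (D x)), Y x⟫_ℂ
    rw [ContinuousLinearMap.adjoint_inner_left]
    rfl
  have hterm : ∀ i, (⟪onb 𝓗 i, absOp T (onb 𝓗 i)⟫_ℂ).re ≤ ε + (‖Y (onb 𝓗 i)‖ ^ 2 +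
      ‖(ContinuousLinearMap.adjoint X * (T * D)) (onb 𝓗 i)‖ ^ 2) := by
    intro i
    rw [hid, Complex.add_re, Complex.re_ofReal_mul]
    have hn : ‖onb 𝓗 i‖ = 1 := (onb 𝓗).orthonormal.1 i
    have h1 : (⟪onb 𝓗 i, absOp T (D (onb 𝓗 i))⟫_ℂ).re ≤ 1 := by
      refine (re_inner_le_norm (𝕜 := ℂ) _ _).trans ?_
      rw [hn, one_mul]
      exact (hbound _).trans hn.le
    have h2 := re_inner_le_norm (𝕜 := ℂ)
      ((ContinuousLinearMap.adjoint X * (T * D)) (onb 𝓗 i)) (Y (onb 𝓗 i))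
    have h3 : (⟪(ContinuousLinearMap.adjoint X * (T * D)) (onb 𝓗 i), Y (onb 𝓗 i)⟫_ℂ).re ≤
        ‖(ContinuousLinearMap.adjoint X * (T * D)) (onb 𝓗 i)‖ * ‖Y (onb 𝓗 i)‖ := h2
    nlinarith [sq_nonneg (‖(ContinuousLinearMap.adjoint X * (T * D)) (onb 𝓗 i)‖ -
      ‖Y (onb 𝓗 i)‖), sq_nonneg ‖(ContinuousLinearMap.adjoint X * (T * D)) (onb 𝓗 i)‖,
      sq_nonneg ‖Y (onb 𝓗 i)‖]
  have hXWle : hsNormSq (ContinuousLinearMap.adjoint X * (T * D)) ≤ hsNormSq X := by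
    refine (hsNormSq_mul_le' _ _).trans ?_
    rw [hsNormSq_adjoint]
    refine mul_le_of_le_one_right' (pow_le_one' ?_ 2)
    rw [← ofReal_norm, ← ENNReal.ofReal_one]
    exact ENNReal.ofReal_le_ofReal hW
  have hXW := hXWle.trans_lt hX
  have hreal : ∑' i, ‖(ContinuousLinearMap.adjoint X * (T * D)) (onb 𝓗 i)‖ ^ 2 ≤
      (hsNormSq X).toReal := by
    rw [← toReal_hsNormSq]
    exact ENNReal.toReal_mono hX.ne hXWle
  have hF : (F.card : ℝ) * ε ≤ η := by
    rw [hεdef, mul_div_assoc', div_le_iff₀ (by positivity)]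
    nlinarith
  calc ∑ i ∈ F, (⟪onb 𝓗 i, absOp T (onb 𝓗 i)⟫_ℂ).re
      ≤ ∑ i ∈ F, (ε + (‖Y (onb 𝓗 i)‖ ^ 2 +
        ‖(ContinuousLinearMap.adjoint X * (T * D)) (onb 𝓗 i)‖ ^ 2)) :=
        Finset.sum_le_sum fun i _ => hterm i
    _ = F.card * ε + (∑ i ∈ F, ‖Y (onb 𝓗 i)‖ ^ 2 +
        ∑ i ∈ F, ‖(ContinuousLinearMap.adjoint X * (T * D)) (onb 𝓗 i)‖ ^ 2) := by
        rw [Finset.sum_add_distrib, Finset.sum_add_distrib, Finset.sum_const, nsmul_eq_mul]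
    _ ≤ _ := by
      have h1 := (summable_of_hsNormSq_lt_top hY).sum_le_tsum F (fun _ _ => by positivity)
      have h2 := (summable_of_hsNormSq_lt_top hXW).sum_le_tsum F (fun _ _ => by positivity)
      linarith

end HilbertSpace

/-! ### Trace over a unit cell and the abstract variational argument. -/

section HilbertSpace

variable {𝓗 : Type*} [NormedAddCommGroup 𝓗] [InnerProductSpace ℂ 𝓗] [CompleteSpace 𝓗]

/-- A unitary representation `τ` of an abelian group, with a projection `P` onto a unit cell. -/
structure IsCellProjection {Γ : Type*} [AddCommGroup Γ] (τ : Γ → 𝓗 →L[ℂ] 𝓗)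
    (P : 𝓗 →L[ℂ] 𝓗) : Prop where
  adjoint_τ : ∀ r, ContinuousLinearMap.adjoint (τ r) = τ (-r)
  adjoint_P : ContinuousLinearMap.adjoint P = P
  tsum_eq : ∀ x, ∑' r, ‖P (τ r x)‖ₑ ^ 2 = ‖x‖ₑ ^ 2

theorem adjoint_mul (S T : 𝓗 →L[ℂ] 𝓗) : ContinuousLinearMap.adjoint (S * T) =
    ContinuousLinearMap.adjoint T * ContinuousLinearMap.adjoint S :=
  ContinuousLinearMap.adjoint_comp S T

/-- The trace in the unit cell. -/
def cellTrace (P X : 𝓗 →L[ℂ] 𝓗) : ℂ := ∑' i, ⟪P (onb 𝓗 i), X (P (onb 𝓗 i))⟫_ℂ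

/-- Writes the trace of X = Xγ over a cell as a pairing of two operators that are Hilbert–Schmidt on
the cell as soon as γ is. -/
theorem inner_adjoint_apply_of_mul_eq {X γ : 𝓗 →L[ℂ] 𝓗} (hX : X * γ = X) (x y : 𝓗) :
    ⟪ContinuousLinearMap.adjoint X x, γ y⟫_ℂ = ⟪x, X y⟫_ℂ := by
  rw [ContinuousLinearMap.adjoint_inner_left]
  exact congrArg (fun S : 𝓗 →L[ℂ] 𝓗 => ⟪x, S y⟫_ℂ) hX

theorem summable_inner_apply {X Y P : 𝓗 →L[ℂ] 𝓗} (hX : hsNormSq (X * P) < ⊤)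
    (hY : hsNormSq (Y * P) < ⊤) :
    Summable fun i => ⟪X (P (onb 𝓗 i)), Y (P (onb 𝓗 i))⟫_ℂ :=
  (summable_inner_of_hsNormSq hX hY).congr fun _ => rfl

namespace IsCellProjection

variable {Γ : Type*} [AddCommGroup Γ] {τ : Γ → 𝓗 →L[ℂ] 𝓗} {P : 𝓗 →L[ℂ] 𝓗}
  (hP : IsCellProjection τ P)
include hP

theorem trace_eq_cellTrace (X : 𝓗 →L[ℂ] 𝓗) : trace (P * X * P) = cellTrace P X := by
  rw [trace, cellTrace]
  refine tsum_congr fun i => ?_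
  conv_rhs => rw [← hP.adjoint_P, ContinuousLinearMap.adjoint_inner_left, hP.adjoint_P]
  rfl

theorem commute_adjoint {X : 𝓗 →L[ℂ] 𝓗} (hX : ∀ r, Commute X (τ r)) (r : Γ) :
    Commute (ContinuousLinearMap.adjoint X) (τ r) := by
  have h := congrArg ContinuousLinearMap.adjoint (hX (-r)).eq
  rw [adjoint_mul, adjoint_mul, hP.adjoint_τ, neg_neg] at h
  exact h.symm

/-- Cutting the output into cells, ‖YP‖² is the sum over r of ‖P τ_r Y P‖². For periodic X the
adjoint of P τ_r X P is P τ_{−r} X* P, so taking adjoints only permutes the terms. -/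
theorem hsNormSq_adjoint_mul {X : 𝓗 →L[ℂ] 𝓗} (hX : ∀ r, Commute X (τ r)) :
    hsNormSq (ContinuousLinearMap.adjoint X * P) = hsNormSq (X * P) := by
  have key : ∀ Y : 𝓗 →L[ℂ] 𝓗, hsNormSq (Y * P) = ∑' r, hsNormSq (P * (τ r * Y) * P) := by
    intro Y
    simp only [hsNormSq]
    rw [ENNReal.tsum_comm]
    exact tsum_congr fun i => (hP.tsum_eq (Y (P (onb 𝓗 i)))).symm
  rw [key, key, ← (Equiv.neg Γ).tsum_eq]
  refine tsum_congr fun r => ?_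
  rw [← BlochCurrent.hsNormSq_adjoint (P * (τ r * X) * P), adjoint_mul, adjoint_mul, adjoint_mul,
    hP.adjoint_P, hP.adjoint_τ, (hP.commute_adjoint hX _).eq, mul_assoc]
  rfl

/-- Cyclicity of the trace per unit volume. -/
theorem tsum_inner_eq {X Y : 𝓗 →L[ℂ] 𝓗} (hX : ∀ r, Commute X (τ r)) (hY : ∀ r, Commute Y (τ r))
    (hX' : hsNormSq (X * P) < ⊤) (hY' : hsNormSq (Y * P) < ⊤) :
    ∑' i, ⟪X (P (onb 𝓗 i)), Y (P (onb 𝓗 i))⟫_ℂ =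
      ∑' i, ⟪ContinuousLinearMap.adjoint Y (P (onb 𝓗 i)),
        ContinuousLinearMap.adjoint X (P (onb 𝓗 i))⟫_ℂ := by
  refine tsum_inner_eq_of_hsNormSq_eq hX' hY' (X' := ContinuousLinearMap.adjoint X * P)
    (Y' := ContinuousLinearMap.adjoint Y * P) (by rwa [hP.hsNormSq_adjoint_mul hX])
    (by rwa [hP.hsNormSq_adjoint_mul hY]) fun z => ?_
  have h1 : X * P + z • (Y * P) = (X + z • Y) * P := by rw [add_mul, smul_mul_assoc]
  have h2 : ContinuousLinearMap.adjoint X * P + (starRingEnd ℂ) z •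
      (ContinuousLinearMap.adjoint Y * P) = ContinuousLinearMap.adjoint (X + z • Y) * P := by
    rw [map_add, LinearIsometryEquiv.map_smulₛₗ, add_mul, smul_mul_assoc]
  rw [h1, h2, hP.hsNormSq_adjoint_mul fun r => (hX r).add_left ((hY r).smul_left z)]

section Bohm

variable {γ : 𝓗 →L[ℂ] 𝓗} (hγ : IsStarProjection γ) (hγτ : ∀ r, Commute γ (τ r))
  (hγP : hsNormSq (γ * P) < ⊤)
include hγP

omit hP in
theorem hsNormSq_lt_top_of_mul_eq {X : 𝓗 →L[ℂ] 𝓗} (hX : X * γ = X) : hsNormSq (X * P) < ⊤ := by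
  rw [← hX, mul_assoc]
  exact hsNormSq_mul_lt_top X hγP

theorem summable_cellTrace {X : 𝓗 →L[ℂ] 𝓗} (hX : X * γ = X) (hXτ : ∀ r, Commute X (τ r)) :
    Summable fun i => ⟪P (onb 𝓗 i), X (P (onb 𝓗 i))⟫_ℂ := by
  refine (summable_inner_of_hsNormSq (X := ContinuousLinearMap.adjoint X * P) (Y := γ * P)
    ?_ hγP).congr fun i => ?_
  · rw [hP.hsNormSq_adjoint_mul hXτ]
    exact hsNormSq_lt_top_of_mul_eq hγP hX
  · exact inner_adjoint_apply_of_mul_eq hX (P (onb 𝓗 i)) (P (onb 𝓗 i))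

include hγ hγτ in
-- Cyclicity moves γ from the right of X to its left, so that the summands become quadratic forms
-- evaluated on the range of γ.
theorem cellTrace_eq_tsum {X : 𝓗 →L[ℂ] 𝓗} (hX : X * γ = X) (hXτ : ∀ r, Commute X (τ r)) :
    cellTrace P X = ∑' i, ⟪γ (P (onb 𝓗 i)), X (P (onb 𝓗 i))⟫_ℂ := by
  have hγa : ContinuousLinearMap.adjoint γ = γ := hγ.isSelfAdjoint
  have h := hP.tsum_inner_eq (hP.commute_adjoint hXτ) hγτ
    (by rw [hP.hsNormSq_adjoint_mul hXτ]; exact hsNormSq_lt_top_of_mul_eq hγP hX) hγP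
  rw [hγa, ContinuousLinearMap.adjoint_adjoint] at h
  rw [← h, cellTrace]
  exact tsum_congr fun i => (inner_adjoint_apply_of_mul_eq hX (P (onb 𝓗 i)) (P (onb 𝓗 i))).symm

set_option maxHeartbeats 400000 in
include hγ hγτ in
/-- A bounded family of gauge transformations that leaves the energy of a state of lowest energy
unchanged to first order carries no current. -/
theorem cellTrace_eq_zero {K J : 𝓗 →L[ℂ] 𝓗} (hK : K * γ = K) (hJ : J * γ = J)
    (hKτ : ∀ r, Commute K (τ r)) (hJτ : ∀ r, Commute J (τ r))
    (hKneg : K ≤ 0) (c : ℝ) (U : ℝ → 𝓗 →L[ℂ] 𝓗)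
    (hU1 : ∀ s, U s * ContinuousLinearMap.adjoint (U s) = 1)
    (hU2 : ∀ s, ContinuousLinearMap.adjoint (U s) * U s = 1)
    (hUP : ∀ s, Commute (U s) P)
    (hUτ : ∀ s X, (∀ r, Commute X (τ r)) →
      ∀ r, Commute (U s * X * ContinuousLinearMap.adjoint (U s)) (τ r))
    (hre : ∀ (s : ℝ) ψ, (⟪(U s * γ * ContinuousLinearMap.adjoint (U s)) ψ,
      K ((U s * γ * ContinuousLinearMap.adjoint (U s)) ψ)⟫_ℂ).re ≤
      (⟪(U s * γ * ContinuousLinearMap.adjoint (U s)) ψ, (U s * (K + (s : ℂ) • J +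
        ((s ^ 2 * c : ℝ) : ℂ) • γ) * ContinuousLinearMap.adjoint (U s)) ψ⟫_ℂ).re)
    (him : ∀ (s : ℝ) ψ, (⟪(U s * γ * ContinuousLinearMap.adjoint (U s)) ψ, (U s * (K + (s : ℂ) • J +
        ((s ^ 2 * c : ℝ) : ℂ) • γ) * ContinuousLinearMap.adjoint (U s)) ψ⟫_ℂ).im = 0) :
    cellTrace P J = 0 := by
  have hγγ : γ * γ = γ := hγ.isIdempotentElem
  have hγa : ContinuousLinearMap.adjoint γ = γ := hγ.isSelfAdjoint
  have hsK : HasSum (fun i => ⟪P (onb 𝓗 i), K (P (onb 𝓗 i))⟫_ℂ) (cellTrace P K) :=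
    (hP.summable_cellTrace hγP hK hKτ).hasSum
  have hsJ : HasSum (fun i => ⟪P (onb 𝓗 i), J (P (onb 𝓗 i))⟫_ℂ) (cellTrace P J) :=
    (hP.summable_cellTrace hγP hJ hJτ).hasSum
  have hsγ : HasSum (fun i => ⟪P (onb 𝓗 i), γ (P (onb 𝓗 i))⟫_ℂ) (cellTrace P γ) :=
    (hP.summable_cellTrace hγP hγγ hγτ).hasSum
  -- With −K = S², the trace of K becomes minus a squared Hilbert–Schmidt norm, for which
  -- inequalities and adjoint invariance are available.
  set S : 𝓗 →L[ℂ] 𝓗 := CFC.sqrt (-K) with hS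
  have hKnn : 0 ≤ -K := neg_nonneg.2 hKneg
  have hSS : S * S = -K := CFC.sqrt_mul_sqrt_self _ hKnn
  have hSa : ContinuousLinearMap.adjoint S = S := (CFC.sqrt_nonneg (-K)).isSelfAdjoint
  have hSτ : ∀ r, Commute S (τ r) := fun r =>
    Commute.cfcₙ_nnreal (hKτ r).neg_left _
  have hSnorm : ∀ x, ‖S x‖ ^ 2 = -(⟪x, K x⟫_ℂ).re := by
    intro x
    have h1 : ⟪S x, S x⟫_ℂ = ⟪x, (-K) x⟫_ℂ := by
      rw [← hSS, ← ContinuousLinearMap.adjoint_inner_right, hSa]; rfl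
    have h2 : (⟪S x, S x⟫_ℂ).re = ‖S x‖ ^ 2 := by
      rw [inner_self_eq_norm_sq_to_K]; norm_cast
    rw [← h2, h1]
    simp
  have hSsum : HasSum (fun i => ‖(S * P) (onb 𝓗 i)‖ ^ 2) (-(cellTrace P K).re) := by
    refine (Complex.hasSum_re hsK).neg.congr_fun fun i => ?_
    exact hSnorm _
  have hSfin : hsNormSq (S * P) < ⊤ := hsNormSq_lt_top_of_summable hSsum.summable
  have hStr : (hsNormSq (S * P)).toReal = -(cellTrace P K).re := by
    rw [toReal_hsNormSq, hSsum.tsum_eq]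
  -- The displayed quadratic polynomial in s is the cell trace of C = K + sJ + s²cγ. It equals the
  -- trace of T = u C u*, the energy of the transformed state γs, which is then compared with the
  -- energy of the ground state.
  have main : ∀ s : ℝ,
      (cellTrace P K).re ≤ (cellTrace P K + s * cellTrace P J +
        ((s ^ 2 * c : ℝ) : ℂ) * cellTrace P γ).re ∧
      (cellTrace P K + s * cellTrace P J + ((s ^ 2 * c : ℝ) : ℂ) * cellTrace P γ).im = 0 := by
    intro s
    set u := U s
    set u' := ContinuousLinearMap.adjoint u with hu'
    set C := K + (s : ℂ) • J + ((s ^ 2 * c : ℝ) : ℂ) • γ with hC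
    set γs := u * γ * u' with hγs
    have hu1 : u * u' = 1 := hU1 s
    have hu2 : u' * u = 1 := hU2 s
    have hCγ : C * γ = C := by
      rw [hC, add_mul, add_mul, smul_mul_assoc, smul_mul_assoc, hK, hJ, hγγ]
    have hCτ : ∀ r, Commute C (τ r) := fun r =>
      ((hKτ r).add_left ((hJτ r).smul_left _)).add_left ((hγτ r).smul_left _)
    have hsum : cellTrace P C = cellTrace P K + s * cellTrace P J +
        ((s ^ 2 * c : ℝ) : ℂ) * cellTrace P γ := by
      rw [← ((hsK.add (hsJ.mul_left (s : ℂ))).add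
        (hsγ.mul_left ((s ^ 2 * c : ℝ) : ℂ))).tsum_eq, cellTrace]
      refine tsum_congr fun i => ?_
      simp only [hC, add_apply, smul_apply, inner_add_right, inner_smul_right]
    have hγsS : IsStarProjection γs := by
      refine ⟨?_, ?_⟩
      · show u * γ * u' * (u * γ * u') = u * γ * u'
        calc u * γ * u' * (u * γ * u') = u * γ * (u' * u) * γ * u' := by simp only [mul_assoc]
          _ = u * (γ * γ) * u' := by rw [hu2, mul_one, mul_assoc u γ γ]
          _ = _ := by rw [hγγ]
      · show ContinuousLinearMap.adjoint (u * γ * u') = u * γ * u'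
        rw [adjoint_mul, adjoint_mul, hγa, hu', ContinuousLinearMap.adjoint_adjoint, mul_assoc]
    have hγsa : ContinuousLinearMap.adjoint γs = γs := hγsS.isSelfAdjoint
    have hγsτ : ∀ r, Commute γs (τ r) := hUτ s γ hγτ
    have hu'P : u' * P = P * u' := by
      have h := congrArg ContinuousLinearMap.adjoint (hUP s).eq
      rw [adjoint_mul, adjoint_mul, hP.adjoint_P] at h
      exact h.symm
    have hγsP : hsNormSq (γs * P) < ⊤ := by
      have : γs * P = u * ((γ * P) * u') := by
        rw [hγs, mul_assoc (u * γ), hu'P]; simp only [mul_assoc]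
      rw [this]
      exact hsNormSq_mul_lt_top _ (hsNormSq_mul_lt_top' hγP _)
    set T := u * C * u' with hT
    have hTγ : T * γs = T := by
      rw [hT, hγs]
      calc u * C * u' * (u * γ * u') = u * C * (u' * u) * γ * u' := by simp only [mul_assoc]
        _ = u * (C * γ) * u' := by rw [hu2, mul_one, mul_assoc u C γ]
        _ = _ := by rw [hCγ]
    have hTτ : ∀ r, Commute T (τ r) := hUτ s C hCτ
    -- Since u commutes with P, this is unitary invariance of the trace within the cell, applied
    -- after factoring C = Cγ into Hilbert–Schmidt factors.
    have hTC : cellTrace P T = cellTrace P C := by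
      have hX : hsNormSq (ContinuousLinearMap.adjoint C * P) < ⊤ := by
        rw [hP.hsNormSq_adjoint_mul hCτ]
        exact hsNormSq_lt_top_of_mul_eq hγP hCγ
      have h := tsum_inner_mul_isometry hX hγP (U := u')
        (by rw [hu', ContinuousLinearMap.adjoint_adjoint]; exact hu2)
      rw [cellTrace, cellTrace]
      have h1 := inner_adjoint_apply_of_mul_eq hCγ
      have hc : ∀ x, P (u' x) = u' (P x) := fun x =>
        congrArg (fun S : 𝓗 →L[ℂ] 𝓗 => S x) hu'P.symm
      calc ∑' i, ⟪P (onb 𝓗 i), T (P (onb 𝓗 i))⟫_ℂ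
          = ∑' i, ⟪(ContinuousLinearMap.adjoint C * P * u') (onb 𝓗 i),
            (γ * P * u') (onb 𝓗 i)⟫_ℂ := by
            refine tsum_congr fun i => ?_
            show ⟪P (onb 𝓗 i), u (C (u' (P (onb 𝓗 i))))⟫_ℂ =
              ⟪ContinuousLinearMap.adjoint C (P (u' (onb 𝓗 i))), γ (P (u' (onb 𝓗 i)))⟫_ℂ
            rw [h1, hc, ← ContinuousLinearMap.adjoint_inner_left]
        _ = _ := h.trans (tsum_congr fun i => h1 _ _)
    have hTt : cellTrace P T = ∑' i, ⟪γs (P (onb 𝓗 i)), T (P (onb 𝓗 i))⟫_ℂ :=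
      hP.cellTrace_eq_tsum hγsS hγsτ hγsP hTγ hTτ
    have hTs : Summable fun i => ⟪γs (P (onb 𝓗 i)), T (P (onb 𝓗 i))⟫_ℂ :=
      summable_inner_apply hγsP (hsNormSq_lt_top_of_mul_eq hγsP hTγ)
    -- The variational inequality Tr(γs K γs) ≥ Tr K: adjoint invariance turns S γs into γs S, and
    -- the projection γs is a contraction.
    have hSγs : hsNormSq (S * γs * P) ≤ hsNormSq (S * P) := by
      have h1 : ContinuousLinearMap.adjoint (γs * S) = S * γs := by
        rw [adjoint_mul, hSa, hγsa]
      rw [← h1, hP.hsNormSq_adjoint_mul fun r => (hγsτ r).mul_left (hSτ r), mul_assoc]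
      refine (hsNormSq_mul_le _ _).trans (mul_le_of_le_one_left' (pow_le_one' ?_ 2))
      rw [← ofReal_norm, ← ENNReal.ofReal_one]
      exact ENNReal.ofReal_le_ofReal hγsS.norm_le
    have hSγsfin := hSγs.trans_lt hSfin
    constructor
    · rw [← hsum, ← hTC, hTt, Complex.re_tsum hTs]
      have h1 : -(hsNormSq (S * γs * P)).toReal ≤
          ∑' i, (⟪γs (P (onb 𝓗 i)), T (P (onb 𝓗 i))⟫_ℂ).re := by
        have h4 : ∀ i, -‖(S * γs * P) (onb 𝓗 i)‖ ^ 2 ≤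
            (⟪γs (P (onb 𝓗 i)), T (P (onb 𝓗 i))⟫_ℂ).re := by
          intro i
          have h2 := hSnorm (γs (P (onb 𝓗 i)))
          have h3 := hre s (P (onb 𝓗 i))
          show -‖S (γs (P (onb 𝓗 i)))‖ ^ 2 ≤ _
          rw [h2, neg_neg]
          exact h3
        rw [toReal_hsNormSq, ← tsum_neg]
        exact Summable.tsum_le_tsum h4 (summable_of_hsNormSq_lt_top hSγsfin).neg
          (Complex.hasSum_re hTs.hasSum).summable
      have h2 := ENNReal.toReal_mono hSfin.ne hSγs
      rw [hStr] at h2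
      linarith
    · rw [← hsum, ← hTC, hTt, Complex.im_tsum hTs]
      rw [tsum_congr fun i => him s (P (onb 𝓗 i)), tsum_zero]
  have hre' : ∀ s : ℝ, 0 ≤ s * (cellTrace P J).re + s ^ 2 * (c * (cellTrace P γ).re) := by
    intro s
    have := (main s).1
    simp only [Complex.add_re, Complex.re_ofReal_mul] at this
    linarith
  have him' : ∀ s : ℝ, (cellTrace P K).im + s * (cellTrace P J).im +
      s ^ 2 * c * (cellTrace P γ).im = 0 := by
    intro s
    have := (main s).2
    simp only [Complex.add_im, Complex.im_ofReal_mul] at this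
    linarith
  apply Complex.ext
  · set a := (cellTrace P J).re
    set b := c * (cellTrace P γ).re
    have hb : 0 < |b| + 1 := by positivity
    -- At this s the polynomial s·a + s²·b is strictly negative unless a = 0; the added 1 keeps the
    -- denominator positive when b = 0.
    have h1 := hre' (-a / (2 * (|b| + 1)))
    have h2 : -a / (2 * (|b| + 1)) * a + (-a / (2 * (|b| + 1))) ^ 2 * b =
        a ^ 2 * (b - 2 * (|b| + 1)) / (4 * (|b| + 1) ^ 2) := by
      field_simp
      ring
    rw [h2] at h1
    have h3 : b - 2 * (|b| + 1) < 0 := by linarith [le_abs_self b, abs_nonneg b]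
    have h4 : 0 ≤ a ^ 2 * (b - 2 * (|b| + 1)) := by
      by_contra h
      exact absurd h1 (not_le.2 (div_neg_of_neg_of_pos (not_le.1 h) (by positivity)))
    have h5 : a ^ 2 = 0 := by nlinarith [sq_nonneg a]
    simpa using h5
  -- The imaginary part is a quadratic polynomial vanishing at every s; subtracting its values at 1
  -- and −1 isolates the linear coefficient.
  · have h1 := him' 1
    have h2 := him' (-1)
    simp only [Complex.zero_im]
    linarith

end Bohm

end IsCellProjection

end HilbertSpace

/-! ### Test functions and directional derivatives. -/

open scoped SchwartzMap FourierTransform LineDeriv Laplacian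

variable {d : ℕ}

/-- The derivative in the direction `v`. -/
def dirDeriv (v : Space d) (φ : Space d → ℂ) : Space d → ℂ := fun x => fderiv ℝ φ x v

/-- The standard basis vectors. -/
def stdVec (j : Fin d) : Space d := EuclideanSpace.basisFun (Fin d) ℝ j

/-- The square of the `L²` norm. -/
def l2sq (f : Space d → ℂ) : ENNReal := ∫⁻ x, ‖f x‖ₑ ^ 2

/-- The differential expression `-½ Δ + e`. -/
def freeOp (e : ℝ) (φ : Space d → ℂ) : Space d → ℂ := fun x =>
  (e : ℂ) * φ x - 1 / 2 * Laplacian.laplacian φ x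

namespace IsTest

variable {φ χ : Space d → ℂ}

theorem dirDeriv (hφ : IsTest φ) (v : Space d) : IsTest (dirDeriv v φ) :=
  ⟨(hφ.1.fderiv_right (m := ∞) le_rfl).clm_apply contDiff_const, hφ.2.fderiv_apply ℝ v⟩

theorem smooth_mul (hφ : IsTest φ) (hχ : ContDiff ℝ ∞ χ) : IsTest fun x => χ x * φ x :=
  ⟨hχ.mul hφ.1, hφ.2.mul_left⟩

theorem mul (hφ : IsTest φ) (hχ : IsTest χ) : IsTest fun x => φ x * χ x :=
  hχ.smooth_mul hφ.1

theorem translate (hφ : IsTest φ) (r : Space d) : IsTest fun x => φ (x + r) :=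
  ⟨hφ.1.comp (contDiff_id.add contDiff_const),
    hφ.2.comp_homeomorph (Homeomorph.addRight r)⟩

theorem conj (hφ : IsTest φ) : IsTest fun x => (starRingEnd ℂ) (φ x) :=
  ⟨Complex.conjCLE.contDiff.comp hφ.1, hφ.2.comp_left (map_zero _)⟩

theorem continuous (hφ : IsTest φ) : Continuous φ := hφ.1.continuous

theorem differentiable (hφ : IsTest φ) : Differentiable ℝ φ := hφ.1.differentiable (by simp)

theorem memLp (hφ : IsTest φ) (p : ENNReal) : MemLp φ p (volume : Measure (Space d)) :=
  hφ.continuous.memLp_of_hasCompactSupport hφ.2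

theorem integrable (hφ : IsTest φ) : Integrable φ :=
  hφ.continuous.integrable_of_hasCompactSupport hφ.2

/-- A test function as a Schwartz function. -/
def schwartz (hφ : IsTest φ) : 𝓢(Space d, ℂ) := hφ.2.toSchwartzMap hφ.1

theorem schwartz_apply (hφ : IsTest φ) (x : Space d) : hφ.schwartz x = φ x := rfl

theorem coe_schwartz (hφ : IsTest φ) : (hφ.schwartz : Space d → ℂ) = φ := rfl

theorem lineDeriv_schwartz (hφ : IsTest φ) (v x : Space d) :
    (∂_{v} hφ.schwartz) x = BlochCurrent.dirDeriv v φ x := rfl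

theorem laplacian_eq (hφ : IsTest φ) (x : Space d) : Laplacian.laplacian φ x =
    ∑ j, BlochCurrent.dirDeriv (stdVec j) (BlochCurrent.dirDeriv (stdVec j) φ) x := by
  have h1 := SchwartzMap.laplacian_apply hφ.schwartz x
  rw [SchwartzMap.laplacian_eq_sum (EuclideanSpace.basisFun (Fin d) ℝ), sum_apply] at h1
  exact h1.symm

theorem integral_mul_laplacian (hφ : IsTest φ) (hχ : IsTest χ) :
    ∫ x, φ x * Laplacian.laplacian χ x = ∫ x, Laplacian.laplacian φ x * χ x := by
  have := SchwartzMap.integral_mul_laplacian_right_eq_left (μ := volume) hφ.schwartz hχ.schwartz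
  simpa only [SchwartzMap.laplacian_apply, coe_schwartz] using this

theorem laplacian (hφ : IsTest φ) : IsTest (Laplacian.laplacian φ) := by
  have h : Laplacian.laplacian φ = fun x =>
      ∑ j, BlochCurrent.dirDeriv (stdVec j) (BlochCurrent.dirDeriv (stdVec j) φ) x :=
    funext hφ.laplacian_eq
  rw [h]
  refine ⟨ContDiff.sum fun j _ => ((hφ.dirDeriv _).dirDeriv _).1, ?_⟩
  have h2 : (fun x => ∑ j, BlochCurrent.dirDeriv (stdVec j)
      (BlochCurrent.dirDeriv (stdVec j) φ) x) = (fun x => Laplacian.laplacian φ x) := h.symm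
  refine HasCompactSupport.of_support_subset_isCompact hφ.2.isCompact fun x hx => ?_
  by_contra hx'
  refine hx (Finset.sum_eq_zero fun j _ => ?_)
  have h1 : x ∉ tsupport (BlochCurrent.dirDeriv (stdVec j) (BlochCurrent.dirDeriv (stdVec j) φ)) :=
    fun hmem => hx' (tsupport_fderiv_apply_subset ℝ (stdVec j)
      (tsupport_fderiv_apply_subset ℝ (stdVec j) hmem))
  exact image_eq_zero_of_notMem_tsupport h1

theorem freeOp (hφ : IsTest φ) (e : ℝ) : IsTest (freeOp e φ) := by
  have h1 : BlochCurrent.freeOp e φ =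
      (e : ℂ) • φ + (-(1 / 2) : ℂ) • Laplacian.laplacian φ := by
    funext x
    simp only [BlochCurrent.freeOp, Pi.add_apply, Pi.smul_apply, smul_eq_mul]
    ring
  rw [h1]
  exact (hφ.scale _).sum (hφ.laplacian.scale _)

end IsTest

/-! ### Plancherel estimates for −½Δ + e. -/

section Fourier

theorem l2sq_eq_ofReal (u : 𝓢(Space d, ℂ)) : l2sq u = ENNReal.ofReal (∫ x, ‖u x‖ ^ 2) := by
  rw [ofReal_integral_eq_lintegral_ofReal]
  · exact lintegral_congr fun x => enorm_sq_eq_ofReal _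
  · have := (u.memLp 2 volume).integrable_norm_pow (by norm_num)
    simpa using this
  · exact .of_forall fun x => by positivity

theorem l2sq_fourier (u : 𝓢(Space d, ℂ)) : l2sq (𝓕 u : 𝓢(Space d, ℂ)) = l2sq u := by
  rw [l2sq_eq_ofReal, l2sq_eq_ofReal, SchwartzMap.integral_norm_sq_fourier]

theorem l2sq_le_of_fourier {u v : 𝓢(Space d, ℂ)} {c : ℝ}
    (h : ∀ ξ, ‖(𝓕 u : 𝓢(Space d, ℂ)) ξ‖ ^ 2 * c ≤ ‖(𝓕 v : 𝓢(Space d, ℂ)) ξ‖ ^ 2) :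
    l2sq u * ENNReal.ofReal c ≤ l2sq v := by
  rw [← l2sq_fourier u, ← l2sq_fourier v, l2sq, l2sq, ← lintegral_mul_const' _ _ (by simp)]
  refine lintegral_mono fun ξ => ?_
  rw [enorm_sq_eq_ofReal, enorm_sq_eq_ofReal, ← ENNReal.ofReal_mul (by positivity)]
  exact ENNReal.ofReal_le_ofReal (h ξ)

/-- The operator `-½ Δ + e` on Schwartz functions. -/
def schwartzFree (e : ℝ) (u : 𝓢(Space d, ℂ)) : 𝓢(Space d, ℂ) :=
  (e : ℂ) • u - (1 / 2 : ℂ) • Δ u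

theorem coe_schwartzFree {φ : Space d → ℂ} (hφ : IsTest φ) (e : ℝ) :
    (schwartzFree e hφ.schwartz : Space d → ℂ) = freeOp e φ := by
  funext x
  simp only [schwartzFree, freeOp, sub_apply, smul_apply,
    SchwartzMap.laplacian_apply, hφ.coe_schwartz, smul_eq_mul]

theorem fourier_lineDeriv_apply (u : 𝓢(Space d, ℂ)) (v ξ : Space d) :
    (𝓕 (∂_{v} u) : 𝓢(Space d, ℂ)) ξ =
      2 * Real.pi * Complex.I * (⟪ξ, v⟫_ℝ : ℝ) * (𝓕 u : 𝓢(Space d, ℂ)) ξ := by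
  have : (inner ℝ · v).HasTemperateGrowth := ((innerSL ℝ).flip v).hasTemperateGrowth
  rw [SchwartzMap.fourier_lineDerivOp_eq, smul_apply,
    SchwartzMap.smulLeftCLM_apply_apply this]
  simp only [smul_eq_mul, Complex.real_smul]
  ring

theorem sum_inner_sq (ξ : Space d) : ∑ j, ⟪ξ, stdVec j⟫_ℝ ^ 2 = ‖ξ‖ ^ 2 := by
  exact (EuclideanSpace.basisFun (Fin d) ℝ).sum_sq_inner_left ξ

/-- In the normalisation e^{−2πi x·ξ} the Laplacian has symbol −4π²|ξ|², whence the 2π² here. -/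
theorem fourier_schwartzFree_apply (e : ℝ) (u : 𝓢(Space d, ℂ)) (ξ : Space d) :
    (𝓕 (schwartzFree e u) : 𝓢(Space d, ℂ)) ξ =
      ((e + 2 * Real.pi ^ 2 * ‖ξ‖ ^ 2 : ℝ) : ℂ) * (𝓕 u : 𝓢(Space d, ℂ)) ξ := by
  have h1 : (𝓕 (Δ u) : 𝓢(Space d, ℂ)) ξ =
      -((4 * Real.pi ^ 2 * ‖ξ‖ ^ 2 : ℝ) : ℂ) * (𝓕 u : 𝓢(Space d, ℂ)) ξ := by
    rw [SchwartzMap.laplacian_eq_sum (EuclideanSpace.basisFun (Fin d) ℝ)]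
    have h2 : (𝓕 (∑ j, ∂_{EuclideanSpace.basisFun (Fin d) ℝ j}
        (∂_{EuclideanSpace.basisFun (Fin d) ℝ j} u)) : 𝓢(Space d, ℂ)) =
        ∑ j, (𝓕 (∂_{EuclideanSpace.basisFun (Fin d) ℝ j}
        (∂_{EuclideanSpace.basisFun (Fin d) ℝ j} u)) : 𝓢(Space d, ℂ)) :=
      map_sum (FourierTransform.fourierCLM ℂ 𝓢(Space d, ℂ)) _ _
    rw [h2, sum_apply]
    simp only [fourier_lineDeriv_apply]
    rw [← sum_inner_sq ξ]
    push_cast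
    rw [Finset.mul_sum, ← Finset.sum_neg_distrib, Finset.sum_mul]
    refine Finset.sum_congr rfl fun j _ => ?_
    simp only [stdVec]
    linear_combination (4 * (Real.pi : ℂ) ^ 2 * ((⟪ξ, EuclideanSpace.basisFun (Fin d) ℝ j⟫_ℝ : ℝ) : ℂ) ^ 2
      * (𝓕 u : 𝓢(Space d, ℂ)) ξ) * Complex.I_sq
  have h3 : (𝓕 (schwartzFree e u) : 𝓢(Space d, ℂ)) =
      (e : ℂ) • (𝓕 u : 𝓢(Space d, ℂ)) - (1 / 2 : ℂ) • (𝓕 (Δ u) : 𝓢(Space d, ℂ)) := by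
    have := map_sub (FourierTransform.fourierCLM ℂ 𝓢(Space d, ℂ)) ((e : ℂ) • u)
      ((1 / 2 : ℂ) • Δ u)
    rw [map_smul, map_smul] at this
    exact this
  rw [h3, sub_apply, smul_apply, smul_apply, h1]
  simp only [smul_eq_mul]
  push_cast
  ring

theorem norm_fourier_schwartzFree (e : ℝ) (he : 0 ≤ e) (u : 𝓢(Space d, ℂ)) (ξ : Space d) :
    ‖(𝓕 (schwartzFree e u) : 𝓢(Space d, ℂ)) ξ‖ =
      (e + 2 * Real.pi ^ 2 * ‖ξ‖ ^ 2) * ‖(𝓕 u : 𝓢(Space d, ℂ)) ξ‖ := by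
  rw [fourier_schwartzFree_apply, norm_mul, Complex.norm_real, Real.norm_of_nonneg (by positivity)]

theorem inner_stdVec_sq_le (ξ : Space d) (j : Fin d) : ⟪ξ, stdVec j⟫_ℝ ^ 2 ≤ ‖ξ‖ ^ 2 := by
  rw [← sum_inner_sq ξ]
  exact Finset.single_le_sum (f := fun j => ⟪ξ, stdVec j⟫_ℝ ^ 2) (fun _ _ => sq_nonneg _)
    (Finset.mem_univ j)

variable {φ : Space d → ℂ} (hφ : IsTest φ) {e : ℝ} (he : 0 ≤ e)
include hφ he

theorem l2sq_mul_le_freeOp : l2sq φ * ENNReal.ofReal (e ^ 2) ≤ l2sq (freeOp e φ) := by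
  rw [← coe_schwartzFree hφ]
  change l2sq hφ.schwartz * _ ≤ _
  refine l2sq_le_of_fourier fun ξ => ?_
  rw [norm_fourier_schwartzFree e he, mul_pow, mul_comm]
  gcongr
  have : 0 ≤ 2 * Real.pi ^ 2 * ‖ξ‖ ^ 2 := by positivity
  linarith

theorem l2sq_dirDeriv_mul_le_freeOp (j : Fin d) :
    l2sq (dirDeriv (stdVec j) φ) * ENNReal.ofReal e ≤ l2sq (freeOp e φ) := by
  rw [← coe_schwartzFree hφ]
  change l2sq (∂_{stdVec j} hφ.schwartz : 𝓢(Space d, ℂ)) * _ ≤ _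
  refine l2sq_le_of_fourier fun ξ => ?_
  rw [norm_fourier_schwartzFree e he, fourier_lineDeriv_apply, mul_pow, norm_mul, mul_pow]
  have h1 : ‖(2 * Real.pi * Complex.I * (⟪ξ, stdVec j⟫_ℝ : ℝ) : ℂ)‖ ^ 2 =
      4 * Real.pi ^ 2 * ⟪ξ, stdVec j⟫_ℝ ^ 2 := by
    simp only [norm_mul, Complex.norm_real, Complex.norm_I, mul_pow, Real.norm_eq_abs, sq_abs]
    norm_num
  rw [h1]
  have h2 := inner_stdVec_sq_le ξ j
  -- The left side is at most the cross term 2·e·(2π²|ξ|²) of the square.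
  have h3 : 4 * Real.pi ^ 2 * ⟪ξ, stdVec j⟫_ℝ ^ 2 * e ≤ (e + 2 * Real.pi ^ 2 * ‖ξ‖ ^ 2) ^ 2 := by
    have h4 : 4 * Real.pi ^ 2 * ⟪ξ, stdVec j⟫_ℝ ^ 2 * e ≤ 4 * Real.pi ^ 2 * ‖ξ‖ ^ 2 * e := by
      gcongr
    nlinarith [sq_nonneg e, sq_nonneg (2 * Real.pi ^ 2 * ‖ξ‖ ^ 2)]
  nlinarith [sq_nonneg ‖(𝓕 hφ.schwartz : 𝓢(Space d, ℂ)) ξ‖]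

theorem l2sq_dirDeriv_dirDeriv_le_freeOp (j : Fin d) :
    l2sq (dirDeriv (stdVec j) (dirDeriv (stdVec j) φ)) ≤ 4 * l2sq (freeOp e φ) := by
  have key : l2sq (dirDeriv (stdVec j) (dirDeriv (stdVec j) φ)) * ENNReal.ofReal (1 / 4) ≤
      l2sq (freeOp e φ) := by
    rw [← coe_schwartzFree hφ]
    change l2sq (∂_{stdVec j} (∂_{stdVec j} hφ.schwartz) : 𝓢(Space d, ℂ)) * _ ≤ _
    refine l2sq_le_of_fourier fun ξ => ?_
    rw [norm_fourier_schwartzFree e he, fourier_lineDeriv_apply, fourier_lineDeriv_apply, mul_pow,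
      ← mul_assoc, norm_mul, mul_pow]
    have h1 : ‖(2 * Real.pi * Complex.I * (⟪ξ, stdVec j⟫_ℝ : ℝ) *
        (2 * Real.pi * Complex.I * (⟪ξ, stdVec j⟫_ℝ : ℝ)) : ℂ)‖ ^ 2 =
        (4 * Real.pi ^ 2 * ⟪ξ, stdVec j⟫_ℝ ^ 2) ^ 2 := by
      simp only [norm_mul, Complex.norm_real, Complex.norm_I, Real.norm_eq_abs, mul_one]
      norm_num
      rw [abs_of_pos Real.pi_pos, ← sq_abs ⟪ξ, stdVec j⟫_ℝ]
      ring
    rw [h1]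
    have h2 := inner_stdVec_sq_le ξ j
    have h3 : (4 * Real.pi ^ 2 * ⟪ξ, stdVec j⟫_ℝ ^ 2) ^ 2 * (1 / 4) ≤
        (e + 2 * Real.pi ^ 2 * ‖ξ‖ ^ 2) ^ 2 := by
      have h4 : (4 * Real.pi ^ 2 * ⟪ξ, stdVec j⟫_ℝ ^ 2) ^ 2 * (1 / 4) =
        (2 * Real.pi ^ 2 * ⟪ξ, stdVec j⟫_ℝ ^ 2) ^ 2 := by ring
      rw [h4]
      gcongr
      have : 2 * Real.pi ^ 2 * ⟪ξ, stdVec j⟫_ℝ ^ 2 ≤ 2 * Real.pi ^ 2 * ‖ξ‖ ^ 2 := by gcongr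
      linarith
    nlinarith [sq_nonneg ‖(𝓕 hφ.schwartz : 𝓢(Space d, ℂ)) ξ‖]
  calc l2sq (dirDeriv (stdVec j) (dirDeriv (stdVec j) φ))
      = 4 * (l2sq (dirDeriv (stdVec j) (dirDeriv (stdVec j) φ)) * ENNReal.ofReal (1 / 4)) := by
        rw [mul_comm, mul_assoc, ← ENNReal.ofReal_ofNat, ← ENNReal.ofReal_mul (by norm_num)]
        norm_num
    _ ≤ _ := by gcongr

end Fourier

/-! ### Sobolev and Gagliardo–Nirenberg inequalities. -/

theorem lintegral_mul_sq_le {α : Type*} [MeasurableSpace α] {μ : Measure α} {f g : α → ENNReal}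
    (hf : AEMeasurable f μ) (hg : AEMeasurable g μ) :
    (∫⁻ a, f a * g a ∂μ) ^ 2 ≤ (∫⁻ a, f a ^ 2 ∂μ) * ∫⁻ a, g a ^ 2 ∂μ := by
  have h := ENNReal.lintegral_mul_le_Lp_mul_Lq μ Real.HolderConjugate.two_two hf hg
  simp only [Pi.mul_apply, ENNReal.rpow_ofNat] at h
  calc (∫⁻ a, f a * g a ∂μ) ^ 2
      ≤ ((∫⁻ a, f a ^ 2 ∂μ) ^ (1 / 2 : ℝ) * (∫⁻ a, g a ^ 2 ∂μ) ^ (1 / 2 : ℝ)) ^ 2 := by gcongr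
    _ = _ := by
      rw [mul_pow, ← ENNReal.rpow_natCast, ← ENNReal.rpow_natCast, ← ENNReal.rpow_mul,
        ← ENNReal.rpow_mul]
      norm_num

/-- The constant in the Sobolev inequality `‖φ‖_∞² ≤ C ‖(-½ Δ + e) φ‖²`. -/
def supConst (d : ℕ) (e : ℝ) : ENNReal :=
  ∫⁻ ξ : Space d, ENNReal.ofReal ((e + 2 * Real.pi ^ 2 * ‖ξ‖ ^ 2)⁻¹) ^ 2

/-- Fourier inversion bounds |φ(x)| by the L¹ norm of the transform; Cauchy–Schwarz against the
inverse symbol then produces ‖(−½Δ + e)φ‖₂. The constant is finite precisely when the inverse symbol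
is square integrable, which is where d ≤ 3 enters. -/
theorem enorm_sq_le_supConst {φ : Space d → ℂ} (hφ : IsTest φ) {e : ℝ} (he : 0 < e) (x : Space d) :
    ‖φ x‖ₑ ^ 2 ≤ supConst d e * l2sq (freeOp e φ) := by
  have hpos : ∀ ξ : Space d, 0 < e + 2 * Real.pi ^ 2 * ‖ξ‖ ^ 2 := fun ξ => by positivity
  have h1 : φ x = (𝓕⁻ (𝓕 hφ.schwartz) : 𝓢(Space d, ℂ)) x := by
    rw [FourierTransform.fourierInv_fourier_eq]; rfl
  have h2 : ‖φ x‖ₑ ≤ ∫⁻ ξ, ‖(𝓕 hφ.schwartz : 𝓢(Space d, ℂ)) ξ‖ₑ := by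
    rw [h1, SchwartzMap.fourierInv_coe, Real.fourierInv_eq]
    refine (enorm_integral_le_lintegral_enorm _).trans (lintegral_mono fun ξ => ?_)
    rw [← ofReal_norm, ← ofReal_norm, Circle.norm_smul]
  have h3 : ∀ ξ, ‖(𝓕 hφ.schwartz : 𝓢(Space d, ℂ)) ξ‖ₑ =
      ENNReal.ofReal ((e + 2 * Real.pi ^ 2 * ‖ξ‖ ^ 2)⁻¹) *
        ‖(𝓕 (schwartzFree e hφ.schwartz) : 𝓢(Space d, ℂ)) ξ‖ₑ := by
    intro ξ
    rw [← ofReal_norm, ← ofReal_norm, norm_fourier_schwartzFree e he.le,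
      ← ENNReal.ofReal_mul (by have := hpos ξ; positivity), ← mul_assoc,
      inv_mul_cancel₀ (hpos ξ).ne', one_mul]
  simp_rw [h3] at h2
  calc ‖φ x‖ₑ ^ 2 ≤ _ := pow_le_pow_left' h2 2
    _ ≤ _ := lintegral_mul_sq_le
      ((Continuous.measurable (by
        refine ENNReal.continuous_ofReal.comp (Continuous.inv₀ (by fun_prop)
          fun ξ => (hpos ξ).ne'))).aemeasurable)
      ((SchwartzMap.continuous _).enorm.measurable.aemeasurable)
    _ = _ := by
      rw [← coe_schwartzFree hφ, ← l2sq_fourier (schwartzFree e hφ.schwartz)]; rfl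

theorem exists_supConst_le (hd : d ≤ 3) : ∃ C : ℝ, 0 ≤ C ∧ ∀ e : ℝ, 1 ≤ e →
    supConst d e ≤ ENNReal.ofReal (C * e ^ (-(1 / 8) : ℝ)) := by
  -- Split (e + t)⁻² into powers −1/8 and −15/8 of e + t. The second is still integrable because
  -- 15/4 > 3 ≥ d, and the first supplies decay in e.
  have hint : Integrable (fun ξ : Space d => ((1 : ℝ) + ‖ξ‖ ^ 2) ^ (-(15 / 4) / 2 : ℝ)) volume := by
    refine integrable_rpow_neg_one_add_norm_sq ?_
    rw [finrank_euclideanSpace, Fintype.card_fin]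
    have : (d : ℝ) ≤ 3 := by exact_mod_cast hd
    linarith
  refine ⟨∫ ξ : Space d, ((1 : ℝ) + ‖ξ‖ ^ 2) ^ (-(15 / 4) / 2 : ℝ),
    integral_nonneg fun ξ => by positivity, fun e he => ?_⟩
  rw [mul_comm, ENNReal.ofReal_mul (by positivity), ofReal_integral_eq_lintegral_ofReal hint
    (.of_forall fun ξ => by positivity), ← lintegral_const_mul' _ _ (by simp)]
  refine lintegral_mono fun ξ => ?_
  rw [← ENNReal.ofReal_pow (by positivity), ← ENNReal.ofReal_mul (by positivity)]
  refine ENNReal.ofReal_le_ofReal ?_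
  set t := 2 * Real.pi ^ 2 * ‖ξ‖ ^ 2 with ht
  have ht0 : 0 ≤ t := by positivity
  have ht1 : ‖ξ‖ ^ 2 ≤ t := by
    have := Real.pi_gt_three
    have h1 : 1 ≤ 2 * Real.pi ^ 2 := by nlinarith
    simpa using mul_le_mul_of_nonneg_right h1 (sq_nonneg ‖ξ‖)
  have hpos : 0 < e + t := by linarith
  have h1 : ((e + t)⁻¹) ^ 2 = (e + t) ^ (-(1 / 8) : ℝ) * (e + t) ^ (-(15 / 4) / 2 : ℝ) := by
    rw [← Real.rpow_add hpos, inv_pow, ← Real.rpow_natCast, ← Real.rpow_neg hpos.le]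
    norm_num
  rw [h1]
  refine mul_le_mul ?_ ?_ (by positivity) (by positivity)
  · exact Real.rpow_le_rpow_of_nonpos (by linarith) (by linarith) (by norm_num)
  · exact Real.rpow_le_rpow_of_nonpos (by positivity) (by linarith) (by norm_num)

theorem exists_supConst_lt (hd : d ≤ 3) {δ : ENNReal} (hδ : 0 < δ) :
    ∃ e₀ : ℝ, 1 ≤ e₀ ∧ ∀ e, e₀ ≤ e → supConst d e ≤ δ := by
  obtain ⟨C, -, hC⟩ := exists_supConst_le hd
  have hlim : Filter.Tendsto (fun e : ℝ => ENNReal.ofReal (C * e ^ (-(1 / 8) : ℝ))) Filter.atTop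
      (nhds 0) := by
    have := ENNReal.tendsto_ofReal
      ((tendsto_rpow_neg_atTop (by norm_num : (0 : ℝ) < 1 / 8)).const_mul C)
    simpa using this
  obtain ⟨e₁, he₁⟩ := Filter.eventually_atTop.1 (hlim.eventually (gt_mem_nhds hδ))
  exact ⟨max e₁ 1, le_max_right _ _, fun e he =>
    (hC e ((le_max_right _ _).trans he)).trans (he₁ e ((le_max_left _ _).trans he)).le⟩

/-- A Gagliardo–Nirenberg inequality. -/
theorem lintegral_dirDeriv_pow_four_le {φ : Space d → ℂ} (hφ : IsTest φ) (v : Space d) {S : ENNReal}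
    (hS : ∀ x, ‖φ x‖ₑ ≤ S) :
    ∫⁻ x, ‖dirDeriv v φ x‖ₑ ^ 4 ≤ 9 * S ^ 2 * l2sq (dirDeriv v (dirDeriv v φ)) := by
  set u := dirDeriv v φ with hu
  have hut : IsTest u := hφ.dirDeriv v
  -- Chosen so that u h = |u|⁴. Integrating by parts moves the derivative in u = ∂φ onto h, leaving
  -- the bounded factor φ times a quantity of size 3|u|²|∂u|.
  set h : Space d → ℂ := fun x => (starRingEnd ℂ) (u x) * ((starRingEnd ℂ) (u x) * u x) with hh
  have hht : IsTest h := hut.conj.mul (hut.conj.mul hut)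
  have hdh : ∀ x, dirDeriv v h x = (starRingEnd ℂ) (dirDeriv v u x) *
      ((starRingEnd ℂ) (u x) * u x) + (starRingEnd ℂ) (u x) *
      ((starRingEnd ℂ) (dirDeriv v u x) * u x + (starRingEnd ℂ) (u x) * dirDeriv v u x) := by
    intro x
    have h1 : HasFDerivAt u (fderiv ℝ u x) x := (hut.differentiable x).hasFDerivAt
    have h2 : HasFDerivAt (fun y => (starRingEnd ℂ) (u y))
        ((Complex.conjCLE : ℂ →L[ℝ] ℂ).comp (fderiv ℝ u x)) x :=
      (Complex.conjCLE : ℂ →L[ℝ] ℂ).hasFDerivAt.comp x h1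
    have h3 := (h2.mul (h2.mul h1)).fderiv
    simp only [dirDeriv]
    rw [show h = (fun y => (starRingEnd ℂ) (u y)) * ((fun y => (starRingEnd ℂ) (u y)) * u) from rfl,
      h3]
    simp
    ring
  have hdhn : ∀ x, ‖dirDeriv v h x‖ ≤ 3 * (‖u x‖ ^ 2 * ‖dirDeriv v u x‖) := by
    intro x
    rw [hdh]
    refine (norm_add_le _ _).trans ?_
    rw [norm_mul, norm_mul, norm_mul, RCLike.norm_conj, RCLike.norm_conj]
    have h1 := norm_add_le ((starRingEnd ℂ) (dirDeriv v u x) * u x)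
      ((starRingEnd ℂ) (u x) * dirDeriv v u x)
    rw [norm_mul, norm_mul, RCLike.norm_conj, RCLike.norm_conj] at h1
    nlinarith [norm_nonneg (u x), norm_nonneg (dirDeriv v u x)]
  have hparts : ∫ x, u x * h x = -∫ x, φ x * dirDeriv v h x := by
    have h1 := integral_mul_fderiv_eq_neg_fderiv_mul_of_integrable (μ := volume) (𝕜 := ℂ)
      (f := h) (g := φ) (v := v) ((hht.dirDeriv v).mul hφ).integrable
      (hht.mul (hφ.dirDeriv v)).integrable (hht.mul hφ).integrable
      (fun x _ => hht.differentiable x) (fun x _ => hφ.differentiable x)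
    simp only [mul_comm (u _)]
    rw [show (∫ x, h x * u x) = ∫ x, h x * fderiv ℝ φ x v from rfl, h1]
    simp only [mul_comm (φ _)]
    rfl
  have huh : ∀ x, u x * h x = ((‖u x‖ ^ 4 : ℝ) : ℂ) := by
    intro x
    have h1 : u x * (starRingEnd ℂ) (u x) = ((‖u x‖ ^ 2 : ℝ) : ℂ) := by
      rw [Complex.mul_conj, Complex.normSq_eq_norm_sq]
    simp only [hh]
    calc u x * ((starRingEnd ℂ) (u x) * ((starRingEnd ℂ) (u x) * u x))
        = (u x * (starRingEnd ℂ) (u x)) * (u x * (starRingEnd ℂ) (u x)) := by ring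
      _ = _ := by rw [h1]; push_cast; ring
  set I := ∫⁻ x, ‖u x‖ₑ ^ 4 with hI
  have hint4 : Integrable fun x => ‖u x‖ ^ 4 := by
    have := (hut.mul hht).integrable.norm
    refine this.congr (.of_forall fun x => ?_)
    simp only [huh, Complex.norm_real]
    rw [Real.norm_of_nonneg (by positivity)]
  have hIe : I = ENNReal.ofReal (∫ x, ‖u x‖ ^ 4) := by
    rw [ofReal_integral_eq_lintegral_ofReal hint4 (.of_forall fun x => by positivity)]
    refine lintegral_congr fun x => ?_
    rw [← ofReal_norm, ENNReal.ofReal_pow (norm_nonneg _)]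
  have hIfin : I ≠ ⊤ := by rw [hIe]; exact ENNReal.ofReal_ne_top
  have hI1 : I ≤ 3 * S * ∫⁻ x, ‖u x‖ₑ ^ 2 * ‖dirDeriv v u x‖ₑ := by
    have h1 : I = ‖∫ x, u x * h x‖ₑ := by
      simp_rw [huh]
      rw [integral_complex_ofReal, hIe, ← ofReal_norm, Complex.norm_real,
        Real.norm_of_nonneg (integral_nonneg fun x => by positivity)]
    rw [h1, hparts, enorm_neg]
    refine (enorm_integral_le_lintegral_enorm _).trans ?_
    rw [← lintegral_const_mul _ (by
      have h2 := hut.continuous.enorm.measurable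
      have h3 := (hut.dirDeriv v).continuous.enorm.measurable
      fun_prop)]
    refine lintegral_mono fun x => ?_
    rw [enorm_mul]
    have h2 : ‖dirDeriv v h x‖ₑ ≤ 3 * (‖u x‖ₑ ^ 2 * ‖dirDeriv v u x‖ₑ) := by
      rw [← ofReal_norm, ← ofReal_norm, ← ofReal_norm, ← ENNReal.ofReal_pow (norm_nonneg _),
        ← ENNReal.ofReal_mul (by positivity), ← ENNReal.ofReal_ofNat,
        ← ENNReal.ofReal_mul (by positivity)]
      exact ENNReal.ofReal_le_ofReal (hdhn x)
    calc ‖φ x‖ₑ * ‖dirDeriv v h x‖ₑ ≤ S * (3 * (‖u x‖ₑ ^ 2 * ‖dirDeriv v u x‖ₑ)) :=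
          mul_le_mul' (hS x) h2
      _ = _ := by ring
  have hCS := lintegral_mul_sq_le (μ := (volume : Measure (Space d)))
    (f := fun x => ‖u x‖ₑ ^ 2) (g := fun x => ‖dirDeriv v u x‖ₑ)
    (hut.continuous.enorm.measurable.pow_const 2).aemeasurable
    (hut.dirDeriv v).continuous.enorm.measurable.aemeasurable
  simp only [← pow_mul] at hCS
  norm_num at hCS
  rcases eq_or_ne I 0 with h0 | h0
  · rw [h0]; exact zero_le
  -- By Cauchy–Schwarz I ≤ 3S·I^{1/2}·‖∂u‖₂; square it, then divide by I, which is finite and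
  -- nonzero.
  have hfin : I * I ≤ I * (9 * S ^ 2 * l2sq (dirDeriv v u)) := by
    calc I * I = I ^ 2 := (sq I).symm
      _ ≤ (3 * S * ∫⁻ x, ‖u x‖ₑ ^ 2 * ‖dirDeriv v u x‖ₑ) ^ 2 := by gcongr
      _ = 9 * S ^ 2 * (∫⁻ x, ‖u x‖ₑ ^ 2 * ‖dirDeriv v u x‖ₑ) ^ 2 := by ring
      _ ≤ 9 * S ^ 2 * (I * l2sq (dirDeriv v u)) := by gcongr; exact hCS
      _ = _ := by ring
  exact (ENNReal.mul_le_mul_iff_right h0 hIfin).1 hfin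

/-- `‖∂ⱼ φ‖₄⁴ ≤ C ‖(-½ Δ + e) φ‖₂⁴`. -/
theorem lintegral_dirDeriv_pow_four_le_freeOp {φ : Space d → ℂ} (hφ : IsTest φ) (j : Fin d) {e : ℝ}
    (he : 0 < e) : ∫⁻ x, ‖dirDeriv (stdVec j) φ x‖ₑ ^ 4 ≤
      36 * supConst d e * l2sq (freeOp e φ) ^ 2 := by
  have h1 := lintegral_dirDeriv_pow_four_le hφ (stdVec j)
    (S := (supConst d e * l2sq (freeOp e φ)) ^ (1 / 2 : ℝ)) (fun x => by
      have h2 := enorm_sq_le_supConst hφ he x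
      have h3 := ENNReal.rpow_le_rpow h2 (by norm_num : (0 : ℝ) ≤ 1 / 2)
      rwa [← ENNReal.rpow_natCast, ← ENNReal.rpow_mul, Nat.cast_ofNat,
        mul_one_div_cancel (two_ne_zero), ENNReal.rpow_one] at h3)
  rw [← ENNReal.rpow_natCast (_ ^ (1 / 2 : ℝ)), ← ENNReal.rpow_mul, Nat.cast_ofNat,
    one_div_mul_cancel two_ne_zero, ENNReal.rpow_one] at h1
  calc _ ≤ _ := h1
    _ ≤ 9 * (supConst d e * l2sq (freeOp e φ)) * (4 * l2sq (freeOp e φ)) := by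
      gcongr; exact l2sq_dirDeriv_dirDeriv_le_freeOp hφ he.le j
    _ = _ := by ring

/-! ### Density of (−½Δ + e) C_c^∞ in L². -/

theorem hasTemperateGrowth_inv_add_norm_sq {e : ℝ} (he : 0 < e) :
    (fun ξ : Space d => (e + 2 * Real.pi ^ 2 * ‖ξ‖ ^ 2)⁻¹).HasTemperateGrowth := by
  set c : ℝ := Real.sqrt (2 * Real.pi ^ 2 / e) with hc
  have hc2 : c ^ 2 = 2 * Real.pi ^ 2 / e := Real.sq_sqrt (by positivity)
  have h1 : (fun ξ : Space d => ((1 : ℝ) + ‖c • ξ‖ ^ 2) ^ (-1 : ℝ)).HasTemperateGrowth :=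
    (Function.hasTemperateGrowth_one_add_norm_sq_rpow (Space d) (-1)).comp
      (c • ContinuousLinearMap.id ℝ (Space d)).hasTemperateGrowth
  have h2 := (Function.HasTemperateGrowth.const (E := Space d) e⁻¹).mul h1
  refine (congrArg Function.HasTemperateGrowth (funext fun ξ => ?_)).mp h2
  simp only [Pi.mul_apply]
  rw [Real.rpow_neg_one, norm_smul, mul_pow, Real.norm_eq_abs, sq_abs, hc2, ← mul_inv]
  congr 1
  field_simp

/-- The inverse is a Fourier multiplier whose symbol is smooth of temperate growth, so it preserves
the Schwartz space. -/
theorem exists_schwartzFree_eq {e : ℝ} (he : 0 < e) (s : 𝓢(Space d, ℂ)) :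
    ∃ u, schwartzFree e u = s := by
  have hg := hasTemperateGrowth_inv_add_norm_sq (d := d) he
  refine ⟨SchwartzMap.fourierMultiplierCLM ℂ
    (fun ξ : Space d => (e + 2 * Real.pi ^ 2 * ‖ξ‖ ^ 2)⁻¹) s, ?_⟩
  have hinj : Function.Injective (fun u : 𝓢(Space d, ℂ) => (𝓕 u : 𝓢(Space d, ℂ))) :=
    fun u v huv => by
      have := congrArg (fun w : 𝓢(Space d, ℂ) => (𝓕⁻ w : 𝓢(Space d, ℂ))) huv
      simpa only [FourierTransform.fourierInv_fourier_eq] using this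
  apply hinj
  ext ξ
  simp only
  rw [fourier_schwartzFree_apply, SchwartzMap.fourierMultiplierCLM_apply,
    FourierTransform.fourier_fourierInv_eq, SchwartzMap.smulLeftCLM_apply_apply hg,
    Complex.real_smul, ← mul_assoc, ← Complex.ofReal_mul, mul_inv_cancel₀ (by positivity),
    Complex.ofReal_one, one_mul]

theorem dirDeriv_mul {φ χ : Space d → ℂ} (hφ : ContDiff ℝ ∞ φ) (hχ : ContDiff ℝ ∞ χ)
    (v x : Space d) : dirDeriv v (fun x => φ x * χ x) x =
      dirDeriv v φ x * χ x + φ x * dirDeriv v χ x := by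
  have h := ((hφ.differentiable (by simp) x).hasFDerivAt.mul
    (hχ.differentiable (by simp) x).hasFDerivAt).fderiv
  simp only [dirDeriv]
  rw [show (fun x => φ x * χ x) = φ * χ from rfl, h]
  simp
  ring

theorem contDiff_dirDeriv {φ : Space d → ℂ} (hφ : ContDiff ℝ ∞ φ) (v : Space d) :
    ContDiff ℝ ∞ (dirDeriv v φ) :=
  (hφ.fderiv_right (m := ∞) le_rfl).clm_apply contDiff_const

theorem dirDeriv_dirDeriv_mul {φ χ : Space d → ℂ} (hφ : ContDiff ℝ ∞ φ) (hχ : ContDiff ℝ ∞ χ)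
    (v x : Space d) : dirDeriv v (dirDeriv v fun x => φ x * χ x) x =
      dirDeriv v (dirDeriv v φ) x * χ x + 2 * (dirDeriv v φ x * dirDeriv v χ x) +
        φ x * dirDeriv v (dirDeriv v χ) x := by
  have h1 : dirDeriv v (fun x => φ x * χ x) = fun x =>
      dirDeriv v φ x * χ x + φ x * dirDeriv v χ x := funext (dirDeriv_mul hφ hχ v)
  have h2 : ContDiff ℝ ∞ fun x => dirDeriv v φ x * χ x := (contDiff_dirDeriv hφ v).mul hχ
  have h3 : ContDiff ℝ ∞ fun x => φ x * dirDeriv v χ x := hφ.mul (contDiff_dirDeriv hχ v)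
  have h4 : dirDeriv v (fun x => dirDeriv v φ x * χ x + φ x * dirDeriv v χ x) x =
      dirDeriv v (fun x => dirDeriv v φ x * χ x) x + dirDeriv v (fun x => φ x * dirDeriv v χ x) x := by
    change fderiv ℝ _ x v = fderiv ℝ _ x v + fderiv ℝ _ x v
    rw [fderiv_fun_add (h2.differentiable (by simp) x) (h3.differentiable (by simp) x)]
    rfl
  rw [h1, h4, dirDeriv_mul (contDiff_dirDeriv hφ v) hχ, dirDeriv_mul hφ (contDiff_dirDeriv hχ v)]
  ring

theorem laplacian_eq_sum_dirDeriv {φ : Space d → ℂ} (hφ : ContDiff ℝ ∞ φ) (x : Space d) :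
    Laplacian.laplacian φ x = ∑ j, dirDeriv (stdVec j) (dirDeriv (stdVec j) φ) x := by
  rw [InnerProductSpace.laplacian_eq_iteratedFDeriv_orthonormalBasis φ
    (EuclideanSpace.basisFun (Fin d) ℝ)]
  refine Finset.sum_congr rfl fun j _ => ?_
  rw [iteratedFDeriv_succ_apply_left, ← fderiv_continuousMultilinear_apply_const_apply
    (hφ.differentiable_iteratedFDeriv (m := 1) (by exact_mod_cast WithTop.coe_lt_top _) x)]
  simp [stdVec, iteratedFDeriv_one_apply]
  rfl

theorem laplacian_mul {φ χ : Space d → ℂ} (hφ : ContDiff ℝ ∞ φ) (hχ : ContDiff ℝ ∞ χ)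
    (x : Space d) : Laplacian.laplacian (fun x => φ x * χ x) x =
      Laplacian.laplacian φ x * χ x +
        2 * ∑ j, dirDeriv (stdVec j) φ x * dirDeriv (stdVec j) χ x +
        φ x * Laplacian.laplacian χ x := by
  rw [laplacian_eq_sum_dirDeriv (hφ.mul hχ), laplacian_eq_sum_dirDeriv hφ,
    laplacian_eq_sum_dirDeriv hχ, Finset.sum_mul, Finset.mul_sum, Finset.mul_sum,
    ← Finset.sum_add_distrib, ← Finset.sum_add_distrib]
  exact Finset.sum_congr rfl fun j _ => dirDeriv_dirDeriv_mul hφ hχ _ x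

theorem freeOp_mul {φ χ : Space d → ℂ} (hφ : ContDiff ℝ ∞ φ) (hχ : ContDiff ℝ ∞ χ) (e : ℝ)
    (x : Space d) : freeOp e (fun x => φ x * χ x) x =
      φ x * freeOp e χ x - ∑ j, dirDeriv (stdVec j) φ x * dirDeriv (stdVec j) χ x -
        1 / 2 * Laplacian.laplacian φ x * χ x := by
  simp only [freeOp, laplacian_mul hφ hχ]
  ring

/-- A smooth cutoff function. -/
def cutoff (d : ℕ) (ρ : ℝ) (hρ : 0 < ρ) : ContDiffBump (0 : Space d) where
  rIn := ρ
  rOut := ρ + 1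
  rIn_pos := hρ
  rIn_lt_rOut := by linarith

/-- A smooth cutoff function, with complex values. -/
def cutoffFun (d : ℕ) (ρ : ℝ) (hρ : 0 < ρ) : Space d → ℂ := fun x => ((cutoff d ρ hρ x : ℝ) : ℂ)

theorem isTest_cutoffFun (ρ : ℝ) (hρ : 0 < ρ) : IsTest (cutoffFun d ρ hρ) :=
  ⟨Complex.ofRealCLM.contDiff.comp (cutoff d ρ hρ).contDiff,
    (cutoff d ρ hρ).hasCompactSupport.comp_left Complex.ofReal_zero⟩

theorem cutoffFun_eq_one {ρ : ℝ} (hρ : 0 < ρ) {x : Space d} (hx : ‖x‖ ≤ ρ) :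
    cutoffFun d ρ hρ x = 1 := by
  rw [cutoffFun, (cutoff d ρ hρ).one_of_mem_closedBall (mem_closedBall_zero_iff.2 hx)]
  simp

theorem IsTest.exists_bound {φ : Space d → ℂ} (hφ : IsTest φ) : ∃ C : ℝ, 0 ≤ C ∧ ∀ x, ‖φ x‖ ≤ C := by
  obtain ⟨C, hC⟩ := hφ.continuous.bounded_above_of_compact_support hφ.2
  exact ⟨C, (norm_nonneg _).trans (hC 0), hC⟩

theorem dirDeriv_comp_smul {φ : Space d → ℂ} (hφ : ContDiff ℝ ∞ φ) (a : ℝ) (v x : Space d) :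
    dirDeriv v (fun x => φ (a • x)) x = a * dirDeriv v φ (a • x) := by
  have h1 : HasFDerivAt (fun x : Space d => a • x) (a • ContinuousLinearMap.id ℝ (Space d)) x :=
    (a • ContinuousLinearMap.id ℝ (Space d)).hasFDerivAt
  have h2 := ((hφ.differentiable (by simp) (a • x)).hasFDerivAt.comp x h1).fderiv
  simp only [dirDeriv]
  rw [show (fun x => φ (a • x)) = φ ∘ (fun x => a • x) from rfl, h2]
  simp

theorem laplacian_comp_smul {φ : Space d → ℂ} (hφ : ContDiff ℝ ∞ φ) (a : ℝ) (x : Space d) :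
    Laplacian.laplacian (fun x => φ (a • x)) x = a ^ 2 * Laplacian.laplacian φ (a • x) := by
  have hs : ContDiff ℝ ∞ fun x => φ (a • x) := hφ.comp (contDiff_const_smul a)
  rw [laplacian_eq_sum_dirDeriv hs, laplacian_eq_sum_dirDeriv hφ, Finset.mul_sum]
  refine Finset.sum_congr rfl fun j _ => ?_
  have h1 : dirDeriv (stdVec j) (fun x => φ (a • x)) =
      fun x => (a : ℂ) * dirDeriv (stdVec j) φ (a • x) := funext (dirDeriv_comp_smul hφ a _)
  have h2 : dirDeriv (stdVec j) (fun x => (a : ℂ) * dirDeriv (stdVec j) φ (a • x)) x =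
      a * dirDeriv (stdVec j) (fun x => dirDeriv (stdVec j) φ (a • x)) x := by
    simp only [dirDeriv]
    rw [fderiv_const_mul]
    · rfl
    · exact ((contDiff_dirDeriv hφ (stdVec j)).comp (contDiff_const_smul a)).differentiable
        (by simp) x
  rw [h1, h2, dirDeriv_comp_smul (contDiff_dirDeriv hφ _)]
  ring

theorem schwartzFree_apply (e : ℝ) (u : 𝓢(Space d, ℂ)) (x : Space d) :
    schwartzFree e u x = freeOp e u x := by
  simp only [schwartzFree, freeOp, sub_apply, smul_apply, SchwartzMap.laplacian_apply, smul_eq_mul]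

/-- A square integrable function orthogonal to `(-½ Δ + e) C_c^∞` is orthogonal to
`(-½ Δ + e) 𝓢`. -/
theorem integral_mul_schwartzFree_eq_zero {e : ℝ} {f : Space d → ℂ} (hf : MemLp f 2 volume)
    (h : ∀ φ : Space d → ℂ, IsTest φ → ∫ x, f x * freeOp e φ x = 0) (u : 𝓢(Space d, ℂ)) :
    ∫ x, f x * schwartzFree e u x = 0 := by
  have hη := isTest_cutoffFun (d := d) 1 one_pos
  set η := cutoffFun d 1 one_pos with hηd
  obtain ⟨C₀, hC₀, hη₀⟩ := hη.exists_bound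
  obtain ⟨C₂, hC₂, hη₂⟩ := hη.laplacian.exists_bound
  choose C₁ hC₁ hη₁ using fun j : Fin d => (hη.dirDeriv (stdVec j)).exists_bound
  set a : ℕ → ℝ := fun n => 1 / ((n : ℝ) + 1) with ha
  have ha0 : ∀ n, 0 ≤ a n := fun n => by positivity
  have ha1 : ∀ n, a n ≤ 1 := fun n => by
    simp only [ha]
    rw [div_le_one (by positivity)]
    have : (0 : ℝ) ≤ n := by positivity
    linarith
  have hau : Filter.Tendsto a Filter.atTop (nhds 0) := tendsto_one_div_add_atTop_nhds_zero_nat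
  have hsm : ∀ n, ContDiff ℝ ∞ fun x => η (a n • x) := fun n => hη.1.comp (contDiff_const_smul _)
  have hu : ContDiff ℝ ∞ u := u.smooth ⊤
  have hcut : ∀ n, IsTest fun x => η (a n • x) * u x := by
    intro n
    refine ⟨(hsm n).mul hu, ?_⟩
    have hane : a n ≠ 0 := by simp only [ha]; positivity
    exact (hη.2.comp_homeomorph (Homeomorph.smulOfNeZero (a n) hane)).mul_right
  have hexp : ∀ n x, freeOp e (fun x => η (a n • x) * u x) x = η (a n • x) * schwartzFree e u x -
      ∑ j, a n * dirDeriv (stdVec j) η (a n • x) * (∂_{stdVec j} u : 𝓢(Space d, ℂ)) x -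
      1 / 2 * (a n ^ 2 * Laplacian.laplacian η (a n • x)) * u x := by
    intro n x
    rw [freeOp_mul (hsm n) hu, laplacian_comp_smul hη.1, schwartzFree_apply]
    simp only [dirDeriv_comp_smul hη.1]
    rfl
  have hlim : Filter.Tendsto (fun n => ∫ x, f x * freeOp e (fun x => η (a n • x) * u x) x)
      Filter.atTop (nhds (∫ x, f x * schwartzFree e u x)) := by
    refine tendsto_integral_of_dominated_convergence (fun x => ‖f x‖ *
      (C₀ * ‖schwartzFree e u x‖ + ∑ j, C₁ j * ‖(∂_{stdVec j} u : 𝓢(Space d, ℂ)) x‖ +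
        C₂ * ‖u x‖)) (fun n => ?_) ?_ (fun n => .of_forall fun x => ?_) (.of_forall fun x => ?_)
    · exact hf.1.mul ((hcut n).freeOp e).continuous.aestronglyMeasurable
    · have h2 : MemLp (fun x => C₀ * ‖schwartzFree e u x‖ +
          ∑ j, C₁ j * ‖(∂_{stdVec j} u : 𝓢(Space d, ℂ)) x‖ + C₂ * ‖u x‖) 2 volume :=
        (((schwartzFree e u).memLp 2 volume).norm.const_mul C₀ |>.add
          (memLp_finsetSum _ fun j _ =>
            ((∂_{stdVec j} u : 𝓢(Space d, ℂ)).memLp 2 volume).norm.const_mul (C₁ j))).add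
          ((u.memLp 2 volume).norm.const_mul C₂)
      exact hf.norm.integrable_mul h2
    · rw [norm_mul, hexp]
      refine mul_le_mul_of_nonneg_left ?_ (norm_nonneg _)
      refine (norm_sub_le _ _).trans (add_le_add ((norm_sub_le _ _).trans (add_le_add ?_ ?_)) ?_)
      · rw [norm_mul]
        exact mul_le_mul_of_nonneg_right (hη₀ _) (norm_nonneg _)
      · refine (norm_sum_le _ _).trans (Finset.sum_le_sum fun j _ => ?_)
        rw [norm_mul, norm_mul, Complex.norm_real, Real.norm_of_nonneg (ha0 n)]
        refine mul_le_mul_of_nonneg_right ?_ (norm_nonneg _)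
        calc a n * ‖dirDeriv (stdVec j) η (a n • x)‖ ≤ 1 * C₁ j :=
              mul_le_mul (ha1 n) (hη₁ j _) (norm_nonneg _) zero_le_one
          _ = C₁ j := one_mul _
      · rw [norm_mul, norm_mul, norm_mul, norm_pow, Complex.norm_real, Real.norm_of_nonneg (ha0 n)]
        refine mul_le_mul_of_nonneg_right ?_ (norm_nonneg _)
        have h1 : a n ^ 2 ≤ 1 := pow_le_one₀ (ha0 n) (ha1 n)
        have h2 := hη₂ (a n • x)
        have h3 : ‖(1 / 2 : ℂ)‖ = 1 / 2 := by norm_num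
        rw [h3]
        nlinarith [norm_nonneg (Laplacian.laplacian η (a n • x)), sq_nonneg (a n)]
    · refine Filter.Tendsto.const_mul _ ?_
      have hax : Filter.Tendsto (fun n => a n • x) Filter.atTop (nhds 0) := by
        simpa using hau.smul_const x
      have hac : Filter.Tendsto (fun n => (a n : ℂ)) Filter.atTop (nhds 0) := by
        simpa [Function.comp_def] using (Complex.continuous_ofReal.tendsto 0).comp hau
      have hev : ∀ᶠ n in Filter.atTop, η (a n • x) = 1 := by
        filter_upwards [hax.eventually (Metric.closedBall_mem_nhds (0 : Space d) one_pos)] with n hn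
        exact cutoffFun_eq_one one_pos (by simpa using hn)
      have h1 : Filter.Tendsto (fun n => η (a n • x) * schwartzFree e u x) Filter.atTop
          (nhds (schwartzFree e u x)) :=
        tendsto_const_nhds.congr' (hev.mono fun n hn => by
          simp only [hn, one_mul])
      have h2 : ∀ j, Filter.Tendsto (fun n => a n * dirDeriv (stdVec j) η (a n • x) *
          (∂_{stdVec j} u : 𝓢(Space d, ℂ)) x) Filter.atTop (nhds 0) := by
        intro j
        have := (hac.mul (((hη.dirDeriv (stdVec j)).continuous.tendsto 0).comp hax)).mul_const
          ((∂_{stdVec j} u : 𝓢(Space d, ℂ)) x)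
        simpa using this
      have h3 : Filter.Tendsto (fun n => 1 / 2 * ((a n : ℂ) ^ 2 *
          Laplacian.laplacian η (a n • x)) * u x) Filter.atTop (nhds 0) := by
        have := (((hac.pow 2).mul ((hη.laplacian.continuous.tendsto 0).comp hax)).const_mul
          (1 / 2 : ℂ)).mul_const (u x)
        simpa using this
      have h4 := (h1.sub (tendsto_finsetSum Finset.univ fun j _ => h2 j)).sub h3
      simp only [Finset.sum_const_zero, sub_zero] at h4
      exact h4.congr fun n => (hexp n x).symm
  refine tendsto_nhds_unique hlim ?_
  simp only [h _ (hcut _)]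
  exact tendsto_const_nhds

/-- Orthogonality extends from test functions to Schwartz functions; there −½Δ + e is onto, and the
Schwartz space is dense. -/
theorem eq_zero_of_orthogonal_freeOp {e : ℝ} (he : 0 < e) (f : L2 d)
    (h : ∀ φ : Space d → ℂ, ∀ hφ : IsTest φ, ⟪f, ((hφ.freeOp e).memLp 2).toLp (freeOp e φ)⟫_ℂ = 0) :
    f = 0 := by
  have hf : MemLp (fun x => (starRingEnd ℂ) (f x)) 2 volume := (Lp.memLp f).star
  have h1 : ∀ φ : Space d → ℂ, IsTest φ →
      ∫ x, (starRingEnd ℂ) (f x) * freeOp e φ x = 0 := by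
    intro φ hφ
    rw [← h φ hφ, L2.inner_def]
    refine integral_congr_ae ?_
    filter_upwards [((hφ.freeOp e).memLp 2).coeFn_toLp] with x hx
    rw [hx, RCLike.inner_apply, mul_comm]
  have h2 := integral_mul_schwartzFree_eq_zero hf h1
  refine (SchwartzMap.denseRange_toLpCLM (E := Space d) (F := ℂ) (p := 2) (μ := volume)
    (by norm_num)).eq_zero_of_inner_left ℂ fun s => ?_
  obtain ⟨u, rfl⟩ := exists_schwartzFree_eq he s
  rw [SchwartzMap.toLpCLM_apply, L2.inner_def, ← h2 u]
  refine integral_congr_ae ?_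
  filter_upwards [(schwartzFree e u).coeFn_toLp 2 volume] with x hx
  rw [hx, RCLike.inner_apply, mul_comm]

/-! ### Lattice sums and unfolding over a fundamental domain. -/

instance vaddInvariantMeasure_submodule (R : Submodule ℤ (Space d)) :
    VAddInvariantMeasure R (Space d) volume :=
  ⟨fun c s _ => measure_preimage_add volume (c : Space d) s⟩

section Lattice

variable (R : Submodule ℤ (Space d)) [DiscreteTopology R] [IsZLattice ℝ R]

/-- The number of lattice points in a closed ball. -/
def latticeCount (ρ : ℝ) : ENNReal :=
  ∑' s : R, (Metric.closedBall (0 : Space d) ρ).indicator (fun _ => 1) (s : Space d)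

omit [IsZLattice ℝ R] in
theorem latticeCount_lt_top (ρ : ℝ) : latticeCount R ρ < ⊤ := by
  have hfin : (Metric.closedBall (0 : Space d) ρ ∩ (R : Set (Space d))).Finite := by
    refine Metric.finite_isBounded_inter_isClosed ⟨inferInstanceAs (DiscreteTopology R)⟩
      Metric.isBounded_closedBall ?_
    have : DiscreteTopology R.toAddSubgroup := inferInstanceAs (DiscreteTopology R)
    exact AddSubgroup.isClosed_of_discrete (H := R.toAddSubgroup)
  have hfin' : {s : R | (s : Space d) ∈ Metric.closedBall (0 : Space d) ρ}.Finite := by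
    refine Set.Finite.of_finite_image (f := ((↑) : R → Space d)) (hfin.subset ?_)
      Subtype.coe_injective.injOn
    rintro _ ⟨s, hs, rfl⟩
    exact ⟨hs, s.2⟩
  rw [latticeCount, tsum_eq_sum (s := hfin'.toFinset)]
  · refine ENNReal.sum_lt_top.2 fun s _ => ?_
    by_cases h : (s : Space d) ∈ Metric.closedBall (0 : Space d) ρ
    · rw [indicator_of_mem h]; exact ENNReal.one_lt_top
    · rw [indicator_of_notMem h]; exact ENNReal.zero_lt_top
  · intro s hs
    refine indicator_of_notMem (fun h => hs ?_) _
    simpa using h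

omit [DiscreteTopology R] [IsZLattice ℝ R] in
-- If x − r₀ lies in the ball, any other r with x − r in the ball differs from r₀ by at most 2ρ;
-- recentring at r₀ gives a count independent of x.
theorem tsum_indicator_sub_le (ρ : ℝ) (x : Space d) :
    ∑' r : R, (Metric.closedBall (0 : Space d) ρ).indicator (fun _ => (1 : ENNReal))
      (x - (r : Space d)) ≤ latticeCount R (2 * ρ) := by
  by_cases h : ∃ r₀ : R, x - (r₀ : Space d) ∈ Metric.closedBall (0 : Space d) ρ
  · obtain ⟨r₀, hr₀⟩ := h
    rw [latticeCount, ← (Equiv.subLeft r₀).tsum_eq fun r : R =>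
      (Metric.closedBall (0 : Space d) ρ).indicator (fun _ => (1 : ENNReal)) (x - (r : Space d))]
    refine ENNReal.tsum_le_tsum fun s => ?_
    by_cases hs : x - ((Equiv.subLeft r₀ s : R) : Space d) ∈ Metric.closedBall (0 : Space d) ρ
    · have hs' : (s : Space d) ∈ Metric.closedBall (0 : Space d) (2 * ρ) := by
        rw [mem_closedBall_zero_iff] at hs hr₀ ⊢
        have h1 : (s : Space d) = (x - ((Equiv.subLeft r₀ s : R) : Space d)) - (x - r₀) := by
          simp
        rw [h1]
        linarith [norm_sub_le (x - ((Equiv.subLeft r₀ s : R) : Space d)) (x - r₀)]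
      rw [indicator_of_mem hs, indicator_of_mem hs']
    · rw [indicator_of_notMem hs]
      exact zero_le
  · push Not at h
    rw [ENNReal.tsum_eq_zero.2 fun r => indicator_of_notMem (h r) _]
    exact zero_le

/-- Finite overlap of the translates of a ball. -/
theorem tsum_lintegral_closedBall_le (ρ : ℝ) {F : Space d → ENNReal} (hF : Measurable F) :
    ∑' r : R, ∫⁻ x in Metric.closedBall (0 : Space d) ρ, F (x + (r : Space d)) ≤
      latticeCount R (2 * ρ) * ∫⁻ x, F x := by
  have h1 : ∀ r : R, ∫⁻ x in Metric.closedBall (0 : Space d) ρ, F (x + (r : Space d)) =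
      ∫⁻ x, (Metric.closedBall (0 : Space d) ρ).indicator (fun _ => (1 : ENNReal))
        (x - (r : Space d)) * F x := by
    intro r
    rw [← lintegral_indicator Metric.isClosed_closedBall.measurableSet,
      ← lintegral_add_right_eq_self (fun x => (Metric.closedBall (0 : Space d) ρ).indicator
        (fun _ => (1 : ENNReal)) (x - (r : Space d)) * F x) (r : Space d)]
    refine lintegral_congr fun x => ?_
    rw [add_sub_cancel_right]
    by_cases h : x ∈ Metric.closedBall (0 : Space d) ρ
    · simp only [indicator_of_mem h, one_mul]
    · simp only [indicator_of_notMem h, zero_mul]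
  have hm : ∀ r : R, Measurable fun x : Space d =>
      (Metric.closedBall (0 : Space d) ρ).indicator (fun _ => (1 : ENNReal)) (x - (r : Space d)) :=
    fun r => (measurable_const.indicator Metric.isClosed_closedBall.measurableSet).comp
      (measurable_id.sub_const _)
  rw [tsum_congr h1, ← lintegral_tsum fun r => (Measurable.aemeasurable (by exact (hm r).mul hF)),
    ← lintegral_const_mul _ hF]
  refine lintegral_mono fun x => ?_
  simp only
  rw [ENNReal.tsum_mul_right]
  gcongr
  exact tsum_indicator_sub_le R ρ x

variable {R} {Ω : Set (Space d)} (hΩ : IsAddFundamentalDomain R Ω (volume : Measure (Space d)))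
include hΩ

theorem lintegral_periodic_mul {w : Space d → ENNReal}
    (hw : ∀ r ∈ R, ∀ᵐ x : Space d, w (x + r) = w x) (F : Space d → ENNReal) :
    ∫⁻ x, w x * F x = ∑' r : R, ∫⁻ x in Ω, w x * F (x + (r : Space d)) := by
  rw [hΩ.lintegral_eq_tsum'']
  refine tsum_congr fun r => lintegral_congr_ae ?_
  filter_upwards [ae_restrict_of_ae (hw r r.2)] with x hx
  rw [← hx]
  change w ((r : Space d) + x) * F ((r : Space d) + x) = _
  rw [add_comm]

end Lattice

theorem dirDeriv_translate (φ : Space d → ℂ) (v r x : Space d) :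
    dirDeriv v (fun x => φ (x + r)) x = dirDeriv v φ (x + r) := by
  simp only [dirDeriv, fderiv_comp_add_right]

theorem laplacian_translate {φ : Space d → ℂ} (hφ : ContDiff ℝ ∞ φ) (r x : Space d) :
    Laplacian.laplacian (fun x => φ (x + r)) x = Laplacian.laplacian φ (x + r) := by
  rw [laplacian_eq_sum_dirDeriv (by exact hφ.comp (contDiff_id.add contDiff_const)),
    laplacian_eq_sum_dirDeriv hφ]
  refine Finset.sum_congr rfl fun j _ => ?_
  rw [show dirDeriv (stdVec j) (fun x => φ (x + r)) = fun x => dirDeriv (stdVec j) φ (x + r) from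
    funext (dirDeriv_translate φ _ r), dirDeriv_translate]

theorem freeOp_translate {φ : Space d → ℂ} (hφ : ContDiff ℝ ∞ φ) (e : ℝ) (r x : Space d) :
    freeOp e (fun x => φ (x + r)) x = freeOp e φ (x + r) := by
  simp only [freeOp, laplacian_translate hφ]

theorem add_sq_le_two_mul (a b : ENNReal) : (a + b) ^ 2 ≤ 2 * (a ^ 2 + b ^ 2) := by
  have := ENNReal.rpow_add_le_mul_rpow_add_rpow a b one_le_two
  norm_num at this
  exact this

theorem sum_sq_le_card_mul {ι : Type*} (s : Finset ι) (f : ι → ENNReal) :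
    (∑ i ∈ s, f i) ^ 2 ≤ s.card * ∑ i ∈ s, f i ^ 2 := by
  have := ENNReal.rpow_sum_le_const_mul_sum_rpow s f one_le_two
  norm_num at this
  exact this

theorem IsTest.exists_enorm_bound {φ : Space d → ℂ} (hφ : IsTest φ) :
    ∃ C : ENNReal, C < ⊤ ∧ ∀ x, ‖φ x‖ₑ ≤ C := by
  obtain ⟨C, -, hC⟩ := hφ.exists_bound
  refine ⟨ENNReal.ofReal C, ENNReal.ofReal_lt_top, fun x => ?_⟩
  rw [← ofReal_norm]
  exact ENNReal.ofReal_le_ofReal (hC x)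

theorem freeOp_eq_zero_of_eventuallyEq {φ : Space d → ℂ} {x : Space d} (e : ℝ)
    (h : φ =ᶠ[nhds x] 0) : freeOp e φ x = 0 := by
  have h1 := (InnerProductSpace.laplacian_congr_nhds h).eq_of_nhds
  have h2 : Laplacian.laplacian (0 : Space d → ℂ) x = 0 := by
    have := IsTest.zero (d := d).laplacian_scale 0 x
    simpa using this
  rw [freeOp, h1, h2, h.eq_of_nhds]
  simp

theorem l2sq_le_of_le_one {φ : Space d → ℂ} {c : ℝ} {b : ENNReal} (hc : 1 ≤ c)
    (h : l2sq φ * ENNReal.ofReal c ≤ b) : l2sq φ ≤ b :=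
  (le_mul_of_one_le_right' (ENNReal.one_le_ofReal.2 hc)).trans h

theorem le_rpow_half_of_sq_le {a b : ENNReal} (h : a ^ 2 ≤ b) : a ≤ b ^ (1 / 2 : ℝ) := by
  have := ENNReal.rpow_le_rpow h (by norm_num : (0 : ℝ) ≤ 1 / 2)
  rwa [← ENNReal.rpow_natCast_mul, show ((2 : ℕ) : ℝ) * (1 / 2) = 1 by norm_num,
    ENNReal.rpow_one] at this

/-- Relative boundedness of the first order Sobolev norm. -/
theorem lintegral_add_sq_le_freeOp {φ : Space d → ℂ} (hφ : IsTest φ) {e : ℝ} (he : 1 ≤ e) :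
    ∫⁻ x, (‖freeOp e φ x‖ₑ + ∑ j, ‖dirDeriv (stdVec j) φ x‖ₑ + ‖φ x‖ₑ) ^ 2 ≤
      2 * (2 * (1 + d * d) + 1) * l2sq (freeOp e φ) := by
  have he0 : 0 ≤ e := zero_le_one.trans he
  set l := l2sq (freeOp e φ) with hl
  have m1 : Measurable fun x => ‖freeOp e φ x‖ₑ ^ 2 :=
    ((hφ.freeOp e).continuous.measurable.enorm).pow_const 2
  have m2 : ∀ j, Measurable fun x => ‖dirDeriv (stdVec j) φ x‖ₑ ^ 2 := fun j =>
    ((hφ.dirDeriv _).continuous.measurable.enorm).pow_const 2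
  have m3 : Measurable fun x => ‖φ x‖ₑ ^ 2 := (hφ.continuous.measurable.enorm).pow_const 2
  have h1 : l2sq φ ≤ l := l2sq_le_of_le_one (one_le_pow₀ he) (l2sq_mul_le_freeOp hφ he0)
  have h2 : ∀ j, l2sq (dirDeriv (stdVec j) φ) ≤ l := fun j =>
    l2sq_le_of_le_one he (l2sq_dirDeriv_mul_le_freeOp hφ he0 j)
  calc ∫⁻ x, (‖freeOp e φ x‖ₑ + ∑ j, ‖dirDeriv (stdVec j) φ x‖ₑ + ‖φ x‖ₑ) ^ 2
      ≤ ∫⁻ x, 2 * (2 * (‖freeOp e φ x‖ₑ ^ 2 + d * ∑ j, ‖dirDeriv (stdVec j) φ x‖ₑ ^ 2) +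
          ‖φ x‖ₑ ^ 2) := by
        refine lintegral_mono fun x => (add_sq_le_two_mul _ _).trans ?_
        gcongr
        refine (add_sq_le_two_mul _ _).trans ?_
        gcongr
        have := sum_sq_le_card_mul Finset.univ fun j => ‖dirDeriv (stdVec j) φ x‖ₑ
        simpa using this
    _ = 2 * (2 * (l + d * ∑ j, l2sq (dirDeriv (stdVec j) φ)) + l2sq φ) := by
        rw [lintegral_const_mul _ (by fun_prop), lintegral_add_right _ m3,
          lintegral_const_mul _ (by fun_prop), lintegral_add_left m1,
          lintegral_const_mul _ (by fun_prop), lintegral_finsetSum _ fun j _ => m2 j]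
        rfl
    _ ≤ 2 * (2 * (l + d * ∑ _j : Fin d, l) + l) := by
        gcongr with j
        exact h2 j
    _ = _ := by
        rw [Finset.sum_const, Finset.card_univ, Fintype.card_fin, nsmul_eq_mul]
        ring

/-! ### Localisation to translates of the unit cell. -/

section Localization

variable (R : Submodule ℤ (Space d)) [DiscreteTopology R] [IsZLattice ℝ R]

/-- The cutoff costs only terms of order at most one in φ, supported in a ball whose translates
overlap finitely often. It matters that K does not depend on e, so that the smallness gained as e →
∞ survives the summation over cells. -/
theorem exists_localization {ρ : ℝ} (hρ : 0 < ρ) : ∃ K : ENNReal, K < ⊤ ∧ ∀ e : ℝ, 1 ≤ e →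
    ∀ φ : Space d → ℂ, IsTest φ →
      ∑' r : R, l2sq (freeOp e fun x => cutoffFun d ρ hρ x * φ (x + (r : Space d))) ≤
        K * l2sq (freeOp e φ) := by
  have hη := isTest_cutoffFun (d := d) ρ hρ
  set η := cutoffFun d ρ hρ with hηd
  obtain ⟨C₀, hC₀, hη₀⟩ := hη.exists_enorm_bound
  obtain ⟨C₂, hC₂, hη₂⟩ := hη.laplacian.exists_enorm_bound
  choose C₁ hC₁ hη₁ using fun j : Fin d => (hη.dirDeriv (stdVec j)).exists_enorm_bound
  set C := C₀ + ∑ j, C₁ j + C₂ with hC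
  have hCtop : C < ⊤ :=
    ENNReal.add_lt_top.2 ⟨ENNReal.add_lt_top.2 ⟨hC₀, ENNReal.sum_lt_top.2 fun j _ => hC₁ j⟩, hC₂⟩
  have hCC₀ : C₀ ≤ C := le_self_add.trans le_self_add
  have hCC₁ : ∀ j, C₁ j ≤ C := fun j =>
    (Finset.single_le_sum (f := C₁) (fun _ _ => zero_le) (Finset.mem_univ j)).trans
      (le_add_self.trans le_self_add)
  have hCC₂ : C₂ ≤ C := le_add_self
  refine ⟨C ^ 2 * (latticeCount R (2 * (ρ + 1)) * (2 * (2 * (1 + d * d) + 1))), ?_, ?_⟩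
  · refine ENNReal.mul_lt_top (ENNReal.pow_lt_top hCtop)
      (ENNReal.mul_lt_top (latticeCount_lt_top R _) ?_)
    exact_mod_cast ENNReal.natCast_lt_top (2 * (2 * (1 + d * d) + 1))
  intro e he φ hφ
  set F : Space d → ENNReal := fun x =>
    (‖freeOp e φ x‖ₑ + ∑ j, ‖dirDeriv (stdVec j) φ x‖ₑ + ‖φ x‖ₑ) ^ 2 with hF
  have hFm : Measurable F := by
    have m1 : Measurable fun x => ‖freeOp e φ x‖ₑ := (hφ.freeOp e).continuous.measurable.enorm
    have m2 : ∀ j, Measurable fun x => ‖dirDeriv (stdVec j) φ x‖ₑ := fun j =>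
      (hφ.dirDeriv _).continuous.measurable.enorm
    have m3 : Measurable fun x => ‖φ x‖ₑ := hφ.continuous.measurable.enorm
    fun_prop
  have hpt : ∀ (r : R) (x : Space d),
      ‖freeOp e (fun x => η x * φ (x + (r : Space d))) x‖ₑ ^ 2 ≤
        (Metric.closedBall (0 : Space d) (ρ + 1)).indicator
          (fun x => C ^ 2 * F (x + (r : Space d))) x := by
    intro r x
    by_cases hx : x ∈ Metric.closedBall (0 : Space d) (ρ + 1)
    · rw [indicator_of_mem hx, hF, ← mul_pow]
      gcongr
      rw [freeOp_mul hη.1 (hφ.translate _).1, freeOp_translate hφ.1]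
      refine (enorm_sub_le.trans (add_le_add_left enorm_sub_le _)).trans ?_
      rw [mul_add, mul_add, Finset.mul_sum]
      refine add_le_add (add_le_add ?_ ((enorm_sum_le _ _).trans (Finset.sum_le_sum fun j _ => ?_)))
        ?_
      · rw [enorm_mul]
        gcongr
        exact (hη₀ x).trans hCC₀
      · rw [enorm_mul, dirDeriv_translate]
        gcongr
        exact (hη₁ j x).trans (hCC₁ j)
      · rw [enorm_mul, enorm_mul]
        gcongr
        have h3 : ‖(1 / 2 : ℂ)‖ₑ ≤ 1 := by
          rw [← ofReal_norm, ENNReal.ofReal_le_one]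
          norm_num
        calc ‖(1 / 2 : ℂ)‖ₑ * ‖Laplacian.laplacian η x‖ₑ ≤ 1 * C₂ := by
              gcongr
              exact hη₂ x
          _ ≤ C := by rw [one_mul]; exact hCC₂
    · rw [indicator_of_notMem hx, freeOp_eq_zero_of_eventuallyEq e]
      · simp
      · filter_upwards [Metric.isClosed_closedBall.isOpen_compl.mem_nhds hx] with y hy
        have : η y = 0 := by
          have h4 : cutoff d ρ hρ y = 0 := (cutoff d ρ hρ).zero_of_le_dist (by
            have : ρ + 1 < dist y 0 := by simpa using hy
            exact this.le)
          simp [hηd, cutoffFun, h4]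
        simp [this]
  have hr : ∀ r : R, l2sq (freeOp e fun x => η x * φ (x + (r : Space d))) ≤
      C ^ 2 * ∫⁻ x in Metric.closedBall (0 : Space d) (ρ + 1), F (x + (r : Space d)) := by
    intro r
    rw [← lintegral_const_mul _ (by exact hFm.comp (measurable_id.add_const _)),
      ← lintegral_indicator Metric.isClosed_closedBall.measurableSet]
    exact lintegral_mono fun x => hpt r x
  calc ∑' r : R, l2sq (freeOp e fun x => η x * φ (x + (r : Space d)))
      ≤ ∑' r : R, C ^ 2 * ∫⁻ x in Metric.closedBall (0 : Space d) (ρ + 1), F (x + (r : Space d)) :=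
        ENNReal.tsum_le_tsum hr
    _ ≤ C ^ 2 * (latticeCount R (2 * (ρ + 1)) *
          (2 * (2 * (1 + d * d) + 1) * l2sq (freeOp e φ))) := by
        rw [ENNReal.tsum_mul_left]
        gcongr
        refine (tsum_lintegral_closedBall_le R (ρ + 1) hFm).trans ?_
        gcongr
        exact lintegral_add_sq_le_freeOp hφ he
    _ = _ := by ring

variable {R} {Ω : Set (Space d)} (hΩ : IsAddFundamentalDomain R Ω (volume : Measure (Space d)))
include hΩ

/-- A periodic locally square integrable function is relatively bounded with respect to the
Laplacian. -/
theorem lintegral_periodic_mul_le {ρ : ℝ} (hρ : 0 < ρ) (hΩρ : ∀ x ∈ Ω, ‖x‖ < ρ) {K : ENNReal}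
    {e : ℝ} (he : 1 ≤ e) {φ : Space d → ℂ} (hφ : IsTest φ)
    (hK : ∑' r : R, l2sq (freeOp e fun x => cutoffFun d ρ hρ x * φ (x + (r : Space d))) ≤
        K * l2sq (freeOp e φ))
    {w : Space d → ENNReal} (hwm : AEMeasurable w (volume.restrict Ω))
    (hw : ∀ r ∈ R, ∀ᵐ x : Space d, w (x + r) = w x) :
    ∫⁻ x, w x * ‖φ x‖ₑ ^ 2 ≤ (∫⁻ x in Ω, w x) * supConst d e * K * l2sq (freeOp e φ) := by
  rw [lintegral_periodic_mul hΩ hw]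
  have h1 : ∀ r : R, ∫⁻ x in Ω, w x * ‖φ (x + (r : Space d))‖ₑ ^ 2 ≤
      ((∫⁻ x in Ω, w x) * supConst d e) *
        l2sq (freeOp e fun x => cutoffFun d ρ hρ x * φ (x + (r : Space d))) := by
    intro r
    have hg : IsTest fun x => cutoffFun d ρ hρ x * φ (x + (r : Space d)) :=
      (isTest_cutoffFun ρ hρ).mul (hφ.translate _)
    set b := supConst d e *
      l2sq (freeOp e fun x => cutoffFun d ρ hρ x * φ (x + (r : Space d))) with hb
    -- On Ω the cutoff is 1, so the sup bound for the localised function controls the translate of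
    -- φ; only the integral of w over one cell remains.
    have h2 : ∀ᵐ x ∂(volume.restrict Ω), w x * ‖φ (x + (r : Space d))‖ₑ ^ 2 ≤ w x * b := by
      refine (ae_restrict_of_ae_restrict_of_subset (t := Metric.closedBall 0 ρ)
        (fun x hx => by simpa using (hΩρ x hx).le) ?_)
      refine (ae_restrict_iff' Metric.isClosed_closedBall.measurableSet).2 (.of_forall fun x hx => ?_)
      gcongr
      have h3 := enorm_sq_le_supConst hg (zero_lt_one.trans_le he) x
      simpa only [cutoffFun_eq_one hρ (mem_closedBall_zero_iff.1 hx), one_mul] using h3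
    refine (lintegral_mono_ae h2).trans ?_
    rw [mul_assoc, ← hb]
    rw [lintegral_mul_const'' _ hwm]
  refine (ENNReal.tsum_le_tsum h1).trans ?_
  rw [ENNReal.tsum_mul_left, mul_assoc _ K]
  gcongr

/-- Gradients obey no sup bound, so Cauchy–Schwarz on the cell is paired with the L⁴ bound on ∂φ.
The weight must then be square integrable on the cell; for w = |A|² this is the hypothesis A ∈ L⁴.
-/
theorem lintegral_periodic_mul_dirDeriv_le {ρ : ℝ} (hρ : 0 < ρ) (hΩρ : ∀ x ∈ Ω, ‖x‖ < ρ)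
    {K : ENNReal} {e : ℝ} (he : 1 ≤ e) {φ : Space d → ℂ} (hφ : IsTest φ)
    (hK : ∑' r : R, l2sq (freeOp e fun x => cutoffFun d ρ hρ x * φ (x + (r : Space d))) ≤
        K * l2sq (freeOp e φ))
    {w : Space d → ENNReal} (hwm : AEMeasurable w (volume.restrict Ω))
    (hw : ∀ r ∈ R, ∀ᵐ x : Space d, w (x + r) = w x) (j : Fin d) :
    ∫⁻ x, w x * ‖dirDeriv (stdVec j) φ x‖ₑ ^ 2 ≤
      (∫⁻ x in Ω, w x ^ 2) ^ (1 / 2 : ℝ) * (6 * supConst d e ^ (1 / 2 : ℝ)) * K *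
        l2sq (freeOp e φ) := by
  rw [lintegral_periodic_mul hΩ hw]
  have h1 : ∀ r : R, ∫⁻ x in Ω, w x * ‖dirDeriv (stdVec j) φ (x + (r : Space d))‖ₑ ^ 2 ≤
      (∫⁻ x in Ω, w x ^ 2) ^ (1 / 2 : ℝ) * (6 * supConst d e ^ (1 / 2 : ℝ)) *
        l2sq (freeOp e fun x => cutoffFun d ρ hρ x * φ (x + (r : Space d))) := by
    intro r
    set g : Space d → ℂ := fun x => cutoffFun d ρ hρ x * φ (x + (r : Space d)) with hgd
    have hg : IsTest g := (isTest_cutoffFun ρ hρ).mul (hφ.translate _)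
    set b := l2sq (freeOp e g) with hb
    have h2 : ∫⁻ x in Ω, w x * ‖dirDeriv (stdVec j) φ (x + (r : Space d))‖ₑ ^ 2 =
        ∫⁻ x in Ω, w x * ‖dirDeriv (stdVec j) g x‖ₑ ^ 2 := by
      -- The open ball is used here: derivatives agree only where the cutoff is 1 on a
      -- neighbourhood.
      refine lintegral_congr_ae (ae_restrict_of_ae_restrict_of_subset (t := Metric.ball 0 ρ)
        (fun x hx => by simpa using hΩρ x hx) ?_)
      refine (ae_restrict_iff' Metric.isOpen_ball.measurableSet).2 (.of_forall fun x hx => ?_)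
      have hev : g =ᶠ[nhds x] fun x => φ (x + (r : Space d)) := by
        filter_upwards [Metric.isOpen_ball.mem_nhds hx] with y hy
        rw [hgd]
        simp only [cutoffFun_eq_one hρ (mem_ball_zero_iff.1 hy).le, one_mul]
      have hd : dirDeriv (stdVec j) g x = dirDeriv (stdVec j) φ (x + (r : Space d)) := by
        rw [← dirDeriv_translate]
        exact congrArg (fun L : Space d →L[ℝ] ℂ => L (stdVec j)) hev.fderiv_eq
      simp only [hd]
    have h3 := lintegral_mul_sq_le (μ := volume.restrict Ω) hwm
      (g := fun x => ‖dirDeriv (stdVec j) g x‖ₑ ^ 2)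
      (((hg.dirDeriv _).continuous.measurable.enorm).pow_const 2).aemeasurable
    have h4 : ∫⁻ x in Ω, (‖dirDeriv (stdVec j) g x‖ₑ ^ 2) ^ 2 ≤ 36 * supConst d e * b ^ 2 := by
      refine le_trans ?_ (lintegral_dirDeriv_pow_four_le_freeOp hg j (zero_lt_one.trans_le he))
      simp only [← pow_mul]
      exact setLIntegral_le_lintegral _ _
    rw [h2]
    have h5 : ∫⁻ x in Ω, w x * ‖dirDeriv (stdVec j) g x‖ₑ ^ 2 ≤
        ((∫⁻ x in Ω, w x ^ 2) * (36 * supConst d e * b ^ 2)) ^ (1 / 2 : ℝ) := by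
      refine le_rpow_half_of_sq_le (h3.trans ?_)
      gcongr
    refine h5.trans_eq ?_
    have h36 : (36 : ENNReal) ^ (1 / 2 : ℝ) = 6 := by
      rw [show (36 : ENNReal) = 6 ^ (2 : ℝ) by norm_num, ← ENNReal.rpow_mul]
      norm_num
    rw [ENNReal.mul_rpow_of_nonneg _ _ (by norm_num), ENNReal.mul_rpow_of_nonneg _ _ (by norm_num),
      ENNReal.mul_rpow_of_nonneg _ _ (by norm_num), h36, ← ENNReal.rpow_natCast_mul]
    norm_num
    ring
  refine (ENNReal.tsum_le_tsum h1).trans ?_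
  rw [ENNReal.tsum_mul_left, mul_assoc _ K]
  gcongr

end Localization

/-! ### Relative bounds for the terms containing A and V, and for the current. -/

namespace IsPeriodicLp

variable {F : Type*} [NormedAddCommGroup F] {R : Submodule ℤ (Space d)} {p : ENNReal}
  {f : Space d → F}

theorem aestronglyMeasurable (hf : IsPeriodicLp R p f) :
    AEStronglyMeasurable f (volume : Measure (Space d)) := by
  have h1 : (⋃ n : ℕ, Metric.closedBall (0 : Space d) n) = univ := Metric.iUnion_closedBall_nat 0
  rw [← Measure.restrict_univ (μ := volume), ← h1, aestronglyMeasurable_iUnion_iff]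
  exact fun n => (hf.2 _ (isCompact_closedBall 0 n)).1

theorem memLp_restrict (hf : IsPeriodicLp R p f) {Ω : Set (Space d)}
    (hΩ : Bornology.IsBounded Ω) : MemLp f p (volume.restrict Ω) := by
  obtain ⟨ρ, hρ⟩ := hΩ.subset_closedBall 0
  exact (hf.2 _ (isCompact_closedBall 0 ρ)).mono_measure (Measure.restrict_mono hρ le_rfl)

theorem lintegral_enorm_pow_lt_top {n : ℕ} (hn : n ≠ 0) (hf : IsPeriodicLp R n f)
    {Ω : Set (Space d)} (hΩ : Bornology.IsBounded Ω) : ∫⁻ x in Ω, ‖f x‖ₑ ^ n < ⊤ := by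
  have h := eLpNorm_lt_top_iff_lintegral_rpow_enorm_lt_top (by exact_mod_cast hn)
    (ENNReal.natCast_ne_top n) |>.1 (hf.memLp_restrict hΩ).2
  simpa using h

theorem mono_exponent {q : ENNReal} (hf : IsPeriodicLp R p f) (hq : q ≤ p) :
    IsPeriodicLp R q f := by
  refine ⟨hf.1, fun K hK => ?_⟩
  have : IsFiniteMeasure ((volume : Measure (Space d)).restrict K) :=
    ⟨by rw [Measure.restrict_apply_univ]; exact hK.measure_lt_top⟩
  exact (hf.2 K hK).mono_exponent hq

theorem enorm_pow_periodic (hf : IsPeriodicLp R p f) (n : ℕ) :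
    ∀ r ∈ R, ∀ᵐ x : Space d, ‖f (x + r)‖ₑ ^ n = ‖f x‖ₑ ^ n := fun r hr => by
  filter_upwards [hf.1 r hr] with x hx
  rw [hx]

end IsPeriodicLp

theorem fderiv_eq_sum (φ : Space d → ℂ) (x v : Space d) :
    fderiv ℝ φ x v = ∑ j, (v j : ℂ) * dirDeriv (stdVec j) φ x := by
  conv_lhs => rw [← (EuclideanSpace.basisFun (Fin d) ℝ).sum_repr v, map_sum]
  refine Finset.sum_congr rfl fun j _ => ?_
  rw [map_smul, Complex.real_smul]
  rfl

theorem enorm_fderiv_sq_le (φ : Space d → ℂ) (x v : Space d) :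
    ‖fderiv ℝ φ x v‖ₑ ^ 2 ≤ d * ∑ j, ‖v‖ₑ ^ 2 * ‖dirDeriv (stdVec j) φ x‖ₑ ^ 2 := by
  have h1 : ‖fderiv ℝ φ x v‖ₑ ≤ ∑ j, ‖v‖ₑ * ‖dirDeriv (stdVec j) φ x‖ₑ := by
    rw [fderiv_eq_sum]
    refine (enorm_sum_le _ _).trans (Finset.sum_le_sum fun j _ => ?_)
    rw [enorm_mul]
    gcongr
    rw [← ofReal_norm, ← ofReal_norm, Complex.norm_real]
    exact ENNReal.ofReal_le_ofReal (EuclideanSpace.norm_eq v ▸ by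
      have := PiLp.norm_apply_le v j
      rwa [EuclideanSpace.norm_eq] at this)
  calc ‖fderiv ℝ φ x v‖ₑ ^ 2 ≤ (∑ j, ‖v‖ₑ * ‖dirDeriv (stdVec j) φ x‖ₑ) ^ 2 := by gcongr
    _ ≤ _ := by
      have := sum_sq_le_card_mul Finset.univ fun j => ‖v‖ₑ * ‖dirDeriv (stdVec j) φ x‖ₑ
      simpa [mul_pow] using this

/-- The perturbation `-i A · ∇ + ½ |A|² + V` of the Laplacian in the Hamiltonian. -/
def fieldTerm (A : Space d → Space d) (V : Space d → ℝ) (φ : Space d → ℂ) (x : Space d) : ℂ :=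
  -Complex.I * fderiv ℝ φ x (A x) + ((1 / 2 * ‖A x‖ ^ 2 + V x : ℝ) : ℂ) * φ x

theorem hamiltonianFun_add (A : Space d → Space d) (V : Space d → ℝ) (φ : Space d → ℂ) (e : ℝ)
    (x : Space d) : hamiltonianFun A V φ x + e * φ x = freeOp e φ x + fieldTerm A V φ x := by
  simp only [hamiltonianFun, freeOp, fieldTerm]
  ring

theorem enorm_fieldTerm_sq_le (A : Space d → Space d) (V : Space d → ℝ) (φ : Space d → ℂ)
    (x : Space d) : ‖fieldTerm A V φ x‖ₑ ^ 2 ≤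
      2 * (d * ∑ j, ‖A x‖ₑ ^ 2 * ‖dirDeriv (stdVec j) φ x‖ₑ ^ 2 +
        2 * (‖A x‖ₑ ^ 4 * ‖φ x‖ₑ ^ 2 + ‖V x‖ₑ ^ 2 * ‖φ x‖ₑ ^ 2)) := by
  have h1 : ‖fieldTerm A V φ x‖ₑ ≤
      ‖fderiv ℝ φ x (A x)‖ₑ + (‖A x‖ₑ ^ 2 + ‖V x‖ₑ) * ‖φ x‖ₑ := by
    rw [fieldTerm]
    refine (enorm_add_le _ _).trans (add_le_add ?_ ?_)
    · rw [enorm_mul, enorm_neg, ← ofReal_norm Complex.I, Complex.norm_I, ENNReal.ofReal_one, one_mul]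
    · rw [enorm_mul]
      gcongr
      rw [← ofReal_norm, Complex.norm_real, ofReal_norm]
      refine (enorm_add_le _ _).trans ?_
      gcongr
      rw [← ofReal_norm (A x), ← ENNReal.ofReal_pow (norm_nonneg _), ← ofReal_norm]
      refine ENNReal.ofReal_le_ofReal ?_
      rw [Real.norm_of_nonneg (by positivity)]
      linarith [sq_nonneg ‖A x‖]
  calc ‖fieldTerm A V φ x‖ₑ ^ 2
      ≤ (‖fderiv ℝ φ x (A x)‖ₑ + (‖A x‖ₑ ^ 2 + ‖V x‖ₑ) * ‖φ x‖ₑ) ^ 2 := by gcongr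
    _ ≤ 2 * (‖fderiv ℝ φ x (A x)‖ₑ ^ 2 + ((‖A x‖ₑ ^ 2 + ‖V x‖ₑ) * ‖φ x‖ₑ) ^ 2) :=
        add_sq_le_two_mul _ _
    _ ≤ _ := by
        gcongr
        · exact enorm_fderiv_sq_le φ x (A x)
        · rw [mul_pow]
          calc (‖A x‖ₑ ^ 2 + ‖V x‖ₑ) ^ 2 * ‖φ x‖ₑ ^ 2
              ≤ 2 * ((‖A x‖ₑ ^ 2) ^ 2 + ‖V x‖ₑ ^ 2) * ‖φ x‖ₑ ^ 2 := by
                gcongr; exact add_sq_le_two_mul _ _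
            _ = _ := by ring

theorem enorm_currentFun_sq_le (A : Space d → Space d) (v : Space d) (φ : Space d → ℂ)
    (x : Space d) : ‖currentFun A v φ x‖ₑ ^ 2 ≤
      2 * ‖v‖ₑ ^ 2 * (d * ∑ j, ‖dirDeriv (stdVec j) φ x‖ₑ ^ 2 + ‖A x‖ₑ ^ 2 * ‖φ x‖ₑ ^ 2) := by
  have h1 : ‖currentFun A v φ x‖ₑ ≤ ‖fderiv ℝ φ x v‖ₑ + ‖v‖ₑ * (‖A x‖ₑ * ‖φ x‖ₑ) := by
    rw [currentFun, enorm_neg]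
    refine (enorm_add_le _ _).trans (add_le_add ?_ ?_)
    · rw [enorm_mul, enorm_neg, ← ofReal_norm Complex.I, Complex.norm_I, ENNReal.ofReal_one, one_mul]
    · rw [enorm_mul, ← mul_assoc]
      gcongr
      rw [← ofReal_norm, ← ofReal_norm v, ← ofReal_norm (A x),
        ← ENNReal.ofReal_mul (norm_nonneg _), Complex.norm_real, mul_comm]
      exact ENNReal.ofReal_le_ofReal (norm_inner_le_norm _ _)
  calc ‖currentFun A v φ x‖ₑ ^ 2
      ≤ (‖fderiv ℝ φ x v‖ₑ + ‖v‖ₑ * (‖A x‖ₑ * ‖φ x‖ₑ)) ^ 2 := by gcongr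
    _ ≤ 2 * (‖fderiv ℝ φ x v‖ₑ ^ 2 + (‖v‖ₑ * (‖A x‖ₑ * ‖φ x‖ₑ)) ^ 2) := add_sq_le_two_mul _ _
    _ ≤ 2 * (d * ∑ j, ‖v‖ₑ ^ 2 * ‖dirDeriv (stdVec j) φ x‖ₑ ^ 2 +
          (‖v‖ₑ * (‖A x‖ₑ * ‖φ x‖ₑ)) ^ 2) := by
        gcongr
        exact enorm_fderiv_sq_le φ x v
    _ = _ := by
        rw [← Finset.mul_sum]
        ring

section Bounds

variable {R : Submodule ℤ (Space d)} [DiscreteTopology R] [IsZLattice ℝ R] {Ω : Set (Space d)}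
  (hΩ : IsUnitCell R Ω) {A : Space d → Space d} (hA : IsPeriodicLp R 4 A)
  {V : Space d → ℝ} (hV : IsPeriodicLp R 2 V)

include hΩ hA

theorem exists_weight_bounds : ∃ K : ENNReal, K < ⊤ ∧ ∀ e : ℝ, 1 ≤ e → ∀ φ : Space d → ℂ,
    IsTest φ →
      (∀ n : ℕ, ∀ {F : Type} [NormedAddCommGroup F] (f : Space d → F), IsPeriodicLp R n f →
        ∫⁻ x, ‖f x‖ₑ ^ n * ‖φ x‖ₑ ^ 2 ≤
          (∫⁻ x in Ω, ‖f x‖ₑ ^ n) * supConst d e * K * l2sq (freeOp e φ)) ∧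
      ∀ j, ∫⁻ x, ‖A x‖ₑ ^ 2 * ‖dirDeriv (stdVec j) φ x‖ₑ ^ 2 ≤
        (∫⁻ x in Ω, ‖A x‖ₑ ^ 4) ^ (1 / 2 : ℝ) * (6 * supConst d e ^ (1 / 2 : ℝ)) * K *
          l2sq (freeOp e φ) := by
  obtain ⟨ρ, hρ, hsub⟩ := hΩ.1.subset_ball_lt 0 0
  have hΩρ : ∀ x ∈ Ω, ‖x‖ < ρ := fun x hx => by simpa using hsub hx
  obtain ⟨K, hKt, hK⟩ := exists_localization R hρ
  refine ⟨K, hKt, fun e he φ hφ => ⟨fun n F _ f hf => ?_, fun j => ?_⟩⟩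
  · exact lintegral_periodic_mul_le hΩ.2 hρ hΩρ he hφ (hK e he φ hφ)
      (hf.aestronglyMeasurable.enorm.pow_const n).restrict (hf.enorm_pow_periodic n)
  · have := lintegral_periodic_mul_dirDeriv_le hΩ.2 hρ hΩρ he hφ (hK e he φ hφ)
      (w := fun x => ‖A x‖ₑ ^ 2) (hA.aestronglyMeasurable.enorm.pow_const 2).restrict
      (hA.enorm_pow_periodic 2) j
    simpa only [← pow_mul] using this

include hV

/-- The terms |A|²φ and Vφ carry a full power of `supConst`, the term A·∇φ only its square root;
once `supConst` is at most 1 the square root dominates both. -/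
theorem exists_l2sq_fieldTerm_le : ∃ M : ENNReal, M < ⊤ ∧ ∀ e : ℝ, 1 ≤ e → supConst d e ≤ 1 →
    ∀ φ : Space d → ℂ, IsTest φ →
      l2sq (fieldTerm A V φ) ≤ M * supConst d e ^ (1 / 2 : ℝ) * l2sq (freeOp e φ) := by
  obtain ⟨K, hK, hb⟩ := exists_weight_bounds hΩ hA
  set a := ∫⁻ x in Ω, ‖A x‖ₑ ^ 4 with ha
  set b := ∫⁻ x in Ω, ‖V x‖ₑ ^ 2 with hbd
  have hat : a < ⊤ := IsPeriodicLp.lintegral_enorm_pow_lt_top (by norm_num) (by exact_mod_cast hA) hΩ.1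
  have hbt : b < ⊤ := IsPeriodicLp.lintegral_enorm_pow_lt_top (by norm_num) (by exact_mod_cast hV) hΩ.1
  have hat' : a ^ (1 / 2 : ℝ) < ⊤ := ENNReal.rpow_lt_top_of_nonneg (by norm_num) hat.ne
  refine ⟨2 * (d * (d * (a ^ (1 / 2 : ℝ) * 6 * K)) + 2 * (a * K + b * K)), ?_, ?_⟩
  · have hd : (d : ENNReal) < ⊤ := ENNReal.natCast_lt_top d
    have h2 : (2 : ENNReal) < ⊤ := ENNReal.ofNat_lt_top
    have h6 : (6 : ENNReal) < ⊤ := ENNReal.ofNat_lt_top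
    refine ENNReal.mul_lt_top h2 (ENNReal.add_lt_top.2 ⟨ENNReal.mul_lt_top hd (ENNReal.mul_lt_top hd
      (ENNReal.mul_lt_top (ENNReal.mul_lt_top hat' h6) hK)), ENNReal.mul_lt_top h2
      (ENNReal.add_lt_top.2 ⟨ENNReal.mul_lt_top hat hK, ENNReal.mul_lt_top hbt hK⟩)⟩)
  intro e he hs φ hφ
  obtain ⟨h1, h2⟩ := hb e he φ hφ
  have h3 := h1 4 A (by exact_mod_cast hA)
  have h4 := h1 2 V (by exact_mod_cast hV)
  set s := supConst d e ^ (1 / 2 : ℝ) with hsd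
  set l := l2sq (freeOp e φ) with hl
  have hs' : supConst d e ≤ s := by
    calc supConst d e = supConst d e ^ (1 : ℝ) := (ENNReal.rpow_one _).symm
      _ ≤ s := ENNReal.rpow_le_rpow_of_exponent_ge hs (by norm_num)
  have mA : ∀ n, AEMeasurable fun x => ‖A x‖ₑ ^ n := fun n =>
    hA.aestronglyMeasurable.enorm.pow_const n
  have mV : AEMeasurable fun x => ‖V x‖ₑ ^ 2 := hV.aestronglyMeasurable.enorm.pow_const 2
  have mφ : AEMeasurable fun x => ‖φ x‖ₑ ^ 2 :=
    (hφ.continuous.measurable.enorm.pow_const 2).aemeasurable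
  have m1 : ∀ j, AEMeasurable fun x => ‖A x‖ₑ ^ 2 * ‖dirDeriv (stdVec j) φ x‖ₑ ^ 2 := fun j =>
    (mA 2).mul ((hφ.dirDeriv _).continuous.measurable.enorm.pow_const 2).aemeasurable
  have m2 : AEMeasurable fun x => ‖A x‖ₑ ^ 4 * ‖φ x‖ₑ ^ 2 := (mA 4).mul mφ
  have m3 : AEMeasurable fun x => ‖V x‖ₑ ^ 2 * ‖φ x‖ₑ ^ 2 := mV.mul mφ
  have m4 : AEMeasurable fun x => ∑ j, ‖A x‖ₑ ^ 2 * ‖dirDeriv (stdVec j) φ x‖ₑ ^ 2 :=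
    Finset.aemeasurable_fun_sum _ fun j _ => m1 j
  calc l2sq (fieldTerm A V φ)
      ≤ ∫⁻ x, 2 * (d * ∑ j, ‖A x‖ₑ ^ 2 * ‖dirDeriv (stdVec j) φ x‖ₑ ^ 2 +
        2 * (‖A x‖ₑ ^ 4 * ‖φ x‖ₑ ^ 2 + ‖V x‖ₑ ^ 2 * ‖φ x‖ₑ ^ 2)) :=
        lintegral_mono fun x => enorm_fieldTerm_sq_le A V φ x
    _ = 2 * (d * ∑ j, (∫⁻ x, ‖A x‖ₑ ^ 2 * ‖dirDeriv (stdVec j) φ x‖ₑ ^ 2) +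
        2 * ((∫⁻ x, ‖A x‖ₑ ^ 4 * ‖φ x‖ₑ ^ 2) + ∫⁻ x, ‖V x‖ₑ ^ 2 * ‖φ x‖ₑ ^ 2)) := by
        rw [lintegral_const_mul' _ _ ENNReal.ofNat_ne_top, lintegral_add_left' (m4.const_mul _),
          lintegral_const_mul' _ _ (ENNReal.natCast_ne_top d), lintegral_finsetSum' _ fun j _ => m1 j,
          lintegral_const_mul' _ _ ENNReal.ofNat_ne_top, lintegral_add_left' m2]
    _ ≤ 2 * (d * ∑ _j : Fin d, (a ^ (1 / 2 : ℝ) * (6 * s) * K * l) +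
        2 * (a * s * K * l + b * s * K * l)) := by
        gcongr with j
        · exact h2 j
        · refine h3.trans ?_
          gcongr
        · refine h4.trans ?_
          gcongr
    _ = _ := by
        rw [Finset.sum_const, Finset.card_univ, Fintype.card_fin, nsmul_eq_mul]
        ring

/-- The field terms are infinitesimally bounded with respect to the Laplacian. -/
theorem exists_l2sq_fieldTerm_le_quarter (hd : d ≤ 3) : ∃ e₀ : ℝ, 1 ≤ e₀ ∧ ∀ e : ℝ, e₀ ≤ e →
    supConst d e ≤ 1 ∧ ∀ φ : Space d → ℂ, IsTest φ →
      l2sq (fieldTerm A V φ) ≤ 1 / 4 * l2sq (freeOp e φ) := by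
  obtain ⟨M, hM, h⟩ := exists_l2sq_fieldTerm_le hΩ hA hV
  -- Requiring `supConst` ≤ t² makes its square root at most t, and M t ≤ 1/4; the added 1 keeps M +
  -- 1 nonzero.
  set t : ENNReal := (4 * (M + 1))⁻¹ with ht
  have hMt : 4 * (M + 1) < ⊤ :=
    ENNReal.mul_lt_top ENNReal.ofNat_lt_top (ENNReal.add_lt_top.2 ⟨hM, ENNReal.one_lt_top⟩)
  have h1M : 1 ≤ 4 * (M + 1) := by
    calc (1 : ENNReal) ≤ M + 1 := le_add_self
      _ = 1 * (M + 1) := (one_mul _).symm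
      _ ≤ 4 * (M + 1) := by gcongr; norm_num
  have ht0 : 0 < t ^ 2 := pos_iff_ne_zero.2 (pow_ne_zero 2 (ENNReal.inv_ne_zero.2 hMt.ne))
  have ht1 : t ≤ 1 := ENNReal.inv_le_one.2 h1M
  obtain ⟨e₀, he₀, hs⟩ := exists_supConst_lt hd ht0
  refine ⟨e₀, he₀, fun e he => ?_⟩
  have hs1 : supConst d e ≤ 1 := (hs e he).trans (pow_le_one₀ zero_le ht1)
  refine ⟨hs1, fun φ hφ => (h e (he₀.trans he) hs1 φ hφ).trans ?_⟩
  gcongr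
  have hst : supConst d e ^ (1 / 2 : ℝ) ≤ t := by
    refine (ENNReal.rpow_le_rpow (hs e he) (by norm_num)).trans_eq ?_
    rw [← ENNReal.rpow_natCast_mul]
    norm_num
  calc M * supConst d e ^ (1 / 2 : ℝ) ≤ (M + 1) * t := by gcongr; exact le_self_add
    _ = 1 / 4 := by
      rw [ht, ENNReal.mul_inv (.inl (by norm_num)) (.inl (by norm_num)), mul_left_comm,
        ENNReal.mul_inv_cancel (by simp) (ENNReal.add_lt_top.2 ⟨hM, ENNReal.one_lt_top⟩).ne]
      norm_num

omit hV in
-- The current is of first order and needs only boundedness relative to −½Δ + e, not smallness;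
-- local square integrability of A is enough.
theorem exists_l2sq_currentFun_le (v : Space d) : ∃ C : ENNReal, C < ⊤ ∧ ∀ e : ℝ, 1 ≤ e →
    supConst d e ≤ 1 → ∀ φ : Space d → ℂ, IsTest φ →
      l2sq (currentFun A v φ) ≤ C * l2sq (freeOp e φ) := by
  obtain ⟨K, hK, hb⟩ := exists_weight_bounds hΩ hA
  have hA2 : IsPeriodicLp R 2 A := hA.mono_exponent (by norm_num)
  set a := ∫⁻ x in Ω, ‖A x‖ₑ ^ 2 with ha
  have hat : a < ⊤ :=
    IsPeriodicLp.lintegral_enorm_pow_lt_top (by norm_num) (by exact_mod_cast hA2) hΩ.1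
  refine ⟨2 * ‖v‖ₑ ^ 2 * (d * d + a * K), ?_, fun e he hs φ hφ => ?_⟩
  · have hd : (d : ENNReal) < ⊤ := ENNReal.natCast_lt_top d
    exact ENNReal.mul_lt_top (ENNReal.mul_lt_top ENNReal.ofNat_lt_top
      (ENNReal.pow_lt_top enorm_lt_top)) (ENNReal.add_lt_top.2
      ⟨ENNReal.mul_lt_top hd hd, ENNReal.mul_lt_top hat hK⟩)
  have h3 := (hb e he φ hφ).1 2 A (by exact_mod_cast hA2)
  set l := l2sq (freeOp e φ) with hl
  have h2 : ∀ j, l2sq (dirDeriv (stdVec j) φ) ≤ l := fun j =>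
    l2sq_le_of_le_one he (l2sq_dirDeriv_mul_le_freeOp hφ (zero_le_one.trans he) j)
  have m1 : ∀ j, Measurable fun x => ‖dirDeriv (stdVec j) φ x‖ₑ ^ 2 := fun j =>
    (hφ.dirDeriv _).continuous.measurable.enorm.pow_const 2
  have m4 : Measurable fun x => ∑ j, ‖dirDeriv (stdVec j) φ x‖ₑ ^ 2 :=
    Finset.measurable_fun_sum _ fun j _ => m1 j
  calc l2sq (currentFun A v φ)
      ≤ ∫⁻ x, 2 * ‖v‖ₑ ^ 2 *
          (d * ∑ j, ‖dirDeriv (stdVec j) φ x‖ₑ ^ 2 + ‖A x‖ₑ ^ 2 * ‖φ x‖ₑ ^ 2) :=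
        lintegral_mono fun x => enorm_currentFun_sq_le A v φ x
    _ = 2 * ‖v‖ₑ ^ 2 * (d * ∑ j, l2sq (dirDeriv (stdVec j) φ) +
          ∫⁻ x, ‖A x‖ₑ ^ 2 * ‖φ x‖ₑ ^ 2) := by
        rw [lintegral_const_mul' _ _ (by finiteness), lintegral_add_left (m4.const_mul _),
          lintegral_const_mul _ m4, lintegral_finsetSum _ fun j _ => m1 j]
        rfl
    _ ≤ 2 * ‖v‖ₑ ^ 2 * (d * ∑ _j : Fin d, l + a * 1 * K * l) := by
        gcongr with j
        · exact h2 j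
        · refine h3.trans ?_
          gcongr
    _ = _ := by
        rw [Finset.sum_const, Finset.card_univ, Fintype.card_fin, nsmul_eq_mul]
        ring

end Bounds

/-! ### Graphs on test functions: density and symmetry. -/

theorem enorm_sq_eq_l2sq {g : L2 d} {f : Space d → ℂ} (h : g =ᵐ[volume] f) :
    ‖g‖ₑ ^ 2 = l2sq f := by
  rw [Lp.enorm_def, eLpNorm_congr_ae h, eLpNorm_eq_lintegral_rpow_enorm_toReal (by norm_num)
    (by norm_num), ← ENNReal.rpow_natCast, ← ENNReal.rpow_mul, l2sq]
  norm_num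

theorem memLp_of_l2sq_lt_top {f : Space d → ℂ} (hf : AEStronglyMeasurable f volume)
    (h : l2sq f < ⊤) : MemLp f 2 (volume : Measure (Space d)) := by
  refine ⟨hf, (eLpNorm_lt_top_iff_lintegral_rpow_enorm_lt_top (by norm_num) (by norm_num)).2 ?_⟩
  simpa [l2sq] using h

theorem IsTest.l2sq_lt_top {φ : Space d → ℂ} (hφ : IsTest φ) : l2sq φ < ⊤ := by
  rw [← enorm_sq_eq_l2sq (hφ.memLp 2).coeFn_toLp]
  exact ENNReal.pow_lt_top enorm_lt_top

theorem norm_le_of_l2sq_le {g h : L2 d} {f f' : Space d → ℂ} (hg : g =ᵐ[volume] f)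
    (hh : h =ᵐ[volume] f') {c : ℝ} (hc : 0 ≤ c) (hl : l2sq f ≤ ENNReal.ofReal (c ^ 2) * l2sq f') :
    ‖g‖ ≤ c * ‖h‖ := by
  rw [← enorm_sq_eq_l2sq hg, ← enorm_sq_eq_l2sq hh, enorm_sq_eq_ofReal, enorm_sq_eq_ofReal,
    ← ENNReal.ofReal_mul (by positivity), ENNReal.ofReal_le_ofReal_iff (by positivity),
    ← mul_pow] at hl
  exact le_of_sq_le_sq hl (by positivity)

theorem inner_eq_integral {g h : L2 d} {f f' : Space d → ℂ} (hg : g =ᵐ[volume] f)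
    (hh : h =ᵐ[volume] f') : ⟪g, h⟫_ℂ = ∫ x, (starRingEnd ℂ) (f x) * f' x := by
  rw [L2.inner_def]
  refine integral_congr_ae ?_
  filter_upwards [hg, hh] with x h1 h2
  rw [RCLike.inner_apply, h1, h2, mul_comm]

/-- The graph of the Hamiltonian on `C_c^∞`. -/
def hamGraph (A : Space d → Space d) (V : Space d → ℝ) : Submodule ℂ (L2 d × L2 d) :=
  testGraph (hamiltonianFun A V)
    (fun φ χ hφ hχ x => by
      simp only [hamiltonianFun, hφ.laplacian_sum hχ, hφ.fderiv_sum hχ, Pi.add_apply]; ring)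
    (fun c φ hφ x => by
      simp only [hamiltonianFun, hφ.laplacian_scale, hφ.fderiv_scale, Pi.smul_apply,
        smul_eq_mul]; ring)

/-- The graph of the current operator on `C_c^∞`. -/
def curGraph (A : Space d → Space d) (v : Space d) : Submodule ℂ (L2 d × L2 d) :=
  testGraph (currentFun A v)
    (fun φ χ hφ hχ x => by
      simp only [currentFun, hφ.fderiv_sum hχ, Pi.add_apply]; ring)
    (fun c φ hφ x => by
      simp only [currentFun, hφ.fderiv_scale, Pi.smul_apply, smul_eq_mul]; ring)

theorem dense_of_orthogonal_eq_zero {D : Submodule ℂ (L2 d)}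
    (h : ∀ f : L2 d, (∀ g ∈ D, ⟪f, g⟫_ℂ = 0) → f = 0) : Dense (D : Set (L2 d)) := by
  rw [Submodule.dense_iff_topologicalClosure_eq_top, Submodule.topologicalClosure_eq_top_iff,
    Submodule.eq_bot_iff]
  exact fun f hf => h f fun g hg => (Submodule.mem_orthogonal' D f).1 hf g hg

/-- The image of the test functions under `-½ Δ + e`. -/
def freeRange (d : ℕ) (e : ℝ) : Submodule ℂ (L2 d) where
  carrier := {g | ∃ φ : Space d → ℂ, IsTest φ ∧ g =ᵐ[volume] freeOp e φ}
  zero_mem' := ⟨0, IsTest.zero, by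
    have : freeOp e (0 : Space d → ℂ) = 0 := funext fun x =>
      freeOp_eq_zero_of_eventuallyEq e (Filter.EventuallyEq.refl _ _)
    rw [this]
    exact Lp.coeFn_zero _ _ _⟩
  add_mem' := by
    rintro p q ⟨φ, hφ, h1⟩ ⟨χ, hχ, h2⟩
    refine ⟨φ + χ, hφ.sum hχ, (Lp.coeFn_add _ _).trans ((h1.add h2).trans (.of_forall fun x => ?_))⟩
    simp only [Pi.add_apply, freeOp, hφ.laplacian_sum hχ]
    ring
  smul_mem' := by
    rintro c p ⟨φ, hφ, h1⟩
    refine ⟨c • φ, hφ.scale c,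
      (Lp.coeFn_smul _ _).trans ((h1.const_smul c).trans (.of_forall fun x => ?_))⟩
    simp only [Pi.smul_apply, freeOp, hφ.laplacian_scale, smul_eq_mul]
    ring

theorem dense_freeRange {e : ℝ} (he : 0 < e) : Dense (freeRange d e : Set (L2 d)) :=
  dense_of_orthogonal_eq_zero fun f hf => eq_zero_of_orthogonal_freeOp he f fun φ hφ =>
    hf _ ⟨φ, hφ, ((hφ.freeOp e).memLp 2).coeFn_toLp⟩

/-- The range of −½Δ + 1 on test functions is already known to be dense, and it consists of test
functions. -/
theorem dense_of_forall_test {D : Set (L2 d)}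
    (h : ∀ φ (hφ : IsTest φ), (hφ.memLp 2).toLp φ ∈ D) : Dense D := by
  refine (dense_freeRange (d := d) one_pos).mono ?_
  rintro g ⟨φ, hφ, hg⟩
  have : g = ((hφ.freeOp 1).memLp 2).toLp (freeOp 1 φ) :=
    Lp.ext (hg.trans ((hφ.freeOp 1).memLp 2).coeFn_toLp.symm)
  rw [this]
  exact h _ (hφ.freeOp 1)

theorem dirDeriv_conj (φ : Space d → ℂ) (v x : Space d) :
    dirDeriv v (fun x => (starRingEnd ℂ) (φ x)) x = (starRingEnd ℂ) (dirDeriv v φ x) :=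
  congrArg (fun L : Space d →L[ℝ] ℂ => L v) (Complex.conjCLE.comp_fderiv (f := φ) (x := x))

theorem laplacian_conj {φ : Space d → ℂ} (hφ : IsTest φ) (x : Space d) :
    Laplacian.laplacian (fun x => (starRingEnd ℂ) (φ x)) x =
      (starRingEnd ℂ) (Laplacian.laplacian φ x) := by
  rw [hφ.conj.laplacian_eq, hφ.laplacian_eq, map_sum]
  refine Finset.sum_congr rfl fun j _ => ?_
  rw [show dirDeriv (stdVec j) (fun x => (starRingEnd ℂ) (φ x)) =
    fun x => (starRingEnd ℂ) (dirDeriv (stdVec j) φ x) from funext (dirDeriv_conj φ _),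
    dirDeriv_conj]

/-- The Coulomb gauge condition for complex test functions. -/
theorem IsDivFree.integral_eq_zero {A : Space d → Space d} (hA : IsDivFree A) {φ : Space d → ℂ}
    (hφ : IsTest φ) (hi : Integrable fun x => fderiv ℝ φ x (A x)) :
    ∫ x, fderiv ℝ φ x (A x) = 0 := by
  have hre : IsTest fun x => (φ x).re :=
    ⟨Complex.reCLM.contDiff.comp hφ.1, hφ.2.comp_left Complex.zero_re⟩
  have him : IsTest fun x => (φ x).im :=
    ⟨Complex.imCLM.contDiff.comp hφ.1, hφ.2.comp_left Complex.zero_im⟩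
  have h1 : ∀ x v, fderiv ℝ (fun x => (φ x).re) x v = (fderiv ℝ φ x v).re := fun x v =>
    congrArg (fun L : Space d →L[ℝ] ℝ => L v)
      (Complex.reCLM.hasFDerivAt.comp x (hφ.differentiable x).hasFDerivAt).fderiv
  have h2 : ∀ x v, fderiv ℝ (fun x => (φ x).im) x v = (fderiv ℝ φ x v).im := fun x v =>
    congrArg (fun L : Space d →L[ℝ] ℝ => L v)
      (Complex.imCLM.hasFDerivAt.comp x (hφ.differentiable x).hasFDerivAt).fderiv
  have h3 := hA _ hre
  have h4 := hA _ him
  simp only [h1] at h3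
  simp only [h2] at h4
  apply Complex.ext
  · rw [Complex.zero_re, ← h3]
    exact (integral_re hi).symm
  · rw [Complex.zero_im, ← h4]
    exact (integral_im hi).symm

theorem aestronglyMeasurable_fderiv {A : Space d → Space d} (hA : AEStronglyMeasurable A volume)
    {φ : Space d → ℂ} (hφ : IsTest φ) :
    AEStronglyMeasurable (fun x => fderiv ℝ φ x (A x)) volume := by
  simp only [fderiv_eq_sum]
  refine Finset.aestronglyMeasurable_fun_sum _ fun j _ => ?_
  refine AEStronglyMeasurable.mul ?_ (hφ.dirDeriv _).continuous.aestronglyMeasurable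
  exact (Complex.continuous_ofReal.comp
    (EuclideanSpace.proj (𝕜 := ℝ) j).continuous).comp_aestronglyMeasurable hA

theorem isSymmRel_curGraph {A : Space d → Space d}
    (hJ : ∀ v φ, IsTest φ → MemLp (currentFun A v φ) 2 volume) (v : Space d) :
    IsSymmRel (curGraph A v) := by
  rintro p ⟨φ, hφ, hp1, hp2⟩ q ⟨χ, hχ, hq1, hq2⟩
  rw [inner_eq_integral hp2 hq1, inner_eq_integral hp1 hq2, ← sub_eq_zero,
    ← integral_sub (by exact (hJ v φ hφ).star.integrable_mul (hχ.memLp 2))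
      (by exact (hφ.conj.memLp 2).integrable_mul (hJ v χ hχ))]
  have h1 : ∀ x, (starRingEnd ℂ) (currentFun A v φ x) * χ x -
      (starRingEnd ℂ) (φ x) * currentFun A v χ x =
      -Complex.I * (dirDeriv v (fun x => (starRingEnd ℂ) (φ x)) x * χ x +
        (starRingEnd ℂ) (φ x) * dirDeriv v χ x) := by
    intro x
    simp only [currentFun, dirDeriv_conj, map_add, map_neg, map_mul, Complex.conj_I,
      Complex.conj_ofReal]
    simp only [dirDeriv]
    ring
  simp only [h1]
  have h2 := SchwartzMap.integral_mul_lineDerivOp_right_eq_neg_left (μ := volume)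
    hφ.conj.schwartz hχ.schwartz v
  simp only [IsTest.lineDeriv_schwartz, IsTest.schwartz_apply] at h2
  rw [integral_const_mul, integral_add (((hφ.conj.dirDeriv v).mul hχ).integrable)
    ((hφ.conj.mul (hχ.dirDeriv v)).integrable), h2]
  simp

/-- The two pairings differ by a Green identity for the Laplacian and by i∫ A·∇(φ̄χ), which the
Coulomb gauge condition annihilates. -/
theorem isSymmRel_hamGraph {A : Space d → Space d} {V : Space d → ℝ} (hdiv : IsDivFree A)
    (hH : ∀ φ, IsTest φ → MemLp (hamiltonianFun A V φ) 2 volume) :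
    IsSymmRel (hamGraph A V) := by
  rintro p ⟨φ, hφ, hp1, hp2⟩ q ⟨χ, hχ, hq1, hq2⟩
  have hi1 := (hH φ hφ).star.integrable_mul (hχ.memLp 2)
  have hi2 := (hφ.conj.memLp 2).integrable_mul (hH χ hχ)
  rw [inner_eq_integral hp2 hq1, inner_eq_integral hp1 hq2, ← sub_eq_zero,
    ← integral_sub (by exact hi1) (by exact hi2)]
  set φ' : Space d → ℂ := fun x => (starRingEnd ℂ) (φ x) with hφ'
  have ht : IsTest φ' := hφ.conj
  have h1 : ∀ x, (starRingEnd ℂ) (hamiltonianFun A V φ x) * χ x - φ' x * hamiltonianFun A V χ x =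
      1 / 2 * (φ' x * Laplacian.laplacian χ x - Laplacian.laplacian φ' x * χ x) +
        Complex.I * fderiv ℝ (fun x => φ' x * χ x) x (A x) := by
    intro x
    have h2 := dirDeriv_mul ht.1 hχ.1 (A x) x
    have h3 := dirDeriv_conj φ (A x) x
    rw [show fderiv ℝ (fun x => φ' x * χ x) x (A x) = _ from h2, hφ', h3, laplacian_conj hφ]
    simp only [hamiltonianFun, map_add, map_sub, map_neg, map_mul, Complex.conj_I,
      Complex.conj_ofReal, dirDeriv, map_div₀, map_one, map_ofNat]
    ring
  have hi3 : Integrable fun x =>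
      1 / 2 * (φ' x * Laplacian.laplacian χ x - Laplacian.laplacian φ' x * χ x) :=
    (((ht.mul hχ.laplacian).integrable.sub (ht.laplacian.mul hχ).integrable)).const_mul _
  -- Integrability of A·∇(φ̄χ) is read off from the identity `h1`, all of whose other terms are
  -- integrable.
  have hi4 : Integrable fun x => Complex.I * fderiv ℝ (fun x => φ' x * χ x) x (A x) := by
    refine ((hi1.sub hi2).sub hi3).congr (.of_forall fun x => ?_)
    have := h1 x
    simp only [Pi.sub_apply]
    exact sub_eq_of_eq_add' this
  have hi5 : Integrable fun x => fderiv ℝ (fun x => φ' x * χ x) x (A x) := by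
    refine (hi4.const_mul (-Complex.I)).congr (.of_forall fun x => ?_)
    simp only [← mul_assoc, neg_mul, Complex.I_mul_I, neg_neg, one_mul]
  refine (integral_congr_ae (.of_forall h1)).trans ?_
  rw [integral_add hi3 hi4, integral_const_mul, integral_const_mul,
    hdiv.integral_eq_zero (ht.mul hχ) hi5, integral_sub (ht.mul hχ.laplacian).integrable
      (ht.laplacian.mul hχ).integrable, ht.integral_mul_laplacian hχ]
  simp

theorem exists_tendsto_ae {u : ℕ → L2 d} {f : L2 d}
    (hu : Filter.Tendsto u Filter.atTop (nhds f)) : ∃ ns : ℕ → ℕ, StrictMono ns ∧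
      ∀ᵐ x, Filter.Tendsto (fun n => u (ns n) x) Filter.atTop (nhds (f x)) :=
  (tendstoInMeasure_of_tendsto_Lp hu).exists_seq_tendsto_ae

/-- Pointwise bounds pass to the closure of a graph. -/
theorem ae_norm_le_of_mem_closure {G : Submodule ℂ (L2 d × L2 d)} {e C : ℝ}
    (h : ∀ p ∈ G, ∀ᵐ x, ‖p.1 x‖ ≤ C * ‖p.2 + (e : ℂ) • p.1‖) {p : L2 d × L2 d}
    (hp : p ∈ G.topologicalClosure) : ∀ᵐ x, ‖p.1 x‖ ≤ C * ‖p.2 + (e : ℂ) • p.1‖ := by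
  obtain ⟨u, hu, hup⟩ := mem_closure_iff_seq_limit.1 hp
  obtain ⟨ns, hns, hae⟩ := exists_tendsto_ae ((continuous_fst.tendsto p).comp hup)
  have h2 : Filter.Tendsto (fun n => C * ‖(u (ns n)).2 + (e : ℂ) • (u (ns n)).1‖) Filter.atTop
      (nhds (C * ‖p.2 + (e : ℂ) • p.1‖)) :=
    ((show Continuous fun p : L2 d × L2 d => C * ‖p.2 + (e : ℂ) • p.1‖ by fun_prop).tendsto p).comp
      (hup.comp hns.tendsto_atTop)
  filter_upwards [hae, ae_all_iff.2 fun n => h (u (ns n)) (hu (ns n))] with x hx1 hx2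
  exact le_of_tendsto_of_tendsto' hx1.norm h2 hx2

theorem aestronglyMeasurable_fieldTerm {A : Space d → Space d} {V : Space d → ℝ}
    (hA : AEStronglyMeasurable A volume) (hV : AEStronglyMeasurable V volume) {φ : Space d → ℂ}
    (hφ : IsTest φ) : AEStronglyMeasurable (fieldTerm A V φ) volume := by
  refine ((aestronglyMeasurable_fderiv hA hφ).const_mul _).add (AEStronglyMeasurable.mul ?_
    hφ.continuous.aestronglyMeasurable)
  exact Complex.continuous_ofReal.comp_aestronglyMeasurable
    (((hA.norm.pow 2).const_mul (1 / 2)).add hV)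

theorem aestronglyMeasurable_currentFun {A : Space d → Space d}
    (hA : AEStronglyMeasurable A volume) (v : Space d) {φ : Space d → ℂ} (hφ : IsTest φ) :
    AEStronglyMeasurable (currentFun A v φ) volume := by
  refine (((hφ.dirDeriv v).continuous.aestronglyMeasurable.const_mul _).add
    (AEStronglyMeasurable.mul ?_ hφ.continuous.aestronglyMeasurable)).neg
  exact Complex.continuous_ofReal.comp_aestronglyMeasurable (hA.inner aestronglyMeasurable_const)

/-! ### Perturbation theory for H + e. -/

section Bounded

variable {A : Space d → Space d} {V : Space d → ℝ} {e : ℝ} (he : 1 ≤ e)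
  (hq : ∀ φ : Space d → ℂ, IsTest φ → l2sq (fieldTerm A V φ) ≤ 1 / 4 * l2sq (freeOp e φ))

include hq

theorem memLp_hamiltonianFun_of_le (hA : AEStronglyMeasurable A volume)
    (hV : AEStronglyMeasurable V volume) {φ : Space d → ℂ} (hφ : IsTest φ) :
    MemLp (hamiltonianFun A V φ) 2 volume := by
  have h1 : MemLp (fieldTerm A V φ) 2 volume := by
    refine memLp_of_l2sq_lt_top (aestronglyMeasurable_fieldTerm hA hV hφ) ((hq φ hφ).trans_lt ?_)
    exact ENNReal.mul_lt_top (by simp) (hφ.freeOp e).l2sq_lt_top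
  have h2 := (((hφ.freeOp e).memLp 2).add h1).sub ((hφ.memLp 2).const_mul (e : ℂ))
  refine h2.ae_eq (.of_forall fun x => ?_)
  have := hamiltonianFun_add A V φ e x
  simp only [Pi.sub_apply, Pi.add_apply]
  linear_combination -this

/-- H + e differs from −½Δ + e by the field terms, of relative norm at most 1/2 (the square root of
1/4), so the two operators have comparable norms on test functions and every bound for the free one
transfers. -/
theorem exists_norm_sub_free_le {p : L2 d × L2 d} (hp : p ∈ hamGraph A V) :
    ∃ φ : Space d → ℂ, ∃ hφ : IsTest φ, p.1 =ᵐ[volume] φ ∧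
      ‖p.2 + (e : ℂ) • p.1 - ((hφ.freeOp e).memLp 2).toLp (freeOp e φ)‖ ≤
        1 / 2 * ‖((hφ.freeOp e).memLp 2).toLp (freeOp e φ)‖ ∧
      ‖((hφ.freeOp e).memLp 2).toLp (freeOp e φ)‖ ≤ 2 * ‖p.2 + (e : ℂ) • p.1‖ := by
  obtain ⟨φ, hφ, h1, h2⟩ := hp
  set F := ((hφ.freeOp e).memLp 2).toLp (freeOp e φ) with hF
  have hFae : F =ᵐ[volume] freeOp e φ := ((hφ.freeOp e).memLp 2).coeFn_toLp
  have h3 : (p.2 + (e : ℂ) • p.1 - F : L2 d) =ᵐ[volume] fieldTerm A V φ := by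
    filter_upwards [h1, h2, hFae, Lp.coeFn_sub (p.2 + (e : ℂ) • p.1) F,
      Lp.coeFn_add p.2 ((e : ℂ) • p.1), Lp.coeFn_smul (e : ℂ) p.1] with x x1 x2 x3 x4 x5 x6
    rw [x4, Pi.sub_apply, x5, Pi.add_apply, x6, Pi.smul_apply, x1, x2, x3, smul_eq_mul,
      hamiltonianFun_add, add_sub_cancel_left]
  have h4 : ‖p.2 + (e : ℂ) • p.1 - F‖ ≤ 1 / 2 * ‖F‖ := by
    refine norm_le_of_l2sq_le h3 hFae (by norm_num) ((hq φ hφ).trans_eq ?_)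
    congr 1
    rw [show ((1 / 2 : ℝ) ^ 2) = 1 / 4 by norm_num, ENNReal.ofReal_div_of_pos (by norm_num)]
    norm_num
  refine ⟨φ, hφ, h1, h4, ?_⟩
  have h5 := norm_sub_norm_le F (p.2 + (e : ℂ) • p.1)
  rw [norm_sub_rev] at h5
  linarith

include he in
theorem norm_fst_le {p : L2 d × L2 d} (hp : p ∈ hamGraph A V) :
    1 / 2 * ‖p.1‖ ≤ ‖p.2 + (e : ℂ) • p.1‖ := by
  obtain ⟨φ, hφ, h1, -, h3⟩ := exists_norm_sub_free_le hq hp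
  have h4 : ‖p.1‖ ≤ 1 * ‖((hφ.freeOp e).memLp 2).toLp (freeOp e φ)‖ := by
    refine norm_le_of_l2sq_le h1 ((hφ.freeOp e).memLp 2).coeFn_toLp zero_le_one ?_
    rw [one_pow, ENNReal.ofReal_one, one_mul]
    exact l2sq_le_of_le_one (one_le_pow₀ he) (l2sq_mul_le_freeOp hφ (zero_le_one.trans he))
  linarith

include he in
theorem ae_norm_fst_le (hs : supConst d e ≤ 1) {p : L2 d × L2 d} (hp : p ∈ hamGraph A V) :
    ∀ᵐ x, ‖p.1 x‖ ≤ 2 * ‖p.2 + (e : ℂ) • p.1‖ := by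
  obtain ⟨φ, hφ, h1, -, h3⟩ := exists_norm_sub_free_le hq hp
  filter_upwards [h1] with x hx
  rw [hx]
  refine le_trans ?_ h3
  have h4 := enorm_sq_le_supConst hφ (zero_lt_one.trans_le he) x
  have h5 : ‖φ x‖ₑ ^ 2 ≤ ‖((hφ.freeOp e).memLp 2).toLp (freeOp e φ)‖ₑ ^ 2 := by
    rw [enorm_sq_eq_l2sq ((hφ.freeOp e).memLp 2).coeFn_toLp]
    refine h4.trans ?_
    calc supConst d e * l2sq (freeOp e φ) ≤ 1 * l2sq (freeOp e φ) := by gcongr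
      _ = _ := one_mul _
  rw [enorm_sq_eq_ofReal, enorm_sq_eq_ofReal, ENNReal.ofReal_le_ofReal_iff (by positivity)] at h5
  exact le_of_sq_le_sq h5 (norm_nonneg _)

theorem exists_current_le {v : Space d} {C : ENNReal} (hC : C < ⊤)
    (hJ : ∀ φ : Space d → ℂ, IsTest φ → l2sq (currentFun A v φ) ≤ C * l2sq (freeOp e φ))
    (hA : AEStronglyMeasurable A volume) {p : L2 d × L2 d} (hp : p ∈ hamGraph A V) :
    ∃ j, (p.1, j) ∈ curGraph A v ∧
      ‖j‖ ≤ 2 * Real.sqrt C.toReal * ‖p.2 + (e : ℂ) • p.1‖ := by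
  obtain ⟨φ, hφ, h1, -, h3⟩ := exists_norm_sub_free_le hq hp
  have h2 : MemLp (currentFun A v φ) 2 volume :=
    memLp_of_l2sq_lt_top (aestronglyMeasurable_currentFun hA v hφ)
      ((hJ φ hφ).trans_lt (ENNReal.mul_lt_top hC (hφ.freeOp e).l2sq_lt_top))
  refine ⟨h2.toLp _, ⟨φ, hφ, h1, h2.coeFn_toLp⟩, ?_⟩
  have h4 : ‖h2.toLp _‖ ≤ Real.sqrt C.toReal * ‖((hφ.freeOp e).memLp 2).toLp (freeOp e φ)‖ := by
    refine norm_le_of_l2sq_le h2.coeFn_toLp ((hφ.freeOp e).memLp 2).coeFn_toLp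
      (Real.sqrt_nonneg _) ?_
    rw [Real.sq_sqrt ENNReal.toReal_nonneg, ENNReal.ofReal_toReal hC.ne]
    exact hJ φ hφ
  have := mul_le_mul_of_nonneg_left h3 (Real.sqrt_nonneg C.toReal)
  linarith

include he in
-- If f is orthogonal to the range of H + e, replacing H + e by the free operator costs at most half
-- of the norm: ‖f‖² ≤ ‖f‖‖f − F‖ + ½‖f‖‖F‖ for F in the free range. That range is dense, so F = f
-- is allowed and f = 0.
theorem dense_range_hamGraph (hA : AEStronglyMeasurable A volume)
    (hV : AEStronglyMeasurable V volume) :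
    Dense {f | ∃ p ∈ hamGraph A V, p.2 + (e : ℂ) • p.1 = f} := by
  set D : Submodule ℂ (L2 d) := (hamGraph A V).map
    (LinearMap.snd ℂ (L2 d) (L2 d) + (e : ℂ) • LinearMap.fst ℂ (L2 d) (L2 d)) with hD
  have hDd : Dense (D : Set (L2 d)) := by
    refine dense_of_orthogonal_eq_zero fun f hf => ?_
    have key : ∀ F ∈ freeRange d e, ‖f‖ ^ 2 ≤ ‖f‖ * ‖f - F‖ + 1 / 2 * (‖f‖ * ‖F‖) := by
      rintro F ⟨φ, hφ, hF⟩
      set p : L2 d × L2 d := ((hφ.memLp 2).toLp φ,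
        (memLp_hamiltonianFun_of_le hq hA hV hφ).toLp _) with hp
      have hpG : p ∈ hamGraph A V := ⟨φ, hφ, (hφ.memLp 2).coeFn_toLp,
        (memLp_hamiltonianFun_of_le hq hA hV hφ).coeFn_toLp⟩
      obtain ⟨φ', hφ', h1, h2, -⟩ := exists_norm_sub_free_le hq hpG
      have h3 : φ' = φ := (Continuous.ae_eq_iff_eq volume hφ'.continuous hφ.continuous).1
        (h1.symm.trans (hφ.memLp 2).coeFn_toLp)
      subst h3
      have h4 : F = ((hφ.freeOp e).memLp 2).toLp (freeOp e φ') :=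
        Lp.ext (hF.trans (MemLp.coeFn_toLp _).symm)
      rw [← h4] at h2
      have h5 : ⟪f, p.2 + (e : ℂ) • p.1⟫_ℂ = 0 := hf _ ⟨p, hpG, rfl⟩
      have h6 : ⟪f, f⟫_ℂ = ⟪f, f - F⟫_ℂ - ⟪f, p.2 + (e : ℂ) • p.1 - F⟫_ℂ := by
        rw [← inner_sub_right, sub_sub_sub_cancel_right, inner_sub_right, h5, sub_zero]
      have h7 : ‖f‖ ^ 2 = ‖⟪f, f⟫_ℂ‖ := by
        rw [inner_self_eq_norm_sq_to_K]
        simp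
      rw [h7, h6]
      refine (norm_sub_le _ _).trans (add_le_add (norm_inner_le_norm _ _) ?_)
      refine (norm_inner_le_norm _ _).trans ?_
      have := mul_le_mul_of_nonneg_left h2 (norm_nonneg f)
      linarith
    have hcl : ∀ F : L2 d, ‖f‖ ^ 2 ≤ ‖f‖ * ‖f - F‖ + 1 / 2 * (‖f‖ * ‖F‖) := fun F =>
      (dense_freeRange (d := d) (zero_lt_one.trans_le he)).induction
        (P := fun F => ‖f‖ ^ 2 ≤ ‖f‖ * ‖f - F‖ + 1 / 2 * (‖f‖ * ‖F‖)) (fun F hF => key F hF)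
        (isClosed_le (by fun_prop) (by fun_prop)) F
    have h8 := hcl f
    rw [sub_self, norm_zero, mul_zero, zero_add] at h8
    have h9 : ‖f‖ = 0 := by nlinarith [norm_nonneg f]
    exact norm_eq_zero.1 h9
  refine hDd.mono ?_
  rintro f ⟨p, hp, rfl⟩
  exact ⟨p, hp, rfl⟩

end Bounded

/-- The regularity properties of the Hamiltonian and of the current operator. -/
theorem exists_hamiltonian_bounds (hd : d ≤ 3) {R : Submodule ℤ (Space d)} [DiscreteTopology R]
    [IsZLattice ℝ R] {Ω : Set (Space d)} (hΩ : IsUnitCell R Ω) {A : Space d → Space d}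
    (hA : IsPeriodicLp R 4 A) {V : Space d → ℝ} (hV : IsPeriodicLp R 2 V) (hdiv : IsDivFree A) :
    ∃ e₀ : ℝ, (∀ e, e₀ ≤ e →
      (∀ p ∈ hamGraph A V, 1 / 2 * ‖p.1‖ ≤ ‖p.2 + (e : ℂ) • p.1‖) ∧
      (∀ p ∈ hamGraph A V, ∀ᵐ x, ‖p.1 x‖ ≤ 2 * ‖p.2 + (e : ℂ) • p.1‖) ∧
      Dense {f | ∃ p ∈ hamGraph A V, p.2 + (e : ℂ) • p.1 = f} ∧
      ∀ v, ∃ C : ℝ, ∀ p ∈ hamGraph A V, ∃ j, (p.1, j) ∈ curGraph A v ∧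
        ‖j‖ ≤ C * ‖p.2 + (e : ℂ) • p.1‖) ∧
      IsSymmRel (hamGraph A V) ∧ Dense {x | ∃ y, (x, y) ∈ hamGraph A V} ∧
      ∀ v, IsSymmRel (curGraph A v) ∧ Dense {x | ∃ y, (x, y) ∈ curGraph A v} := by
  obtain ⟨e₀, he₀, h⟩ := exists_l2sq_fieldTerm_le_quarter hΩ hA hV hd
  have hAm := hA.aestronglyMeasurable
  have hVm := hV.aestronglyMeasurable
  have hJ : ∀ v φ, IsTest φ → MemLp (currentFun A v φ) 2 volume := by
    intro v φ hφ
    obtain ⟨C, hC, hb⟩ := exists_l2sq_currentFun_le hΩ hA v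
    exact memLp_of_l2sq_lt_top (aestronglyMeasurable_currentFun hAm v hφ)
      ((hb e₀ he₀ (h e₀ le_rfl).1 φ hφ).trans_lt
        (ENNReal.mul_lt_top hC (hφ.freeOp e₀).l2sq_lt_top))
  have hH : ∀ φ, IsTest φ → MemLp (hamiltonianFun A V φ) 2 volume := fun φ hφ =>
    memLp_hamiltonianFun_of_le (h e₀ le_rfl).2 hAm hVm hφ
  refine ⟨e₀, fun e he => ?_, isSymmRel_hamGraph hdiv hH, dense_of_forall_test fun φ hφ =>
    ⟨(hH φ hφ).toLp _, φ, hφ, (hφ.memLp 2).coeFn_toLp, (hH φ hφ).coeFn_toLp⟩, fun v =>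
    ⟨isSymmRel_curGraph hJ v, dense_of_forall_test fun φ hφ =>
      ⟨(hJ v φ hφ).toLp _, φ, hφ, (hφ.memLp 2).coeFn_toLp, (hJ v φ hφ).coeFn_toLp⟩⟩⟩
  obtain ⟨hs, hq⟩ := h e he
  have he1 := he₀.trans he
  refine ⟨fun p hp => norm_fst_le he1 hq hp, fun p hp => ae_norm_fst_le he1 hq hs hp,
    dense_range_hamGraph he1 hq hAm hVm, fun v => ?_⟩
  obtain ⟨C, hC, hb⟩ := exists_l2sq_currentFun_le hΩ hA v
  exact ⟨_, fun p hp => exists_current_le hq hC (hb e he1 hs) hAm hp⟩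

/-! ### Multiplication operators and translations -/

theorem coeFn_mulOp {χ : Space d → ℂ} (hχ : MemLp χ ⊤ (volume : Measure (Space d))) (ψ : L2 d) :
    mulOp χ ψ =ᵐ[volume] fun x => χ x * ψ x := by
  rw [mulOp, dif_pos hχ, ContinuousLinearMap.holderL_apply_apply]
  filter_upwards [ContinuousLinearMap.coeFn_holder (r := 2) (ContinuousLinearMap.mul ℂ ℂ)
    (hχ.toLp χ) ψ, hχ.coeFn_toLp] with x h1 h2
  rw [h1, h2]
  rfl

theorem adjoint_mulOp {χ : Space d → ℂ} (hχ : MemLp χ ⊤ (volume : Measure (Space d))) :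
    ContinuousLinearMap.adjoint (mulOp χ) = mulOp fun x => (starRingEnd ℂ) (χ x) := by
  have hχ' : MemLp (fun x => (starRingEnd ℂ) (χ x)) ⊤ (volume : Measure (Space d)) := hχ.star
  symm
  rw [ContinuousLinearMap.eq_adjoint_iff]
  intro f g
  rw [L2.inner_def, L2.inner_def]
  refine integral_congr_ae ?_
  filter_upwards [coeFn_mulOp hχ' f, coeFn_mulOp hχ g] with x h1 h2
  rw [h1, h2, RCLike.inner_apply, RCLike.inner_apply, map_mul, Complex.conj_conj]
  ring

theorem commute_mulOp {χ η : Space d → ℂ} (hχ : MemLp χ ⊤ (volume : Measure (Space d)))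
    (hη : MemLp η ⊤ (volume : Measure (Space d))) : Commute (mulOp χ) (mulOp η) := by
  ext1 ψ
  refine Lp.ext ?_
  filter_upwards [coeFn_mulOp hχ (mulOp η ψ), coeFn_mulOp hη ψ, coeFn_mulOp hη (mulOp χ ψ),
    coeFn_mulOp hχ ψ] with x h1 h2 h3 h4
  refine h1.trans (Eq.trans ?_ h3.symm)
  rw [h2, h4]
  ring

theorem ae_comp_sub {P : Space d → Prop} (r : Space d) (h : ∀ᵐ x, P x) : ∀ᵐ x, P (x - r) :=
  (measurePreserving_sub_right volume r).quasiMeasurePreserving.ae h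

theorem coeFn_translation (r : Space d) (ψ : L2 d) :
    translation r ψ =ᵐ[volume] fun x => ψ (x - r) :=
  Lp.coeFn_compMeasurePreserving ψ (measurePreserving_sub_right volume r)

theorem translation_translation (r s : Space d) (ψ : L2 d) :
    translation r (translation s ψ) = translation (r + s) ψ := by
  refine Lp.ext ?_
  filter_upwards [coeFn_translation r (translation s ψ), ae_comp_sub r (coeFn_translation s ψ),
    coeFn_translation (r + s) ψ] with x h1 h2 h3
  rw [h1, h2, h3, sub_sub]

theorem translation_zero (ψ : L2 d) : translation (0 : Space d) ψ = ψ := by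
  refine Lp.ext ?_
  filter_upwards [coeFn_translation 0 ψ] with x h1
  rw [h1, sub_zero]

theorem inner_translation (r : Space d) (f g : L2 d) :
    ⟪translation r f, translation r g⟫_ℂ = ⟪f, g⟫_ℂ :=
  (Lp.compMeasurePreservingₗᵢ ℂ (fun x : Space d => x - r)
    (measurePreserving_sub_right volume r)).inner_map_map f g

theorem adjoint_translation (r : Space d) :
    ContinuousLinearMap.adjoint (translation r : L2 d →L[ℂ] L2 d) = translation (-r) := by
  symm
  rw [ContinuousLinearMap.eq_adjoint_iff]
  intro f g
  rw [← inner_translation r, translation_translation, add_neg_cancel, translation_zero]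

theorem map_mem_topologicalClosure {G : Submodule ℂ (L2 d × L2 d)} (W : L2 d →L[ℂ] L2 d)
    (h : ∀ p ∈ G, (W p.1, W p.2) ∈ G) {p : L2 d × L2 d} (hp : p ∈ G.topologicalClosure) :
    (W p.1, W p.2) ∈ G.topologicalClosure :=
  map_mem_closure (f := fun p : L2 d × L2 d => (W p.1, W p.2)) (by fun_prop) hp
    fun p hp => h p hp

section Periodic

variable {R : Submodule ℤ (Space d)} {A : Space d → Space d} {V : Space d → ℝ}

theorem IsPeriodicLp.ae_sub {F : Type*} [NormedAddCommGroup F] {p : ENNReal} {f : Space d → F}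
    (hf : IsPeriodicLp R p f) {r : Space d} (hr : r ∈ R) : ∀ᵐ x, f (x - r) = f x := by
  filter_upwards [hf.1 (-r) (R.neg_mem hr)] with x hx
  rwa [← sub_eq_add_neg] at hx

theorem translation_mem_hamGraph (hA : IsPeriodicLp R 4 A) (hV : IsPeriodicLp R 2 V)
    {r : Space d} (hr : r ∈ R) {p : L2 d × L2 d} (hp : p ∈ hamGraph A V) :
    (translation r p.1, translation r p.2) ∈ hamGraph A V := by
  obtain ⟨φ, hφ, h1, h2⟩ := hp
  refine ⟨fun x => φ (x + -r), hφ.translate (-r), ?_, ?_⟩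
  · filter_upwards [coeFn_translation r p.1, ae_comp_sub r h1] with x h3 h4
    rw [h3, h4, sub_eq_add_neg]
  · filter_upwards [coeFn_translation r p.2, ae_comp_sub r h2, hA.ae_sub hr, hV.ae_sub hr]
      with x h3 h4 h5 h6
    rw [h3, h4]
    rw [hamiltonianFun, h5, h6]
    simp only [hamiltonianFun, laplacian_translate hφ.1, fderiv_comp_add_right,
      sub_eq_add_neg x r]

theorem translation_mem_curGraph (hA : IsPeriodicLp R 4 A) (v : Space d)
    {r : Space d} (hr : r ∈ R) {p : L2 d × L2 d} (hp : p ∈ curGraph A v) :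
    (translation r p.1, translation r p.2) ∈ curGraph A v := by
  obtain ⟨φ, hφ, h1, h2⟩ := hp
  refine ⟨fun x => φ (x + -r), hφ.translate (-r), ?_, ?_⟩
  · filter_upwards [coeFn_translation r p.1, ae_comp_sub r h1] with x h3 h4
    rw [h3, h4, sub_eq_add_neg]
  · filter_upwards [coeFn_translation r p.2, ae_comp_sub r h2, hA.ae_sub hr] with x h3 h4 h5
    rw [h3, h4]
    rw [currentFun, h5]
    simp only [currentFun, fderiv_comp_add_right, sub_eq_add_neg x r]

end Periodic

/-! ### Gauge transformations -/

/-- The plane wave `e^{i s v · x}`. -/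
def gaugeFun (v : Space d) (s : ℝ) (x : Space d) : ℂ :=
  Complex.exp (((s * ⟪v, x⟫_ℝ : ℝ) : ℂ) * Complex.I)

theorem norm_gaugeFun (v : Space d) (s : ℝ) (x : Space d) : ‖gaugeFun v s x‖ = 1 :=
  Complex.norm_exp_ofReal_mul_I _

theorem contDiff_gaugeFun (v : Space d) (s : ℝ) : ContDiff ℝ ∞ (gaugeFun v s) := by
  have h1 : ContDiff ℝ ∞ fun x : Space d => s * ⟪v, x⟫_ℝ :=
    contDiff_const.mul ((innerSL ℝ v).contDiff)
  exact ((Complex.ofRealCLM.contDiff.comp h1).mul contDiff_const).cexp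

theorem memLp_gaugeFun (v : Space d) (s : ℝ) :
    MemLp (gaugeFun v s) ⊤ (volume : Measure (Space d)) :=
  memLp_top_of_bound (contDiff_gaugeFun v s).continuous.aestronglyMeasurable 1
    (.of_forall fun x => (norm_gaugeFun v s x).le)

theorem dirDeriv_gaugeFun (v : Space d) (s : ℝ) (w x : Space d) :
    dirDeriv w (gaugeFun v s) x = s * ⟪v, w⟫_ℝ * Complex.I * gaugeFun v s x := by
  have h1 : HasFDerivAt (fun x : Space d => s * ⟪v, x⟫_ℝ) (s • innerSL ℝ v) x :=
    ((innerSL ℝ v).hasFDerivAt).const_mul s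
  have h2 := ((Complex.ofRealCLM.hasFDerivAt.comp x h1).mul_const Complex.I).cexp
  have h3 := h2.fderiv
  rw [dirDeriv, show gaugeFun v s = fun x => Complex.exp
    ((Complex.ofRealCLM ∘ fun x : Space d => s * ⟪v, x⟫_ℝ) x * Complex.I) from rfl, h3]
  simp
  ring

theorem sum_inner_mul_dirDeriv (φ : Space d → ℂ) (v x : Space d) :
    ∑ j, (⟪v, stdVec j⟫_ℝ : ℂ) * dirDeriv (stdVec j) φ x = dirDeriv v φ x := by
  rw [dirDeriv, fderiv_eq_sum]
  refine Finset.sum_congr rfl fun j _ => ?_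
  congr 2
  rw [stdVec, real_inner_comm]
  simp [EuclideanSpace.inner_single_left]

theorem laplacian_gaugeFun (v : Space d) (s : ℝ) (x : Space d) :
    Laplacian.laplacian (gaugeFun v s) x = -(s ^ 2 * ‖v‖ ^ 2 : ℝ) * gaugeFun v s x := by
  rw [laplacian_eq_sum_dirDeriv (contDiff_gaugeFun v s)]
  have h1 : ∀ j, dirDeriv (stdVec j) (dirDeriv (stdVec j) (gaugeFun v s)) x =
      s * ⟪v, stdVec j⟫_ℝ * Complex.I * (s * ⟪v, stdVec j⟫_ℝ * Complex.I * gaugeFun v s x) := by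
    intro j
    rw [show dirDeriv (stdVec j) (gaugeFun v s) =
      (s * ⟪v, stdVec j⟫_ℝ * Complex.I : ℂ) • gaugeFun v s from
        funext fun y => dirDeriv_gaugeFun v s _ y]
    rw [dirDeriv, fderiv_const_smul ((contDiff_gaugeFun v s).differentiable (by simp) x)]
    exact congrArg (fun z => (s * ⟪v, stdVec j⟫_ℝ * Complex.I : ℂ) * z)
      (dirDeriv_gaugeFun v s (stdVec j) x)
  rw [Finset.sum_congr rfl fun j _ => h1 j, ← sum_inner_sq v]
  push_cast
  rw [Finset.mul_sum, ← Finset.sum_neg_distrib, Finset.sum_mul]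
  refine Finset.sum_congr rfl fun j _ => ?_
  linear_combination (s ^ 2 * ⟪v, stdVec j⟫_ℝ ^ 2 * gaugeFun v s x : ℂ) * Complex.I_mul_I

/-- The plane wave shifts −i∇ + A by s v. Expanding the square yields a cross term s v·(−i∇ + A),
which is −sJ, and the scalar s²|v|²/2. -/
theorem hamiltonianFun_gauge (A : Space d → Space d) (V : Space d → ℝ) (v : Space d) (s : ℝ)
    {φ : Space d → ℂ} (hφ : IsTest φ) (x : Space d) :
    hamiltonianFun A V (fun x => gaugeFun v s x * φ x) x =
      gaugeFun v s x * (hamiltonianFun A V φ x - s * currentFun A v φ x +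
        (s ^ 2 * (‖v‖ ^ 2 / 2) : ℝ) * φ x) := by
  have h1 := dirDeriv_mul (contDiff_gaugeFun v s) hφ.1 (A x) x
  have h2 := laplacian_mul (contDiff_gaugeFun v s) hφ.1 x
  have h3 : ∑ j, dirDeriv (stdVec j) (gaugeFun v s) x * dirDeriv (stdVec j) φ x =
      s * Complex.I * gaugeFun v s x * dirDeriv v φ x := by
    rw [← sum_inner_mul_dirDeriv φ v x, Finset.mul_sum]
    refine Finset.sum_congr rfl fun j _ => ?_
    rw [dirDeriv_gaugeFun]
    ring
  rw [h3, laplacian_gaugeFun] at h2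
  rw [dirDeriv_gaugeFun] at h1
  simp only [hamiltonianFun, currentFun]
  rw [h2, show fderiv ℝ (fun x => gaugeFun v s x * φ x) x (A x) = _ from h1]
  simp only [dirDeriv, real_inner_comm v (A x)]
  push_cast
  linear_combination (-(s * ⟪v, A x⟫_ℝ * gaugeFun v s x * φ x) : ℂ) * Complex.I_mul_I

theorem gauge_mem_hamGraph {A : Space d → Space d} {V : Space d → ℝ} (v : Space d) (s : ℝ)
    {p : L2 d × L2 d} (hp : p ∈ hamGraph A V) {g : L2 d} (hg : (p.1, g) ∈ curGraph A v) :
    (mulOp (gaugeFun v s) p.1, mulOp (gaugeFun v s)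
      (p.2 - (s : ℂ) • g + ((s ^ 2 * (‖v‖ ^ 2 / 2) : ℝ) : ℂ) • p.1)) ∈ hamGraph A V := by
  obtain ⟨φ, hφ, h1, h2⟩ := hp
  obtain ⟨φ', hφ', h1', h3⟩ := hg
  -- Two continuous functions that agree almost everywhere coincide, so both graphs use the same
  -- test function.
  have h4 : φ' = φ := (Continuous.ae_eq_iff_eq volume hφ'.continuous hφ.continuous).1
    (h1'.symm.trans h1)
  subst h4
  refine ⟨fun x => gaugeFun v s x * φ' x, hφ.smooth_mul (contDiff_gaugeFun v s), ?_, ?_⟩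
  · filter_upwards [coeFn_mulOp (memLp_gaugeFun v s) p.1, h1] with x h5 h6
    rw [h5, h6]
  · set c : ℂ := ((s ^ 2 * (‖v‖ ^ 2 / 2) : ℝ) : ℂ) with hc
    filter_upwards [coeFn_mulOp (memLp_gaugeFun v s) (p.2 - (s : ℂ) • g + c • p.1), h1, h2, h3,
      Lp.coeFn_add (p.2 - (s : ℂ) • g) (c • p.1), Lp.coeFn_sub p.2 ((s : ℂ) • g),
      Lp.coeFn_smul (s : ℂ) g, Lp.coeFn_smul c p.1] with x x1 x2 x3 x4 x5 x6 x7 x8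
    rw [x1, x5, Pi.add_apply, x6, Pi.sub_apply, x7, x8, Pi.smul_apply, Pi.smul_apply, x2, x3, x4,
      hamiltonianFun_gauge A V v s hφ, smul_eq_mul, smul_eq_mul]

/-- The gauge transformation of the closure of the Hamiltonian. -/
theorem gauge_mem_topologicalClosure {A : Space d → Space d} {V : Space d → ℝ} {v : Space d}
    (hsymm : IsSymmRel (curGraph A v)) (hdense : Dense {x | ∃ y, (x, y) ∈ curGraph A v})
    {e C : ℝ} (hC : ∀ p ∈ hamGraph A V, ∃ j, (p.1, j) ∈ curGraph A v ∧
      ‖j‖ ≤ C * ‖p.2 + (e : ℂ) • p.1‖)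
    {ψ f : L2 d} (hψ : (ψ, f) ∈ (hamGraph A V).topologicalClosure) :
    ∃ g, (ψ, g) ∈ (curGraph A v).topologicalClosure ∧ ‖g‖ ≤ C * ‖f + (e : ℂ) • ψ‖ ∧
      ∀ s : ℝ, (mulOp (gaugeFun v s) ψ, mulOp (gaugeFun v s)
        (f - (s : ℂ) • g + ((s ^ 2 * (‖v‖ ^ 2 / 2) : ℝ) : ℂ) • ψ)) ∈
          (hamGraph A V).topologicalClosure := by
  -- Relative boundedness makes the currents of an approximating sequence converge too, so the
  -- identity on test functions passes to the limit, with the same g for all s.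
  obtain ⟨u, w, g, hu, hw, hlim, hlim', hg⟩ :=
    exists_seq_of_relatively_bounded (hsymm.eq_zero hdense) hC hψ
  have h1 : Filter.Tendsto (fun n => (u n).1) Filter.atTop (nhds ψ) :=
    (continuous_fst.tendsto _).comp hlim
  have h2 : Filter.Tendsto (fun n => (u n).2) Filter.atTop (nhds f) :=
    (continuous_snd.tendsto _).comp hlim
  refine ⟨g, mem_closure_of_tendsto (h1.prodMk_nhds hlim') (.of_forall hw), hg, fun s => ?_⟩
  refine mem_closure_of_tendsto (f := fun n => (mulOp (gaugeFun v s) (u n).1,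
    mulOp (gaugeFun v s) ((u n).2 - (s : ℂ) • w n +
      ((s ^ 2 * (‖v‖ ^ 2 / 2) : ℝ) : ℂ) • (u n).1))) (b := Filter.atTop) ?_
    (.of_forall fun n => gauge_mem_hamGraph v s (hu n) (hw n))
  refine Filter.Tendsto.prodMk_nhds (((mulOp (gaugeFun v s)).continuous.tendsto _).comp h1) ?_
  exact ((mulOp (gaugeFun v s)).continuous.tendsto _).comp
    ((h2.sub (hlim'.const_smul _)).add (h1.const_smul _))

theorem mulOp_gaugeFun_mul (v : Space d) (s : ℝ) :
    mulOp (gaugeFun v s) * ContinuousLinearMap.adjoint (mulOp (gaugeFun v s)) = 1 := by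
  have h1 := memLp_gaugeFun v s
  rw [adjoint_mulOp h1]
  ext1 ψ
  refine Lp.ext ?_
  filter_upwards [coeFn_mulOp h1 (mulOp (fun x => (starRingEnd ℂ) (gaugeFun v s x)) ψ),
    coeFn_mulOp (χ := fun x => (starRingEnd ℂ) (gaugeFun v s x)) h1.star ψ] with x h2 h3
  refine h2.trans ?_
  rw [h3, ← mul_assoc, Complex.mul_conj, Complex.normSq_eq_norm_sq, norm_gaugeFun]
  simp

theorem adjoint_mul_mulOp_gaugeFun (v : Space d) (s : ℝ) :
    ContinuousLinearMap.adjoint (mulOp (gaugeFun v s)) * mulOp (gaugeFun v s) = 1 := by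
  have h1 := memLp_gaugeFun v s
  rw [← mulOp_gaugeFun_mul v s, adjoint_mulOp h1]
  exact (commute_mulOp h1.star h1).eq

theorem translation_mul_mulOp_gaugeFun (v r : Space d) (s : ℝ) :
    translation r * mulOp (gaugeFun v s) =
      gaugeFun v s (-r) • (mulOp (gaugeFun v s) * translation r) := by
  ext1 ψ
  refine Lp.ext ?_
  have h1 := memLp_gaugeFun v s
  filter_upwards [coeFn_translation r (mulOp (gaugeFun v s) ψ),
    ae_comp_sub r (coeFn_mulOp h1 ψ), coeFn_mulOp h1 (translation r ψ), coeFn_translation r ψ,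
    Lp.coeFn_smul (gaugeFun v s (-r)) (mulOp (gaugeFun v s) (translation r ψ))]
    with x h2 h3 h4 h5 h6
  refine (h2.trans h3).trans (Eq.trans ?_ h6.symm)
  rw [Pi.smul_apply, h4, h5, smul_eq_mul, ← mul_assoc]
  congr 1
  rw [gaugeFun, gaugeFun, gaugeFun, ← Complex.exp_add, inner_sub_right, inner_neg_right]
  congr 1
  push_cast
  ring

/-- The phases picked up by U and by U* cancel, so conjugation preserves periodicity although the
plane wave itself need not be periodic. -/
theorem commute_conj_gauge (v r : Space d) (s : ℝ) {X : L2 d →L[ℂ] L2 d}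
    (hX : Commute X (translation r)) :
    Commute (mulOp (gaugeFun v s) * X * ContinuousLinearMap.adjoint (mulOp (gaugeFun v s)))
      (translation r) := by
  set U := mulOp (gaugeFun v s) with hU
  set τ : L2 d →L[ℂ] L2 d := translation r with hτ
  set c := gaugeFun v s (-r) with hc
  have h1 : τ * U = c • (U * τ) := translation_mul_mulOp_gaugeFun v r s
  have h2 : U * ContinuousLinearMap.adjoint U = 1 := mulOp_gaugeFun_mul v s
  have h3 : ContinuousLinearMap.adjoint U * U = 1 := adjoint_mul_mulOp_gaugeFun v s
  have h4 : ContinuousLinearMap.adjoint U * τ = c • (τ * ContinuousLinearMap.adjoint U) := by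
    calc ContinuousLinearMap.adjoint U * τ
        = ContinuousLinearMap.adjoint U * (τ * U) * ContinuousLinearMap.adjoint U := by
          rw [mul_assoc, mul_assoc, h2, mul_one]
      _ = c • (ContinuousLinearMap.adjoint U * U * τ * ContinuousLinearMap.adjoint U) := by
          rw [h1, mul_smul_comm, smul_mul_assoc]
          simp only [mul_assoc]
      _ = _ := by rw [h3, one_mul]
  change U * X * ContinuousLinearMap.adjoint U * τ = τ * (U * X * ContinuousLinearMap.adjoint U)
  calc U * X * ContinuousLinearMap.adjoint U * τ
      = c • (U * (X * τ) * ContinuousLinearMap.adjoint U) := by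
        rw [mul_assoc (U * X), h4, mul_smul_comm]
        simp only [mul_assoc]
    _ = c • (U * τ) * X * ContinuousLinearMap.adjoint U := by
        rw [hX.eq, smul_mul_assoc, smul_mul_assoc]
        simp only [mul_assoc]
    _ = _ := by
        rw [← h1]
        simp only [mul_assoc]

/-! ### Locally Hilbert-Schmidt operators -/

theorem coeFn_map_sum {ι : Type*} (s : Finset ι) (X : L2 d →L[ℂ] L2 d) (b : ι → L2 d)
    (c : ι → ℂ) : X (∑ i ∈ s, c i • b i) =ᵐ[volume] fun x => ∑ i ∈ s, c i * X (b i) x := by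
  classical
  induction s using Finset.induction_on with
  | empty =>
    simp only [Finset.sum_empty, map_zero]
    exact Lp.coeFn_zero _ _ _
  | insert a s ha ih =>
    rw [Finset.sum_insert ha, map_add, map_smul]
    filter_upwards [ih, Lp.coeFn_add (c a • X (b a)) (X (∑ i ∈ s, c i • b i)),
      Lp.coeFn_smul (c a) (X (b a))] with x h1 h2 h3
    rw [h2, Pi.add_apply, h3, h1, Finset.sum_insert ha, Pi.smul_apply, smul_eq_mul]

/-- An operator from `L²` to `L^∞` is pointwise Hilbert-Schmidt. -/
theorem ae_sum_norm_sq_le {X : L2 d →L[ℂ] L2 d} {C : ℝ}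
    (hX : ∀ ψ, ∀ᵐ x, ‖X ψ x‖ ≤ C * ‖ψ‖) {ι : Type*} [Fintype ι] {b : ι → L2 d}
    (hb : Orthonormal ℂ b) : ∀ᵐ x, ∑ i, ‖X (b i) x‖ ^ 2 ≤ C ^ 2 := by
  -- The exceptional null set depends on the coefficients; a countable dense family of them leaves
  -- one null set, and continuity recovers all coefficients at the remaining x.
  have h1 : ∀ n : ℕ, ∀ᵐ x, ‖∑ i, TopologicalSpace.denseSeq (ι → ℂ) n i * X (b i) x‖ ≤
      C * ‖∑ i, TopologicalSpace.denseSeq (ι → ℂ) n i • b i‖ := by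
    intro n
    filter_upwards [hX (∑ i, TopologicalSpace.denseSeq (ι → ℂ) n i • b i),
      coeFn_map_sum Finset.univ X b (TopologicalSpace.denseSeq (ι → ℂ) n)] with x h2 h3
    rwa [h3] at h2
  filter_upwards [ae_all_iff.2 h1] with x hx
  have h2 : ∀ c : ι → ℂ, ‖∑ i, c i * X (b i) x‖ ≤ C * ‖∑ i, c i • b i‖ := fun c =>
    (TopologicalSpace.denseRange_denseSeq (ι → ℂ)).induction_on
      (p := fun c => ‖∑ i, c i * X (b i) x‖ ≤ C * ‖∑ i, c i • b i‖) c
      (isClosed_le (by fun_prop) (by fun_prop)) hx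
  set S := ∑ i, ‖X (b i) x‖ ^ 2 with hS
  have hS0 : 0 ≤ S := Finset.sum_nonneg fun i _ => sq_nonneg _
  -- Choosing the conjugate values as coefficients gives S ≤ C·S^{1/2}, by duality in ℓ².
  have h3 := h2 fun i => (starRingEnd ℂ) (X (b i) x)
  have h4 : ∑ i, (starRingEnd ℂ) (X (b i) x) * X (b i) x = (S : ℂ) := by
    rw [hS]
    push_cast
    exact Finset.sum_congr rfl fun i _ => Complex.conj_mul' _
  have h5 : ‖∑ i, (starRingEnd ℂ) (X (b i) x) • b i‖ ^ 2 = S := by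
    have h6 := hb.inner_sum (fun i => (starRingEnd ℂ) (X (b i) x))
      (fun i => (starRingEnd ℂ) (X (b i) x)) Finset.univ
    rw [inner_self_eq_norm_sq_to_K] at h6
    have h7 : ∑ i, (starRingEnd ℂ) ((starRingEnd ℂ) (X (b i) x)) *
        (starRingEnd ℂ) (X (b i) x) = (S : ℂ) := by
      rw [← h4]
      exact Finset.sum_congr rfl fun i _ => by rw [Complex.conj_conj, mul_comm]
    rw [h7] at h6
    rw [← RCLike.ofReal_pow] at h6
    exact Complex.ofReal_injective h6
  rw [h4, Complex.norm_real, Real.norm_of_nonneg hS0] at h3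
  have h8 : S ^ 2 ≤ C ^ 2 * S := by
    calc S ^ 2 ≤ (C * ‖∑ i, (starRingEnd ℂ) (X (b i) x) • b i‖) ^ 2 := by gcongr
      _ = C ^ 2 * S := by rw [mul_pow, h5]
  rcases hS0.eq_or_lt with h0 | h0
  · rw [← h0]
    positivity
  · nlinarith

theorem hsNormSq_mulOp_mul_le {X : L2 d →L[ℂ] L2 d} {C : ℝ}
    (hX : ∀ ψ, ∀ᵐ x, ‖X ψ x‖ ≤ C * ‖ψ‖) {χ : Space d → ℂ}
    (hχ : MemLp χ ⊤ (volume : Measure (Space d))) :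
    hsNormSq (mulOp χ * X) ≤ ENNReal.ofReal (C ^ 2) * l2sq χ := by
  rw [hsNormSq, ENNReal.tsum_eq_iSup_sum]
  refine iSup_le fun F => ?_
  have hb : Orthonormal ℂ fun i : F => onb (L2 d) i :=
    (onb (L2 d)).orthonormal.comp _ Subtype.coe_injective
  have h1 : ∀ i, ‖(mulOp χ * X) (onb (L2 d) i)‖ₑ ^ 2 =
      ∫⁻ x, ‖χ x‖ₑ ^ 2 * ‖X (onb (L2 d) i) x‖ₑ ^ 2 := by
    intro i
    rw [show (mulOp χ * X) (onb (L2 d) i) = mulOp χ (X (onb (L2 d) i)) from rfl,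
      enorm_sq_eq_l2sq (coeFn_mulOp hχ _), l2sq]
    simp only [enorm_mul, mul_pow]
  have hm : AEMeasurable (fun x => ‖χ x‖ₑ ^ 2) volume := hχ.1.enorm.pow_const 2
  simp only [h1]
  rw [← lintegral_finsetSum' _ fun i _ => (by exact hm.mul ((Lp.aestronglyMeasurable _).enorm.pow_const 2)),
    l2sq, ← lintegral_const_mul' _ _ ENNReal.ofReal_ne_top]
  refine lintegral_mono_ae ?_
  filter_upwards [ae_sum_norm_sq_le hX hb] with x hx
  rw [← Finset.mul_sum, mul_comm]
  gcongr
  simp only [enorm_sq_eq_ofReal]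
  rw [← ENNReal.ofReal_sum_of_nonneg fun i _ => sq_nonneg _]
  refine ENNReal.ofReal_le_ofReal ?_
  rwa [← Finset.sum_coe_sort F fun i => ‖X (onb (L2 d) i) x‖ ^ 2]

theorem l2sq_lt_top_of_memLp_top {χ : Space d → ℂ} (hχ : MemLp χ ⊤ (volume : Measure (Space d)))
    {S : Set (Space d)} (hS : Bornology.IsBounded S) (hχS : ∀ x ∉ S, χ x = 0) : l2sq χ < ⊤ := by
  obtain ⟨ρ, hρ⟩ := hS.subset_closedBall 0
  obtain ⟨C, hC⟩ : ∃ C : ENNReal, C < ⊤ ∧ ∀ᵐ x, ‖χ x‖ₑ ≤ C :=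
    ⟨eLpNorm χ ⊤ volume, hχ.2, by
      rw [eLpNorm_exponent_top]; exact ae_le_eLpNormEssSup⟩
  calc l2sq χ ≤ ∫⁻ x, (Metric.closedBall (0 : Space d) ρ).indicator (fun _ => C ^ 2) x := by
        refine lintegral_mono_ae ?_
        filter_upwards [hC.2] with x hx
        by_cases h : x ∈ Metric.closedBall (0 : Space d) ρ
        · rw [indicator_of_mem h]
          gcongr
        · rw [hχS x fun h' => h (hρ h')]
          simp
    _ = C ^ 2 * volume (Metric.closedBall (0 : Space d) ρ) := by
        rw [lintegral_indicator Metric.isClosed_closedBall.measurableSet, lintegral_const,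
          Measure.restrict_apply_univ]
    _ < ⊤ := ENNReal.mul_lt_top (ENNReal.pow_lt_top hC.1) measure_closedBall_lt_top

theorem hsNormSq_mulOp_mul_lt_top {X : L2 d →L[ℂ] L2 d} {C : ℝ}
    (hX : ∀ ψ, ∀ᵐ x, ‖X ψ x‖ ≤ C * ‖ψ‖) {χ : Space d → ℂ}
    (hχ : MemLp χ ⊤ (volume : Measure (Space d))) {S : Set (Space d)}
    (hS : Bornology.IsBounded S) (hχS : ∀ x ∉ S, χ x = 0) : hsNormSq (mulOp χ * X) < ⊤ :=
  (hsNormSq_mulOp_mul_le hX hχ).trans_lt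
    (ENNReal.mul_lt_top ENNReal.ofReal_lt_top (l2sq_lt_top_of_memLp_top hχ hS hχS))

/-- Since ‖|B|x‖ = ‖Bx‖, the relation Bγ = B passes to |B|, and by self-adjointness |B| = γ|B|γ.
Then χ|B|χ = (χγ)(|B|γχ) is a product of two Hilbert–Schmidt operators. -/
theorem isLocallyTraceClass_absOp {γ B : L2 d →L[ℂ] L2 d} (hγ : IsStarProjection γ)
    (hB : B * γ = B) (hs : ∀ χ : Space d → ℂ, MemLp χ ⊤ (volume : Measure (Space d)) →
      HasCompactSupport χ → hsNormSq (mulOp χ * γ) < ⊤) : IsLocallyTraceClass (absOp B) := by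
  intro χ hχ hχc
  have hγa : ContinuousLinearMap.adjoint γ = γ := hγ.isSelfAdjoint
  have h1 : absOp B * γ = absOp B := by
    ext1 x
    have h2 : B (γ x - x) = 0 := by
      rw [map_sub, sub_eq_zero]
      exact congrArg (fun S : L2 d →L[ℂ] L2 d => S x) hB
    have h3 := norm_absOp_apply B (γ x - x)
    rw [h2, norm_zero, norm_eq_zero, map_sub, sub_eq_zero] at h3
    exact h3
  have h2 : γ * absOp B = absOp B := by
    have h3 := congrArg ContinuousLinearMap.adjoint h1
    rwa [adjoint_mul, absOp_adjoint, hγa] at h3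
  have h3 : hsNormSq (γ * mulOp χ) < ⊤ := by
    rw [← hsNormSq_adjoint, adjoint_mul, adjoint_mulOp hχ, hγa]
    exact hs _ hχ.star (hχc.comp_left (map_zero _))
  have h4 : mulOp χ * absOp B * mulOp χ = (mulOp χ * γ) * (absOp B * (γ * mulOp χ)) := by
    rw [← mul_assoc (absOp B), h1, mul_assoc (mulOp χ) γ, ← mul_assoc γ, h2, mul_assoc]
  rw [h4]
  exact isTraceClass_mul (hs χ hχ hχc) (hsNormSq_mul_lt_top _ h3)

/-! ### The unit cell -/

section Cell

variable {R : Submodule ℤ (Space d)} [DiscreteTopology R] [IsZLattice ℝ R] {Ω : Set (Space d)}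
  (hΩ : IsAddFundamentalDomain R Ω (volume : Measure (Space d)))
include hΩ

omit [DiscreteTopology R] [IsZLattice ℝ R] in
theorem memLp_indicator_cell :
    MemLp (Ω.indicator fun _ => (1 : ℂ)) ⊤ (volume : Measure (Space d)) := by
  refine memLp_top_of_bound (aestronglyMeasurable_const.indicator₀ hΩ.nullMeasurableSet) 1
    (.of_forall fun x => ?_)
  by_cases h : x ∈ Ω
  · simp [indicator_of_mem h]
  · simp [indicator_of_notMem h]

theorem isCellProjection : IsCellProjection (fun r : R => translation (r : Space d))
    (mulOp (Ω.indicator fun _ => 1)) := by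
  have hm := memLp_indicator_cell hΩ
  refine ⟨fun r => by rw [adjoint_translation]; rfl, ?_, fun ψ => ?_⟩
  · rw [adjoint_mulOp hm]
    congr 1
    funext x
    by_cases h : x ∈ Ω
    · simp [indicator_of_mem h]
    · simp [indicator_of_notMem h]
  · rw [enorm_sq_eq_l2sq (Filter.EventuallyEq.refl _ ψ), l2sq, hΩ.lintegral_eq_tsum']
    refine tsum_congr fun r => ?_
    have h1 : mulOp (Ω.indicator fun _ => 1) (translation (r : Space d) ψ) =ᵐ[volume]
        fun x => Ω.indicator (fun _ => (1 : ℂ)) x * ψ (x - r) := by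
      filter_upwards [coeFn_mulOp hm (translation (r : Space d) ψ),
        coeFn_translation (r : Space d) ψ] with x h2 h3
      rw [h2, h3]
    rw [enorm_sq_eq_l2sq h1, l2sq, ← lintegral_indicator₀ hΩ.nullMeasurableSet]
    refine lintegral_congr fun x => ?_
    by_cases h : x ∈ Ω
    · rw [indicator_of_mem h, indicator_of_mem h, one_mul, sub_eq_neg_add]
      rfl
    · rw [indicator_of_notMem h, indicator_of_notMem h, zero_mul]
      simp

end Cell

/-! ### The truncated operator T 𝟙(T ≤ μ). -/

section HilbertSpace

variable {𝓗 : Type*} [NormedAddCommGroup 𝓗] [InnerProductSpace ℂ 𝓗] [CompleteSpace 𝓗]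

variable {E : ProjectionValuedMeasure 𝓗} {T : 𝓗 →ₗ.[ℂ] 𝓗} (hT : E.IsSpectralMeasureOf T)
  {μ : ℝ} {L : 𝓗 →L[ℂ] 𝓗} (hL : ∀ x, (E.proj (Iic μ) x, L x) ∈ T.graph)

include hT hL

namespace ProjectionValuedMeasure

theorem IsSpectralMeasureOf.proj_Iic_clm_apply (x : 𝓗) : E.proj (Iic μ) (L x) = L x := by
  obtain ⟨y, hy, hy'⟩ := T.mem_graph_iff.1 (hL x)
  dsimp only at hy hy'
  have h1 := hT.map_proj (C := Iic μ) measurableSet_Iic y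
  rw [hy'] at h1
  rw [← h1, ← hy']
  congr 1
  refine Subtype.ext ?_
  change E.proj (Iic μ) y = y
  rw [hy, E.proj_proj_self measurableSet_Iic]

theorem IsSpectralMeasureOf.inner_proj_Iic_clm (x : 𝓗) :
    ∃ q : ℝ, ⟪x, L x⟫_ℂ = q ∧ q ≤ μ * ‖E.proj (Iic μ) x‖ ^ 2 := by
  obtain ⟨y, hy, hy'⟩ := T.mem_graph_iff.1 (hL x)
  dsimp only at hy hy'
  have h1 : ⟪x, L x⟫_ℂ = ⟪(y : 𝓗), T y⟫_ℂ := by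
    rw [← hT.proj_Iic_clm_apply hL, ← E.inner_proj_left measurableSet_Iic, hy, hy']
  have h2 : (⟪(y : 𝓗), T y⟫_ℂ).re ≤ μ * ‖(y : 𝓗)‖ ^ 2 :=
    hT.re_inner_le measurableSet_Iic (fun s hs => hs) (by
      rw [hy]; exact E.proj_proj_self measurableSet_Iic x)
  rw [h1, ← hy]
  refine ⟨_, hT.2 y, ?_⟩
  rwa [hT.2 y, Complex.ofReal_re] at h2

theorem IsSpectralMeasureOf.clm_sub_nonpos : L - (μ : ℂ) • E.proj (Iic μ) ≤ 0 := by
  rw [← neg_nonneg, ContinuousLinearMap.nonneg_iff_isPositive,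
    ContinuousLinearMap.isPositive_iff_complex]
  intro x
  obtain ⟨q, hq, hq'⟩ := hT.inner_proj_Iic_clm hL x
  have h1 : ⟪(-(L - (μ : ℂ) • E.proj (Iic μ))) x, x⟫_ℂ =
      ((μ * ‖E.proj (Iic μ) x‖ ^ 2 - q : ℝ) : ℂ) := by
    rw [← inner_conj_symm]
    simp only [neg_apply, sub_apply, smul_apply, inner_neg_right, inner_sub_right,
      inner_smul_right, hq, E.inner_proj_self measurableSet_Iic]
    rw [← Complex.ofReal_mul, ← Complex.ofReal_sub, ← Complex.ofReal_neg, Complex.conj_ofReal,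
      neg_sub]
  rw [h1]
  refine ⟨by rw [RCLike.re_to_complex, Complex.ofReal_re], ?_⟩
  rw [RCLike.re_to_complex, Complex.ofReal_re]
  linarith

/-- The truncated operator `(T - μ) 𝟙(T ≤ μ)` is below `T - μ`. -/
theorem IsSpectralMeasureOf.re_inner_clm_sub_le {x y : 𝓗} (hxy : (x, y) ∈ T.graph) :
    (⟪x, (L - (μ : ℂ) • E.proj (Iic μ)) x⟫_ℂ).re ≤ (⟪x, y - (μ : ℂ) • x⟫_ℂ).re := by
  obtain ⟨z, rfl, rfl⟩ := T.mem_graph_iff.1 hxy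
  have hI : MeasurableSet (Iic μ) := measurableSet_Iic
  set z₁ : T.domain := ⟨E.proj (Iic μ) z, hT.proj_mem hI z.2⟩ with hz₁
  set z₂ : T.domain := ⟨E.proj (Iic μ)ᶜ z, hT.proj_mem hI.compl z.2⟩ with hz₂
  have hp₁ : E.proj (Iic μ) z₁ = z₁ := E.proj_proj_self hI _
  have hp₂ : E.proj (Iic μ)ᶜ z₂ = z₂ := E.proj_proj_self hI.compl _
  have hz : z = z₁ + z₂ := Subtype.ext (E.proj_add_proj_compl hI (z : 𝓗)).symm
  have hLz : L z = T z₁ := by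
    obtain ⟨y, hy, hy'⟩ := T.mem_graph_iff.1 (hL z)
    dsimp only at hy hy'
    rw [← hy']
    congr 1
    exact Subtype.ext hy
  -- Cross terms vanish, so truncation merely discards the contribution of z₂, where T − μ is
  -- nonnegative.
  have h1 : ⟪(z : 𝓗), T z⟫_ℂ = ⟪(z₁ : 𝓗), T z₁⟫_ℂ + ⟪(z₂ : 𝓗), T z₂⟫_ℂ := by
    rw [hz, T.map_add, Submodule.coe_add, inner_add_left, inner_add_right, inner_add_right,
      hT.inner_eq_zero hI hI.compl disjoint_compl_right hp₁ hp₂,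
      hT.inner_eq_zero hI.compl hI disjoint_compl_left hp₂ hp₁]
    ring
  have h2 : ⟪(z : 𝓗), L z⟫_ℂ = ⟪(z₁ : 𝓗), T z₁⟫_ℂ := by
    rw [← hT.proj_Iic_clm_apply hL, ← E.inner_proj_left hI, hLz]
  have h3 : μ * ‖(z₂ : 𝓗)‖ ^ 2 ≤ (⟪(z₂ : 𝓗), T z₂⟫_ℂ).re :=
    hT.le_re_inner hI.compl (fun s hs => (not_le.1 (show ¬s ≤ μ from hs)).le) hp₂
  have h4 : ‖(z : 𝓗)‖ ^ 2 = ‖(z₁ : 𝓗)‖ ^ 2 + ‖(z₂ : 𝓗)‖ ^ 2 := E.norm_sq_eq_add hI (z : 𝓗)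
  have h5 : ⟪(z : 𝓗), (z : 𝓗)⟫_ℂ = ((‖(z : 𝓗)‖ ^ 2 : ℝ) : ℂ) := by
    rw [inner_self_eq_norm_sq_to_K]
    norm_cast
  have h6 : ⟪(z : 𝓗), E.proj (Iic μ) z⟫_ℂ = ((‖(z₁ : 𝓗)‖ ^ 2 : ℝ) : ℂ) := E.inner_proj_self hI _
  simp only [sub_apply, smul_apply, inner_sub_right, inner_smul_right, h2, h1, h5, h6,
    Complex.sub_re, Complex.add_re, Complex.re_ofReal_mul, Complex.ofReal_re]
  rw [h4]
  linarith

omit hL in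
theorem IsSpectralMeasureOf.im_inner_sub_eq_zero {x y : 𝓗} (hxy : (x, y) ∈ T.graph) :
    (⟪x, y - (μ : ℂ) • x⟫_ℂ).im = 0 := by
  obtain ⟨z, rfl, rfl⟩ := T.mem_graph_iff.1 hxy
  rw [inner_sub_right, inner_smul_right, hT.2 z, inner_self_eq_norm_sq_to_K]
  simp [← Complex.ofReal_pow, ← Complex.ofReal_mul]

omit hL in
theorem IsSpectralMeasureOf.proj_Iio_eq_zero_of_graph {G : Submodule ℂ (𝓗 × 𝓗)}
    (hG : T.graph = G.topologicalClosure) {e κ : ℝ} (hκ : 0 < κ)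
    (h : ∀ e', e ≤ e' → ∀ p ∈ G, κ * ‖p.1‖ ≤ ‖p.2 + (e' : ℂ) • p.1‖) (x : 𝓗) :
    E.proj (Iio (-e)) x = 0 :=
  hT.proj_Iio_eq_zero hκ (fun e' he' x =>
    le_norm_of_mem_closure (h e' he') ((x : 𝓗), T x) (hG ▸ T.mem_graph x)) x

end ProjectionValuedMeasure

end HilbertSpace

/-! ### The current of the ground state. -/

theorem tracePerVolume_zero (Ω : Set (Space d)) : tracePerVolume Ω (0 : L2 d →L[ℂ] L2 d) = 0 := by
  simp [tracePerVolume, trace]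

theorem memSOnePer_zero (R : Submodule ℤ (Space d)) : MemSOnePer R (0 : L2 d →L[ℂ] L2 d) := by
  refine ⟨fun r _ => Commute.zero_left _, isLocallyTraceClass_absOp (γ := 0) (.zero _) (by simp)
    fun χ _ _ => ?_⟩
  simp [hsNormSq]

section Current

theorem trace_current_eq_zero {R : Submodule ℤ (Space d)} [DiscreteTopology R] [IsZLattice ℝ R]
    {Ω : Set (Space d)} (hΩ : IsUnitCell R Ω) {T : L2 d →ₗ.[ℂ] L2 d}
    {E : ProjectionValuedMeasure (L2 d)} (hT : E.IsSpectralMeasureOf T) {μ : ℝ} (v : Space d)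
    {L B : L2 d →L[ℂ] L2 d} (hL : ∀ x, (E.proj (Iic μ) x, L x) ∈ T.graph)
    (hLγ : L * E.proj (Iic μ) = L) (hBγ : B * E.proj (Iic μ) = B)
    (hγτ : ∀ r ∈ R, Commute (E.proj (Iic μ)) (translation r))
    (hLτ : ∀ r ∈ R, Commute L (translation r)) (hBτ : ∀ r ∈ R, Commute B (translation r))
    {c C : ℝ} (hsup : ∀ ψ, ∀ᵐ x, ‖E.proj (Iic μ) ψ x‖ ≤ C * ‖ψ‖)
    (hU : ∀ (s : ℝ) ψ, (mulOp (gaugeFun v s) (E.proj (Iic μ) ψ), mulOp (gaugeFun v s)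
      (L ψ - (s : ℂ) • B ψ + ((s ^ 2 * c : ℝ) : ℂ) • E.proj (Iic μ) ψ)) ∈ T.graph) :
    tracePerVolume Ω B = 0 := by
  have hγ : IsStarProjection (E.proj (Iic μ)) := E.isStarProjection _ measurableSet_Iic
  have hP := isCellProjection hΩ.2
  have hm := memLp_indicator_cell hΩ.2
  have hγP : hsNormSq (E.proj (Iic μ) * mulOp (Ω.indicator fun _ => 1)) < ⊤ := by
    rw [← hsNormSq_adjoint, adjoint_mul, hP.adjoint_P, hγ.isSelfAdjoint.adjoint_eq]
    exact hsNormSq_mulOp_mul_lt_top hsup hm hΩ.1 fun x hx => indicator_of_notMem hx _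
  -- The transformed state γ_s maps into the domain of T, and (T − μ)γ_s is the conjugated operator
  -- of the variational argument; its hypotheses thus reduce to comparing forms of T − μ and of its
  -- truncation.
  have hpair : ∀ (s : ℝ) ψ, ∃ y, ((mulOp (gaugeFun v s) * E.proj (Iic μ) *
      ContinuousLinearMap.adjoint (mulOp (gaugeFun v s))) ψ, y) ∈ T.graph ∧
      (mulOp (gaugeFun v s) * (L - (μ : ℂ) • E.proj (Iic μ) + (s : ℂ) • -B +
        ((s ^ 2 * c : ℝ) : ℂ) • E.proj (Iic μ)) *
        ContinuousLinearMap.adjoint (mulOp (gaugeFun v s))) ψ =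
        y - (μ : ℂ) • (mulOp (gaugeFun v s) * E.proj (Iic μ) *
          ContinuousLinearMap.adjoint (mulOp (gaugeFun v s))) ψ := by
    intro s ψ
    refine ⟨_, hU s (ContinuousLinearMap.adjoint (mulOp (gaugeFun v s)) ψ), ?_⟩
    generalize mulOp (gaugeFun v s) = U
    generalize E.proj (Iic μ) = γ
    simp only [mul_apply_eq_comp, add_apply, sub_apply, smul_apply, neg_apply, map_add, map_sub,
      map_smul, map_neg]
    module
  -- Applied to −B because the gauge identity contributes −s B.
  have hJ0 : cellTrace (mulOp (Ω.indicator fun _ => 1)) (-B) = 0 := by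
    refine hP.cellTrace_eq_zero hγ (fun r => hγτ r r.2) hγP (K := L - (μ : ℂ) • E.proj (Iic μ))
      ?_ ?_ (fun r => (hLτ r r.2).sub_left ((hγτ r r.2).smul_left _))
      (fun r => (hBτ r r.2).neg_left) (hT.clm_sub_nonpos hL) c (fun s => mulOp (gaugeFun v s))
      (mulOp_gaugeFun_mul v) (adjoint_mul_mulOp_gaugeFun v)
      (fun s => commute_mulOp (memLp_gaugeFun v s) hm)
      (fun s X hX r => commute_conj_gauge v r s (hX r)) (fun s ψ => ?_) (fun s ψ => ?_)
    · rw [sub_mul, hLγ, smul_mul_assoc, hγ.isIdempotentElem.eq]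
    · rw [neg_mul, hBγ]
    · obtain ⟨y, hy, hy'⟩ := hpair s ψ
      rw [hy']
      exact hT.re_inner_clm_sub_le hL hy
    · obtain ⟨y, hy, hy'⟩ := hpair s ψ
      rw [hy']
      exact hT.im_inner_sub_eq_zero hy
  rw [tracePerVolume, hP.trace_eq_cellTrace]
  have h2 : cellTrace (mulOp (Ω.indicator fun _ => 1)) B =
      -cellTrace (mulOp (Ω.indicator fun _ => 1)) (-B) := by
    rw [cellTrace, cellTrace, ← tsum_neg]
    refine tsum_congr fun i => ?_
    rw [neg_apply, inner_neg_right, neg_neg]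
  rw [h2, hJ0, neg_zero, mul_zero]

theorem commute_of_mem_graph {T : L2 d →ₗ.[ℂ] L2 d} {γ L W : L2 d →L[ℂ] L2 d}
    (hL : ∀ x, (γ x, L x) ∈ T.graph) (hW : ∀ x y, (x, y) ∈ T.graph → (W x, W y) ∈ T.graph)
    (hγ : Commute γ W) : Commute L W :=
  ContinuousLinearMap.ext fun ψ => T.mem_graph_snd_inj (hL (W ψ)) (hW _ _ (hL ψ))
    (congrArg (fun S : L2 d →L[ℂ] L2 d => S ψ) hγ.eq)

theorem mul_eq_of_mem_graph {T : L2 d →ₗ.[ℂ] L2 d} {γ L : L2 d →L[ℂ] L2 d}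
    (hL : ∀ x, (γ x, L x) ∈ T.graph) (hγ : ∀ x, γ (γ x) = γ x) : L * γ = L :=
  ContinuousLinearMap.ext fun ψ => T.mem_graph_snd_inj (hL (γ ψ)) (hL ψ) (hγ ψ)

variable (hd : d ≤ 3) {R : Submodule ℤ (Space d)} [DiscreteTopology R]
    [IsZLattice ℝ R] {Ω : Set (Space d)} (hΩ : IsUnitCell R Ω) {A : Space d → Space d}
    (hA : IsPeriodicLp R 4 A) {V : Space d → ℝ} (hV : IsPeriodicLp R 2 V) (hdiv : IsDivFree A)
include hd hΩ hA hV hdiv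

theorem isSelfAdjoint_hamiltonian : IsSelfAdjoint (hamiltonian A V) := by
  obtain ⟨e, h, hsymm, hdense, -⟩ := exists_hamiltonian_bounds hd hΩ hA hV hdiv
  obtain ⟨h1, -, h2, -⟩ := h e le_rfl
  exact hsymm.isSelfAdjoint_closure hdense e one_half_pos h1 h2

theorem exists_current_proj_Iic {T 𝒥 : L2 d →ₗ.[ℂ] L2 d} {v : Space d}
    (hTd : T = hamiltonian A V) (h𝒥 : 𝒥 = currentOperator A v)
    {E : ProjectionValuedMeasure (L2 d)} (hT : E.IsSpectralMeasureOf T) (μ : ℝ) :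
    ∃ B : L2 d →L[ℂ] L2 d, (∀ ψ, (E.proj (Iic μ) ψ, B ψ) ∈ 𝒥.graph) ∧ MemSOnePer R B ∧
      tracePerVolume Ω B = 0 := by
  obtain ⟨e, h, hsymm, hdense, hcur⟩ := exists_hamiltonian_bounds hd hΩ hA hV hdiv
  obtain ⟨hcs, hcd⟩ := hcur v
  obtain ⟨h1, hsup, -, hJ⟩ := h e le_rfl
  obtain ⟨C, hC⟩ := hJ v
  have hHg : T.graph = (hamGraph A V).topologicalClosure := by
    rw [hTd]
    exact hsymm.graph_closure hdense
  have hJg : 𝒥.graph = (curGraph A v).topologicalClosure := by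
    rw [h𝒥]
    exact hcs.graph_closure hcd
  clear hTd h𝒥
  have hM : ∀ x, E.proj (Iio (-e)) x = 0 := 
    hT.proj_Iio_eq_zero_of_graph hHg one_half_pos fun e' he' => (h e' he').1
  obtain ⟨L, hL⟩ := hT.exists_proj_Iic_clm hM μ
  have hLb : ∀ ψ, ‖L ψ + (e : ℂ) • E.proj (Iic μ) ψ‖ ≤ ‖L + (e : ℂ) • E.proj (Iic μ)‖ * ‖ψ‖ :=
    fun ψ => (L + (e : ℂ) • E.proj (Iic μ)).le_opNorm ψ
  have hL' : ∀ ψ, (E.proj (Iic μ) ψ, L ψ) ∈ (hamGraph A V).topologicalClosure := fun ψ => by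
    rw [← hHg]
    exact hL ψ
  have hgauge := fun ψ => gauge_mem_topologicalClosure hcs hcd hC (hL' ψ)
  -- J is bounded relative to H + e, and (H + e)γ is bounded, so Jγ is a bounded operator.
  obtain ⟨B, hB⟩ : ∃ B : L2 d →L[ℂ] L2 d, ∀ ψ, (E.proj (Iic μ) ψ, B ψ) ∈ 𝒥.graph := by
    refine exists_clm_of_graph _ (|C| * ‖L + (e : ℂ) • E.proj (Iic μ)‖) fun ψ => ?_
    obtain ⟨g, hg1, hg2, -⟩ := hgauge ψ
    refine ⟨g, by rw [hJg]; exact hg1, hg2.trans ?_⟩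
    rw [mul_assoc]
    exact mul_le_mul (le_abs_self C) (hLb ψ) (norm_nonneg _) (abs_nonneg C)
  have hUg : ∀ (s : ℝ) ψ, (mulOp (gaugeFun v s) (E.proj (Iic μ) ψ), mulOp (gaugeFun v s)
      (L ψ - (s : ℂ) • B ψ + ((s ^ 2 * (‖v‖ ^ 2 / 2) : ℝ) : ℂ) • E.proj (Iic μ) ψ)) ∈
      T.graph := by
    intro s ψ
    obtain ⟨g, hg1, -, hg3⟩ := hgauge ψ
    rw [← hJg] at hg1
    rw [hHg, 𝒥.mem_graph_snd_inj (hB ψ) hg1 rfl]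
    exact hg3 s
  have hτT : ∀ r ∈ R, ∀ x y, (x, y) ∈ T.graph → (translation r x, translation r y) ∈ T.graph := by
    intro r hr x y hxy
    rw [hHg] at hxy ⊢
    exact map_mem_topologicalClosure (translation r)
      (fun p hp => translation_mem_hamGraph hA hV hr hp) hxy
  have hτJ : ∀ r ∈ R, ∀ x y, (x, y) ∈ 𝒥.graph → (translation r x, translation r y) ∈ 𝒥.graph := by
    intro r hr x y hxy
    rw [hJg] at hxy ⊢
    exact map_mem_topologicalClosure (translation r)
      (fun p hp => translation_mem_curGraph hA v hr hp) hxy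
  have hγτ : ∀ r ∈ R, Commute (E.proj (Iic μ)) (translation r) := fun r hr =>
    hT.proj_Iic_commute hM μ _ (hτT r hr) fun x y hxy => by
      rw [adjoint_translation]
      exact hτT _ (R.neg_mem hr) x y hxy
  have hγγ : ∀ x, E.proj (Iic μ) (E.proj (Iic μ) x) = E.proj (Iic μ) x :=
    E.proj_proj_self measurableSet_Iic
  -- The sup bound on the domain of H, combined with boundedness of (H + e)γ: γ maps L² into L^∞,
  -- hence is locally Hilbert–Schmidt.
  have hγsup : ∀ ψ, ∀ᵐ x, ‖E.proj (Iic μ) ψ x‖ ≤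
      (2 * ‖L + (e : ℂ) • E.proj (Iic μ)‖) * ‖ψ‖ := by
    intro ψ
    filter_upwards [ae_norm_le_of_mem_closure hsup (hL' ψ)] with x hx
    refine hx.trans ?_
    rw [mul_assoc]
    exact mul_le_mul_of_nonneg_left (hLb ψ) zero_le_two
  have hBτ : ∀ r ∈ R, Commute B (translation r) := fun r hr =>
    commute_of_mem_graph hB (hτJ r hr) (hγτ r hr)
  have hBγ := mul_eq_of_mem_graph hB hγγ
  refine ⟨B, hB, ⟨hBτ, isLocallyTraceClass_absOp (E.isStarProjection _ measurableSet_Iic) hBγ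
    fun χ hχ hχc => hsNormSq_mulOp_mul_lt_top hγsup hχ hχc.isCompact.isBounded
      fun x hx => image_eq_zero_of_notMem_tsupport hx⟩, ?_⟩
  exact trace_current_eq_zero hΩ hT v hL (mul_eq_of_mem_graph hL hγγ) hBγ hγτ
    (fun r hr => commute_of_mem_graph hL (hτT r hr) (hγτ r hr)) hBτ hγsup hUg

/-- The ground state of a periodic system carries no current. -/
theorem exists_current_groundState (μ : ℝ) (v : Space d) : ∃ B : L2 d →L[ℂ] L2 d,
    (∀ ψ, (groundState A V μ ψ, B ψ) ∈ (currentOperator A v).graph) ∧ MemSOnePer R B ∧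
      tracePerVolume Ω B = 0 := by
  by_cases hsp : HasSpectralMeasure (hamiltonian A V)
  · rw [groundState, spectralProjectionLE, dif_pos hsp]
    exact exists_current_proj_Iic hd hΩ hA hV hdiv rfl rfl hsp.choose_spec μ
  -- With no spectral measure the ground state is 0 by definition, and B = 0 satisfies every
  -- requirement.
  · rw [groundState, spectralProjectionLE, dif_neg hsp]
    exact ⟨0, fun ψ => (currentOperator A v).graph.zero_mem, memSOnePer_zero R,
      tracePerVolume_zero Ω⟩

theorem hasCurrent_zero {μ : ℝ} {a b : Space d} {ε t : ℝ}
    (h : densityMatrix A V μ b ε t = groundState A V μ) : HasCurrent R Ω A V μ a b ε t 0 := by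
  obtain ⟨B, h1, h2, h3⟩ := exists_current_groundState hd hΩ hA hV hdiv μ a
  exact ⟨B, by rwa [h], h2, h3⟩

end Current

theorem densityMatrix_zero_field (A : Space d → Space d) (V : Space d → ℝ) (μ : ℝ) (b : Space d)
    (t : ℝ) : densityMatrix A V μ b 0 t = groundState A V μ := by
  have h1 : fieldHamiltonian A V b 0 = hamiltonian A V := by
    simp [fieldHamiltonian]
  rw [densityMatrix, groundState, h1, expI_mul_spectralProjectionLE_mul_expI]

theorem densityMatrix_zero_time (A : Space d → Space d) (V : Space d → ℝ) (μ : ℝ) (b : Space d)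
    (ε : ℝ) : densityMatrix A V μ b ε 0 = groundState A V μ := by
  rw [densityMatrix, neg_zero, expI_zero, one_mul, mul_one]

end BlochCurrent

end

theorem proposition1 {d : ℕ} (hd1 : 1 ≤ d) (hd3 : d ≤ 3)
    (R : Submodule ℤ (BlochCurrent.Space d)) [DiscreteTopology R] [IsZLattice ℝ R]
    (Ω : Set (BlochCurrent.Space d)) (hΩ : BlochCurrent.IsUnitCell R Ω)
    (A : BlochCurrent.Space d → BlochCurrent.Space d) (hA : BlochCurrent.IsPeriodicLp R 4 A)
    (hdiv : BlochCurrent.IsDivFree A)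
    (V : BlochCurrent.Space d → ℝ) (hV : BlochCurrent.IsPeriodicLp R 2 V)
    (μF : ℝ) (e : Module.Basis (Fin d) ℝ (BlochCurrent.Space d)) (α β : Fin d) :
    IsSelfAdjoint (BlochCurrent.hamiltonian A V) ∧
    (∀ t : ℝ, 0 ≤ t → BlochCurrent.HasCurrent R Ω A V μF (e α) (e β) 0 t 0) ∧
    (∀ ε : ℝ, 0 ≤ ε → BlochCurrent.HasCurrent R Ω A V μF (e α) (e β) ε 0 0) :=
  ⟨BlochCurrent.isSelfAdjoint_hamiltonian hd3 hΩ hA hV hdiv,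
    fun t _ => BlochCurrent.hasCurrent_zero hd3 hΩ hA hV hdiv
      (BlochCurrent.densityMatrix_zero_field A V μF (e β) t),
    fun ε _ => BlochCurrent.hasCurrent_zero hd3 hΩ hA hV hdiv
      (BlochCurrent.densityMatrix_zero_time A V μF (e β) ε)⟩
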